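/- **Setting.** Let $W=(w_1,\dots,w_n)$, $n\ge 3$ (indices modulo $n$), be a simple closed spherical polygon on $S^2\subset\mathbb R^3$ whose edges are great circle arcs of positive length less than $\pi$, and assume that $W$ is in general position, i.e. no three of its vertices lie on a common great circle. Equivalently, $W$ is the link of an embedded polyhedral vertex star, namely of the star $S(W)=\bigcup_i\{a w_i+b w_{i+1}: a,b\ge 0\}$ with apex $0$. The Gauss image of the star is the polar polygon $W'=(w'_1,\dots,w'_n)$, $w'_i=\frac{w_i\times w_{i+1}}{\|w_i\times w_{i+1}\|}$, whose consecutive vertices are connected by shortest great circle arcs. The winding number $w(W',\xi)\in\mathbb Z$ of $W'$ around $\xi\in S^2\setminus W'$ is the function determined by the following rules: (1) it is constant on each connected component of $S^2\setminus W'$; (2) it decreases by $1$ if $\xi$ crosses $W'$ from left to right; (3) it does not change under continuous deformations of $W$ through simple spherical polygons (where vertices may be inserted in or removed from the interior of an edge) as long as $\xi$ never lies on $W'$; (4) if $W$ is convex, it equals $1$ inside the region (of area less than $2\pi$) that $W'$ encloses. For $k\ge 1$ consider those components of $S^2\setminus W'$ on which $w(W',\cdot)\ge k$, and regard two of them as connected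 if they share a non-trivial part of an edge of $W'$ (but not if they only share a vertex of $W'$). The resulting connected sets are the positive layers of level $k$; $C_+^k$ is their number, and $C_+:=\sum_{k\ge1}C_+^k$ is the number of positive layers of $W'$. **Proposition.** $C_+\le 1$. If a positive layer $L$ exists, then it is the Gauss image of the boundary of the convex hull $C$ of the star $S(W)$. That is, there is a convex spherical polygon $V=(w_{i_1},\dots,w_{i_m})$ with $i_1<\dots<i_m$ such that $\partial C$ is the polyhedral vertex star $S(V)$ over $V$, the polar polygon $V'$ is a convex spherical polygon that turns left at each vertex, and $L$ is the open region that $V'$ encloses counterclockwise. In particular, $L$ is convex and contains no right turns: $W'$ turns left at each of its vertices that lies in the closure of $L$. -/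

import Mathlib

open Set Filter Topology

noncomputable section

/-- Euclidean three-space. -/
abbrev E3 : Type := EuclideanSpace ℝ (Fin 3)

/-- The unit sphere of Euclidean three-space. -/
def unitSphere : Set E3 := Metric.sphere 0 1

/-- The vector product of Euclidean three-space. -/
def cross (u v : E3) : E3 := WithLp.toLp 2 (crossProduct u.ofLp v.ofLp)

/-- The oriented volume `⟨a × b, c⟩`. For unit vectors, it is positive exactly when `c` lies to the
left of the oriented great circle that runs from `a` to `b` (seen from outside of the sphere). -/
def triple (a b c : E3) : ℝ := inner ℝ (cross a b) c

/-- The shortest great circle arc from `u` to `v`, for unit vectors `u ≠ -v`, with its ends. -/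
def arc (u v : E3) : Set E3 :=
  {x | x ∈ unitSphere ∧ ∃ a b : ℝ, 0 ≤ a ∧ 0 ≤ b ∧ x = a • u + b • v}

/-- The shortest great circle arc from `u` to `v`, for unit vectors `u ≠ ±v`, without its ends. -/
def openArc (u v : E3) : Set E3 :=
  {x | x ∈ unitSphere ∧ ∃ a b : ℝ, 0 < a ∧ 0 < b ∧ x = a • u + b • v}

/-- The union of the edges of the closed polygon with vertices `P 0, …, P (n - 1)`
(indices are read modulo `n`). -/
def trace {n : ℕ} [NeZero n] (P : Fin n → E3) : Set E3 := ⋃ i, arc (P i) (P (i + 1))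

/-- Simple closed spherical polygons. All edges have positive length less than `π`, and two
distinct edges have no point in common except the shared vertex if they are consecutive. -/
structure IsSimplePolygon {n : ℕ} [NeZero n] (W : Fin n → E3) : Prop where
  three_le : 3 ≤ n
  mem_sphere : ∀ i, W i ∈ unitSphere
  ne_succ : ∀ i, W (i + 1) ≠ W i
  ne_neg_succ : ∀ i, W (i + 1) ≠ -W i
  edges_disjoint : ∀ i j, i ≠ j → ∀ x, x ∈ arc (W i) (W (i + 1)) → x ∈ arc (W j) (W (j + 1)) →
    (j = i + 1 ∧ x = W j) ∨ (i = j + 1 ∧ x = W i)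

/-- No three vertices of the polygon lie on a common great circle. -/
def InGeneralPosition {n : ℕ} (W : Fin n → E3) : Prop :=
  ∀ i j k, i ≠ j → j ≠ k → i ≠ k → triple (W i) (W j) (W k) ≠ 0

/-- Convex spherical polygons: simple ones such that, for one of the two orientations, all other
vertices lie strictly to the left of the great circle through any edge. -/
structure IsConvexPolygon {n : ℕ} [NeZero n] (W : Fin n → E3) : Prop where
  simple : IsSimplePolygon W
  one_sided :
    (∀ i j, j ≠ i → j ≠ i + 1 → 0 < triple (W i) (W (i + 1)) (W j)) ∨
    (∀ i j, j ≠ i → j ≠ i + 1 → triple (W i) (W (i + 1)) (W j) < 0)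

/-- The polar polygon, i.e. the Gauss image of the polyhedral vertex star over `W`. Its vertices
are the unit normals `w'ᵢ` of the oriented planes through `0`, `wᵢ`, `wᵢ₊₁`. -/
def polar {n : ℕ} [NeZero n] (W : Fin n → E3) (i : Fin n) : E3 :=
  ‖cross (W i) (W (i + 1))‖⁻¹ • cross (W i) (W (i + 1))

/-- The points of the sphere to the left of all edges. For a convex polygon with left turns, this
is the open region that the polygon encloses counterclockwise (of area less than `2 * π`). -/
def leftRegion {n : ℕ} [NeZero n] (P : Fin n → E3) : Set E3 :=
  {ξ | ξ ∈ unitSphere ∧ ∀ i, 0 < triple (P i) (P (i + 1)) ξ}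

/-- The polyhedral vertex star with apex `0` over `W`: its faces are the planar convex cones that
are spanned by consecutive vertices. -/
def vertexStar {n : ℕ} [NeZero n] (W : Fin n → E3) : Set E3 :=
  ⋃ i, {x | ∃ a b : ℝ, 0 ≤ a ∧ 0 ≤ b ∧ x = a • W i + b • W (i + 1)}

/-- `HasWinding W ξ k`: the winding number of the polar polygon of the simple polygon `W` around the
point `ξ` (not on the polar polygon) is `k`. The winding number is the function that is determined
by the following rules, hence its graph is the least relation that is closed under them.
* It is `1` inside the region that is enclosed by the polar polygon if `W` is convex.
* It is constant on every connected component of the complement of the polar polygon.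
* It decreases by one if the polar polygon is crossed from left to right.
* It does not change under continuous deformations of `W` through simple polygons during which
  `ξ` never lies on the polar polygon. Here, inserting and removing vertices in the interior of an
  edge is allowed, and the choice of the first vertex is irrelevant.
Simple polygons can be deformed into convex ones, so every point off the polar polygon gets a value. -/
inductive HasWinding : {n : ℕ} → [NeZero n] → (Fin n → E3) → E3 → ℤ → Prop
  | convex {n : ℕ} [NeZero n] (W : Fin n → E3) (ξ : E3) (hW : IsConvexPolygon W)
      (hξ : ξ ∈ leftRegion (polar W)) : HasWinding W ξ 1
  | component {n : ℕ} [NeZero n] (W : Fin n → E3) (ξ η : E3) (k : ℤ)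
      (hη : η ∈ connectedComponentIn (unitSphere \ trace (polar W)) ξ)
      (h : HasWinding W ξ k) : HasWinding W η k
  | cross_left_to_right {n : ℕ} [NeZero n] (W : Fin n → E3) (ξ η x : E3) (i : Fin n) (k : ℤ)
      (hη : η ∈ unitSphere)
      (hleft : 0 < triple (polar W i) (polar W (i + 1)) ξ)
      (hright : triple (polar W i) (polar W (i + 1)) η < 0)
      (hx : arc ξ η ∩ trace (polar W) = {x})
      (hxi : x ∈ openArc (polar W i) (polar W (i + 1)))
      (hxj : ∀ j, j ≠ i → x ∉ arc (polar W j) (polar W (j + 1)))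
      (h : HasWinding W ξ k) : HasWinding W η (k - 1)
  | cross_right_to_left {n : ℕ} [NeZero n] (W : Fin n → E3) (ξ η x : E3) (i : Fin n) (k : ℤ)
      (hξ : ξ ∈ unitSphere)
      (hleft : 0 < triple (polar W i) (polar W (i + 1)) ξ)
      (hright : triple (polar W i) (polar W (i + 1)) η < 0)
      (hx : arc ξ η ∩ trace (polar W) = {x})
      (hxi : x ∈ openArc (polar W i) (polar W (i + 1)))
      (hxj : ∀ j, j ≠ i → x ∉ arc (polar W j) (polar W (j + 1)))
      (h : HasWinding W η k) : HasWinding W ξ (k + 1)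
  | deform {n : ℕ} [NeZero n] (H : unitInterval → Fin n → E3) (ξ : E3) (k : ℤ)
      (hcont : Continuous H) (hsimple : ∀ t, IsSimplePolygon (H t))
      (hξ : ∀ t, ξ ∉ trace (polar (H t)))
      (h : HasWinding (H 0) ξ k) : HasWinding (H 1) ξ k
  | insert_vertex {n : ℕ} [NeZero n] (W : Fin n → E3) (p ξ : E3) (k : ℤ)
      (hW : IsSimplePolygon W) (hp : p ∈ openArc (W (-1)) (W 0))
      (h : HasWinding W ξ k) : HasWinding (Fin.snoc (α := fun _ => E3) W p) ξ k
  | remove_vertex {n : ℕ} [NeZero n] (W : Fin n → E3) (p ξ : E3) (k : ℤ)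
      (hW : IsSimplePolygon W) (hp : p ∈ openArc (W (-1)) (W 0))
      (h : HasWinding (Fin.snoc (α := fun _ => E3) W p) ξ k) : HasWinding W ξ k
  | relabel {n : ℕ} [NeZero n] (W : Fin n → E3) (ξ : E3) (k : ℤ)
      (h : HasWinding W ξ k) : HasWinding (fun i => W (i + 1)) ξ k

/-- The components of the complement of the polar polygon with winding number at least `k`, together
with the points of the polar polygon, other than its vertices, near which the winding number is at
least `k` off the polar polygon. In this way, two components that share a part of an edge get
connected, while a vertex does not connect components. -/
def layerSet {n : ℕ} [NeZero n] (W : Fin n → E3) (k : ℕ) : Set E3 :=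
  {x | x ∈ unitSphere ∧ x ∉ range (polar W) ∧
    ∀ᶠ ξ in 𝓝[unitSphere \ trace (polar W)] x, ∃ m : ℤ, (k : ℤ) ≤ m ∧ HasWinding W ξ m}

/-- The connected components of the set of points with winding number at least `k`. For `k ≥ 1`,
these are the positive layers of level `k` of the polar polygon. -/
def layers {n : ℕ} [NeZero n] (W : Fin n → E3) (k : ℕ) : Set (Set E3) :=
  {L | ∃ x ∈ layerSet W k, L = connectedComponentIn (layerSet W k) x}

/-- The number `C₊` of positive layers of the polar polygon, summed over all levels `k ≥ 1`. -/
def numPositiveLayers {n : ℕ} [NeZero n] (W : Fin n → E3) : ℕ∞ :=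
  ∑' k : ℕ, (layers W (k + 1)).encard

end

/-! The winding number is given only by rules, so it is first compared with a closed formula. By
Gauss and Bonnet it should equal `polarIndex`: the edge lengths of `W` are the turning angles of its
polar polygon `W'`, and the signed areas of the triangles with apex `-ξ` over the edges of `W'` give
the area term. This index is continuous off `W'`, takes values in the half-integers, drops by 1 when
an edge of `W'` is crossed from left to right, and is 1 inside the polar of a convex polygon. So it
obeys every rule, and `HasWinding W ξ k` forces the index to be `k` (`HasWinding.polarIndex_eq`).
The existence of winding numbers at all points is never needed.

Let `ξ` be orthogonal to no vertex. Then 4π times the index equals 2π - 2πu + τ, where u counts the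
upward crossings of `W` through the great circle orthogonal to `ξ`, and τ is the total turn of the
edge directions of `W` in the central projection along `ξ` (`four_pi_mul_polarIndex`,
`turn_secant_secant`). The crossings cut `W` into 2u simple chains, and by a discrete form of Hopf's
argument each of them turns by less than π (`abs_sum_turn_chord_lt`). Hence u > 0 makes the index
less than 1/2. If u = 0, then `W` lies in an open hemisphere and projects to a simple planar polygon
with total turn ±2π; the index is 1 or 0 according to its orientation, which can be read off at any
hull vertex (`polarIndex_of_hemisphere`).

So a positive winding number is 1, and it occurs only where all products `σ * ⟪ξ, W i⟫` are
positive, for a sign σ fixed by the orientation of `W`. These points form a connected set,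
`dualRegion σ W`, which is the only possible positive layer (`exists_layerSet_eq`).

The region is the spherical dual of the convex hull of the star. Hopf's argument on a rectangle of
secants shows that `W` visits its hull vertices in the cyclic order of the hull
(`IsHemisphericPolygon.no_extreme_between`). They therefore form the convex polygon V whose cone is
the hull and whose polar encloses the layer. If a vertex of `W'` lies in the closure of the layer,
the plane of the corresponding edge of `W` supports the hull, so both neighbours of that edge lie on
the same side, which makes `W'` turn left there. -/

noncomputable section

open ComplexConjugate

/-! ### Vector algebra in three-space. -/

theorem inner_eq_sum (u v : E3) : inner ℝ u v = u 0 * v 0 + u 1 * v 1 + u 2 * v 2 := by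
  simp [PiLp.inner_apply, Fin.sum_univ_three]; ring

@[simp] theorem cross_apply_zero (u v : E3) : (cross u v) 0 = u 1 * v 2 - u 2 * v 1 := by
  simp [cross, crossProduct]

@[simp] theorem cross_apply_one (u v : E3) : (cross u v) 1 = u 2 * v 0 - u 0 * v 2 := by
  simp [cross, crossProduct]

@[simp] theorem cross_apply_two (u v : E3) : (cross u v) 2 = u 0 * v 1 - u 1 * v 0 := by
  simp [cross, crossProduct]

theorem triple_eq_sum (a b c : E3) : triple a b c =
    (a 1 * b 2 - a 2 * b 1) * c 0 + (a 2 * b 0 - a 0 * b 2) * c 1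
      + (a 0 * b 1 - a 1 * b 0) * c 2 := by
  simp [triple, inner_eq_sum]

theorem E3.ext {u v : E3} (h0 : u 0 = v 0) (h1 : u 1 = v 1) (h2 : u 2 = v 2) : u = v := by
  ext i; fin_cases i <;> assumption

theorem triple_rotate (a b c : E3) : triple a b c = triple b c a := by
  simp only [triple_eq_sum]; ring

theorem triple_swap (a b c : E3) : triple b a c = -triple a b c := by
  simp only [triple_eq_sum]; ring

theorem triple_self_left (a b : E3) : triple a b a = 0 := by
  simp only [triple_eq_sum]; ring

theorem triple_self_right (a b : E3) : triple a b b = 0 := by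
  simp only [triple_eq_sum]; ring

theorem triple_smul_left (r : ℝ) (a b c : E3) : triple (r • a) b c = r * triple a b c := by
  simp [triple_eq_sum]; ring

theorem triple_smul_middle (r : ℝ) (a b c : E3) : triple a (r • b) c = r * triple a b c := by
  simp [triple_eq_sum]; ring

theorem triple_smul_right (r : ℝ) (a b c : E3) : triple a b (r • c) = r * triple a b c := by
  simp [triple_eq_sum]; ring

theorem triple_add_right (a b c d : E3) : triple a b (c + d) = triple a b c + triple a b d := by
  simp [triple_eq_sum]; ring

/-- Polarity is an involution up to scale: the normals of two consecutive edges span the plane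
orthogonal to the common vertex. -/
theorem cross_cross_cross (a b c : E3) :
    cross (cross a b) (cross b c) = triple a b c • b := by
  apply E3.ext <;> simp [triple_eq_sum] <;> ring

theorem mem_unitSphere {v : E3} : v ∈ unitSphere ↔ inner ℝ v v = 1 := by
  rw [unitSphere, mem_sphere_zero_iff_norm, real_inner_self_eq_norm_sq]
  constructor
  · intro h; rw [h]; norm_num
  · intro h
    exact (sq_eq_sq₀ (norm_nonneg v) zero_le_one).1 (by rw [h]; norm_num)

theorem inner_cross_cross (a b c d : E3) :
    inner ℝ (cross a b) (cross c d)
      = inner ℝ a c * inner ℝ b d - inner ℝ a d * inner ℝ b c := by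
  simp [inner_eq_sum]; ring

theorem triple_sq (a b c : E3) : triple a b c ^ 2 =
    inner ℝ a a * inner ℝ b b * inner ℝ c c + 2 * inner ℝ a b * inner ℝ b c * inner ℝ a c
      - inner ℝ a a * inner ℝ b c ^ 2 - inner ℝ b b * inner ℝ a c ^ 2
      - inner ℝ c c * inner ℝ a b ^ 2 := by
  simp only [inner_eq_sum, triple_eq_sum]; ring

theorem inner_lt_one {u v : E3} (hu : u ∈ unitSphere) (hv : v ∈ unitSphere) (h : u ≠ v) :
    inner ℝ u v < 1 := by
  have h1 : 0 < inner ℝ (u - v) (u - v) := real_inner_self_pos.2 (sub_ne_zero.2 h)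
  rw [inner_sub_left, inner_sub_right, inner_sub_right, mem_unitSphere.1 hu, mem_unitSphere.1 hv,
    real_inner_comm u v] at h1
  linarith

theorem neg_one_lt_inner {u v : E3} (hu : u ∈ unitSphere) (hv : v ∈ unitSphere) (h : u ≠ -v) :
    -1 < inner ℝ u v := by
  have hv' : -v ∈ unitSphere := by
    rw [mem_unitSphere] at *; simpa using hv
  have := inner_lt_one hu hv' h
  rw [inner_neg_right] at this
  linarith

theorem cross_ne_zero {u v : E3} (hu : u ∈ unitSphere) (hv : v ∈ unitSphere) (h : u ≠ v)
    (h' : u ≠ -v) : cross u v ≠ 0 := by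
  intro h0
  have h1 := inner_cross_cross u v u v
  rw [h0, inner_zero_left, mem_unitSphere.1 hu, mem_unitSphere.1 hv, real_inner_comm u v] at h1
  have h2 := inner_lt_one hu hv h
  have h3 := neg_one_lt_inner hu hv h'
  nlinarith

/-- Four vectors of three-space are linearly dependent, with explicit coefficients. -/
theorem triple_smul_eq (a b c v : E3) :
    triple a b c • v = triple v b c • a + triple a v c • b + triple a b v • c := by
  apply E3.ext <;> simp [triple_eq_sum] <;> ring

/-- A vector in the plane of `u` and `v` is a combination of `u` and `v`. -/
theorem exists_eq_smul_add_smul {u v x : E3} (h : cross u v ≠ 0) (hx : triple u v x = 0) :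
    ∃ a b : ℝ, x = a • u + b • v := by
  have hn : inner ℝ (cross u v) (cross u v) ≠ 0 := by
    simpa using h
  refine ⟨inner ℝ (cross x v) (cross u v) / inner ℝ (cross u v) (cross u v),
    inner ℝ (cross u x) (cross u v) / inner ℝ (cross u v) (cross u v), ?_⟩
  have key := triple_smul_eq u v (cross u v) x
  have e : ∀ p q : E3, triple p q (cross u v) = inner ℝ (cross p q) (cross u v) := fun _ _ => rfl
  rw [hx, zero_smul, add_zero, e, e, e] at key
  rw [div_eq_inv_mul, div_eq_inv_mul, mul_smul, mul_smul, ← smul_add, ← key, smul_smul,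
    inv_mul_cancel₀ hn, one_smul]

/-! ### Signed angles in the plane. -/

/-- The signed angle from `u` to `v`, in `(-π, π]`. -/
def turn (u v : ℂ) : ℝ := Complex.arg (conj u * v)

theorem coe_turn {u v : ℂ} (hu : u ≠ 0) (hv : v ≠ 0) :
    (turn u v : Real.Angle) = Complex.arg v - Complex.arg u := by
  rw [turn, Complex.arg_mul_coe_angle (by simpa using hu) hv, Complex.arg_conj_coe_angle]
  abel

theorem eq_zero_of_coe_eq_zero {x : ℝ} (h : (x : Real.Angle) = 0) (h1 : -(2 * Real.pi) < x)
    (h2 : x < 2 * Real.pi) : x = 0 := by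
  obtain ⟨k, hk⟩ := Real.Angle.coe_eq_zero_iff.1 h
  have hp := Real.pi_pos
  rw [zsmul_eq_mul] at hk
  have h3 : (k : ℝ) < 1 := by
    by_contra h4; push Not at h4; nlinarith
  have h4 : (-1 : ℝ) < k := by
    by_contra h4; push Not at h4; nlinarith
  have h5 : k < 1 := by exact_mod_cast h3
  have h6 : -1 < k := by exact_mod_cast h4
  have : k = 0 := by omega
  rw [← hk, this]; simp

/-- The standard way to prove identities of arguments below: compute modulo 2π, then exclude other
multiples by a priori bounds. -/
theorem eq_of_coe_eq {x y : ℝ} (h : (x : Real.Angle) = y) (h1 : -(2 * Real.pi) < x - y)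
    (h2 : x - y < 2 * Real.pi) : x = y := by
  have : ((x - y : ℝ) : Real.Angle) = 0 := by
    rw [Real.Angle.coe_sub, h, sub_self]
  linarith [eq_zero_of_coe_eq_zero this h1 h2]

theorem turn_ofReal_mul_left {r : ℝ} (hr : 0 < r) (u v : ℂ) : turn (r * u) v = turn u v := by
  rw [turn, turn, map_mul, Complex.conj_ofReal, mul_assoc, Complex.arg_real_mul _ hr]

theorem turn_ofReal_mul_right {r : ℝ} (hr : 0 < r) (u v : ℂ) : turn u (r * v) = turn u v := by
  rw [turn, turn, mul_left_comm, Complex.arg_real_mul _ hr]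

theorem turn_neg_neg (u v : ℂ) : turn (-u) (-v) = turn u v := by
  simp [turn]

theorem turn_self (u : ℂ) : turn u u = 0 := by
  rw [turn, mul_comm, Complex.mul_conj, Complex.arg_ofReal_of_nonneg (Complex.normSq_nonneg u)]

theorem turn_le_pi (u v : ℂ) : turn u v ≤ Real.pi := Complex.arg_le_pi _

/-- `v` lies in the open half-plane around the direction `z`. -/
def Toward (z v : ℂ) : Prop := 0 < (conj z * v).re

theorem Toward.ne_zero {z v : ℂ} (h : Toward z v) : v ≠ 0 := by
  rintro rfl; simp [Toward] at h

theorem Toward.ne_zero' {z v : ℂ} (h : Toward z v) : z ≠ 0 := by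
  rintro rfl; simp [Toward] at h

theorem Toward.add {z v w : ℂ} (hv : Toward z v) (hw : Toward z w) : Toward z (v + w) := by
  unfold Toward at *; rw [mul_add, Complex.add_re]; linarith

theorem Toward.abs_turn {z v : ℂ} (h : Toward z v) : |turn z v| < Real.pi / 2 :=
  Complex.abs_arg_lt_pi_div_two_iff.2 (Or.inl h)

/-- Angles measured from `z` lie within π/2 of 0, so their differences do not wrap around. This is
why signed angles are additive inside an open half-plane. -/
theorem Toward.turn_eq {z v w : ℂ} (hv : Toward z v) (hw : Toward z w) :
    turn v w = turn z w - turn z v := by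
  have h1 := abs_lt.1 hv.abs_turn
  have h2 := abs_lt.1 hw.abs_turn
  have h3 := Complex.neg_pi_lt_arg (conj v * w)
  have h4 := Complex.arg_le_pi (conj v * w)
  refine eq_of_coe_eq ?_ ?_ ?_
  · rw [Real.Angle.coe_sub, coe_turn hv.ne_zero hw.ne_zero, coe_turn hv.ne_zero' hv.ne_zero,
      coe_turn hv.ne_zero' hw.ne_zero]
    abel
  · unfold turn at *; linarith
  · unfold turn at *; linarith

theorem Toward.turn_add {z u v w : ℂ} (hu : Toward z u) (hv : Toward z v) (hw : Toward z w) :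
    turn u v + turn v w = turn u w := by
  rw [hu.turn_eq hv, hv.turn_eq hw, hu.turn_eq hw]; ring

theorem Toward.abs_turn_lt {z u v : ℂ} (hu : Toward z u) (hv : Toward z v) :
    |turn u v| < Real.pi := by
  have h1 := abs_lt.1 hu.abs_turn
  have h2 := abs_lt.1 hv.abs_turn
  rw [hu.turn_eq hv, abs_lt]
  constructor <;> linarith

theorem Toward.sum_turn {z : ℂ} (f : ℕ → ℂ) (a b : ℕ) (hab : a ≤ b)
    (h : ∀ k, a ≤ k → k ≤ b → Toward z (f k)) :
    ∑ k ∈ Finset.Ico a b, turn (f k) (f (k + 1)) = turn (f a) (f b) := by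
  induction b, hab using Nat.le_induction with
  | base => simp [turn_self]
  | succ b hab ih =>
    rw [Finset.sum_Ico_succ_top hab, ih (fun k h1 h2 => h k h1 (by omega))]
    exact (h a le_rfl (by omega)).turn_add (h b hab (by omega)) (h (b + 1) (by omega) le_rfl)

/-- Turning from `u` over `v` to `-u` is a half turn, counterclockwise if `v` lies to the left of
`u` and clockwise otherwise. -/
theorem turn_neg_of_pos {u v : ℂ} (h : 0 < (conj u * v).im) :
    turn v (-u) = Real.pi - turn u v := by
  have e : conj v * -u = -conj (conj u * v) := by simp [mul_comm]
  have hne : conj (conj u * v) ≠ 0 := by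
    intro h0
    rw [map_eq_zero] at h0
    rw [h0] at h; simp at h
  have h1 : 0 < turn u v := by
    have := Complex.arg_nonneg_iff.2 h.le
    rcases this.lt_or_eq with h2 | h2
    · exact h2
    · exact absurd (Complex.arg_eq_zero_iff.1 h2.symm).2 h.ne'
  have h3 := turn_le_pi u v
  have h2 := turn_le_pi v (-u)
  have h4 : -Real.pi < turn v (-u) := Complex.neg_pi_lt_arg _
  have hp := Real.pi_pos
  refine eq_of_coe_eq ?_ (by linarith) (by linarith)
  rw [turn, e, Complex.arg_neg_coe_angle hne, Complex.arg_conj_coe_angle, Real.Angle.coe_sub, turn]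
  abel

theorem turn_neg_of_neg {u v : ℂ} (h : (conj u * v).im < 0) :
    turn v (-u) = -Real.pi - turn u v := by
  have h1 : turn u v < 0 := Complex.arg_neg_iff.2 h
  have h2 : 0 < (conj (-u) * -v).im → False := by simpa using h.le
  have h3 : 0 < (conj v * u).im := by
    have : conj v * u = conj (conj u * v) := by simp [mul_comm]
    rw [this, Complex.conj_im]; linarith
  have hv : v ≠ 0 := by rintro rfl; simp at h
  have hu : u ≠ 0 := by rintro rfl; simp at h
  have h5 : turn v (-u) < 0 := Complex.arg_neg_iff.2 (by simpa using h3)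
  have h6 : -Real.pi < turn u v := Complex.neg_pi_lt_arg _
  have h7 : -Real.pi < turn v (-u) := Complex.neg_pi_lt_arg _
  have hp := Real.pi_pos
  refine eq_of_coe_eq ?_ (by linarith) (by linarith)
  rw [coe_turn hv (by simpa using hu), Complex.arg_neg_coe_angle hu, Real.Angle.coe_sub,
    coe_turn hu hv, Real.Angle.coe_neg, Real.Angle.neg_coe_pi]
  abel

theorem arg_pos_of_im_pos {z : ℂ} (h : 0 < z.im) : 0 < z.arg := by
  rcases (Complex.arg_nonneg_iff.2 h.le).lt_or_eq with h2 | h2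
  · exact h2
  · exact absurd (Complex.arg_eq_zero_iff.1 h2.symm).2 h.ne'

theorem arg_lt_pi_of_im_pos {z : ℂ} (h : 0 < z.im) : z.arg < Real.pi :=
  Complex.arg_lt_pi_iff.2 (Or.inr h.ne')

/-- Adding a positive real number moves the argument toward zero. -/
theorem abs_two_mul_arg_sub_arg_lt {p : ℂ} {r : ℝ} (hr : 0 < r) (hp : p ∈ Complex.slitPlane) :
    |2 * (r + p).arg - p.arg| < Real.pi := by
  have hpi := Real.pi_pos
  -- The argument of `r + p` lies between 0 and that of `p`. Hence twice it differs from `p.arg` by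
  -- at most `|p.arg| < π`.
  rcases lt_trichotomy p.im 0 with h | h | h
  · have a1 := Complex.arg_neg_iff.2 h
    have a2 := Complex.neg_pi_lt_arg p
    have b1 : (r + p).arg < 0 := Complex.arg_neg_iff.2 (by simpa using h)
    have t : 0 < (conj p * (r + p)).im := by simp; nlinarith
    have t1 := arg_pos_of_im_pos t
    have t2 := arg_lt_pi_of_im_pos t
    have b2 := Complex.neg_pi_lt_arg (r + p)
    have hp0 : p ≠ 0 := by rintro rfl; simp at h
    have hq0 : (r : ℂ) + p ≠ 0 := by
      intro h0; rw [h0] at b1; simp at b1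
    have : turn p (r + p) = (r + p).arg - p.arg :=
      eq_of_coe_eq (by rw [coe_turn hp0 hq0, Real.Angle.coe_sub]) (by rw [turn]; linarith)
        (by rw [turn]; linarith)
    rw [turn] at this
    rw [abs_lt]; constructor <;> linarith
  · have hre : 0 < p.re := by
      rcases Complex.mem_slitPlane_iff.1 hp with h1 | h1
      · exact h1
      · exact absurd h h1
    rw [Complex.arg_eq_zero_iff.2 ⟨hre.le, h⟩, Complex.arg_eq_zero_iff.2 ⟨by simp; linarith, by simpa⟩]
    simpa
  · have a1 := arg_pos_of_im_pos h
    have a2 := arg_lt_pi_of_im_pos h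
    have b1 : 0 < (r + p).arg := arg_pos_of_im_pos (by simpa using h)
    have b2 : (r + p).arg < Real.pi := arg_lt_pi_of_im_pos (by simpa using h)
    have t : (conj p * (r + p)).im < 0 := by simp; nlinarith
    have t1 := Complex.arg_neg_iff.2 t
    have t2 := Complex.neg_pi_lt_arg (conj p * (r + p))
    have hp0 : p ≠ 0 := by rintro rfl; simp at h
    have hq0 : (r : ℂ) + p ≠ 0 := by
      intro h0; rw [h0] at b1; simp at b1
    have : turn p (r + p) = (r + p).arg - p.arg :=
      eq_of_coe_eq (by rw [coe_turn hp0 hq0, Real.Angle.coe_sub]) (by rw [turn]; linarith)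
        (by rw [turn]; linarith)
    rw [turn] at this
    rw [abs_lt]; constructor <;> linarith

/-! ### Plane charts and spherical trigonometry. -/

/-- An orientation preserving parametrization of the plane orthogonal to `ξ` by complex numbers. -/
def IsPlaneChart (ξ : E3) (φ : E3 →ₗ[ℝ] ℂ) : Prop :=
  ∀ v w, conj (φ v) * φ w = ⟨inner ℝ v w - inner ℝ ξ v * inner ℝ ξ w, triple v w ξ⟩

/-- For some `e ≠ 0` orthogonal to `ξ`, the coordinates are the products with `e` and `ξ × e`,
divided by the length of `e`. -/
theorem exists_isPlaneChart {ξ : E3} (hξ : ξ ∈ unitSphere) : ∃ φ, IsPlaneChart ξ φ := by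
  obtain ⟨e, he0, heξ⟩ : ∃ e : E3, e ≠ 0 ∧ inner ℝ ξ e = 0 := by
    have hd : Module.finrank ℝ ((ℝ ∙ ξ)ᗮ : Submodule ℝ E3) = 2 := by
      have : Fact (Module.finrank ℝ E3 = 2 + 1) := ⟨by simp⟩
      apply Submodule.finrank_orthogonal_span_singleton
      rintro rfl; simp [mem_unitSphere] at hξ
    have : Nontrivial ((ℝ ∙ ξ)ᗮ : Submodule ℝ E3) :=
      Module.nontrivial_of_finrank_pos (R := ℝ) (by rw [hd]; norm_num)
    obtain ⟨e, he⟩ := exists_ne (0 : ((ℝ ∙ ξ)ᗮ : Submodule ℝ E3))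
    exact ⟨e, by simpa using he, Submodule.mem_orthogonal_singleton_iff_inner_right.1 e.2⟩
  rw [mem_unitSphere] at hξ
  have hee : 0 < inner ℝ e e := real_inner_self_pos.2 he0
  have hs : √(inner ℝ e e) ^ 2 = inner ℝ e e := Real.sq_sqrt hee.le
  set s := √(inner ℝ e e) with hsdef
  have hs0 : s ≠ 0 := by rintro h; rw [h] at hs; linarith [hs]
  have hss : s⁻¹ * s⁻¹ * inner ℝ e e = 1 := by
    rw [← hs]; field_simp
  refine ⟨⟨⟨fun v => ⟨s⁻¹ * inner ℝ e v, s⁻¹ * triple ξ e v⟩, ?_⟩, ?_⟩, ?_⟩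
  · intro v w
    apply Complex.ext <;> simp [inner_add_right, triple_add_right, mul_add]
  · intro r v
    apply Complex.ext <;> simp [inner_smul_right, triple_smul_right] <;> ring
  · intro v w
    have k1 : inner ℝ ξ ξ * inner ℝ e e * inner ℝ v w
        - inner ℝ ξ e * (inner ℝ ξ e * inner ℝ v w)
        = triple ξ e v * triple ξ e w + inner ℝ e v * inner ℝ e w * inner ℝ ξ ξ
          + inner ℝ ξ v * inner ℝ ξ w * inner ℝ e e
          - inner ℝ ξ e * (inner ℝ ξ v * inner ℝ e w + inner ℝ e v * inner ℝ ξ w) := by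
      simp only [inner_eq_sum, triple_eq_sum]; ring
    have k2 : inner ℝ e v * triple ξ e w - inner ℝ e w * triple ξ e v
        = inner ℝ e e * triple v w ξ - inner ℝ ξ e * triple v w e := by
      simp only [inner_eq_sum, triple_eq_sum]; ring
    rw [heξ, hξ] at k1
    rw [heξ] at k2
    apply Complex.ext
    · simp
      linear_combination (-(s⁻¹ * s⁻¹)) * k1 + (inner ℝ v w - inner ℝ ξ v * inner ℝ ξ w) * hss
    · simp
      linear_combination (s⁻¹ * s⁻¹) * k2 + (triple v w ξ) * hss

/-- The length of the shortest great circle arc between two unit vectors. -/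
def edgeLength (u v : E3) : ℝ := Complex.arg ⟨inner ℝ u v, ‖cross u v‖⟩

/-- A complex number whose argument is half of the signed area of the spherical triangle with
vertices `-ξ`, `b`, `c`. -/
def excessFactor (ξ b c : E3) : ℂ :=
  ⟨1 - inner ℝ ξ b - inner ℝ ξ c + inner ℝ b c, -triple b c ξ⟩

/-- The increment of the longitude with respect to the axis `ξ` along the arc from `b` to `c`. -/
def longitudeStep (ξ b c : E3) : ℝ :=
  Complex.arg ⟨inner ℝ b c - inner ℝ ξ b * inner ℝ ξ c, triple b c ξ⟩

/-- For `v` orthogonal to `b`, the signed angle about `b` from `b × ξ` to `v`. -/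
def slopeAngle (ξ b v : E3) : ℝ := Complex.arg ⟨triple b ξ v, -inner ℝ ξ v⟩

theorem slopeAngle_sign (ξ b v : E3) :
    (0 < inner ℝ ξ v → -Real.pi < slopeAngle ξ b v ∧ slopeAngle ξ b v < 0) ∧
    (inner ℝ ξ v < 0 → 0 < slopeAngle ξ b v ∧ slopeAngle ξ b v < Real.pi) := by
  constructor
  · intro h1
    exact ⟨Complex.neg_pi_lt_arg _, Complex.arg_neg_iff.2 (by simpa using h1)⟩
  · intro h1
    exact ⟨arg_pos_of_im_pos (by simpa using h1), arg_lt_pi_of_im_pos (by simpa using h1)⟩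

/-- The area of the spherical triangle `-ξ`, `b`, `c` in terms of its angles. -/
theorem two_mul_arg_excessFactor {ξ b c v : E3} (hξ : ξ ∈ unitSphere) (hb : b ∈ unitSphere)
    (hc : c ∈ unitSphere) (hv : v ∈ unitSphere) (hbv : inner ℝ b v = 0) (hcv : inner ℝ c v = 0)
    (hx : inner ℝ ξ v ≠ 0) (hbc : c ≠ -b) :
    2 * (excessFactor ξ b c).arg + longitudeStep ξ b c = slopeAngle ξ c v - slopeAngle ξ b v := by
  have hpi := Real.pi_pos
  have hk1 : -1 < inner ℝ b c := by
    have := neg_one_lt_inner hc hb hbc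
    rwa [real_inner_comm] at this
  rw [mem_unitSphere] at hξ hb hc hv
  -- As `v` is a common unit normal of `b` and `c`, all entries become polynomials in the five
  -- numbers `k`, `t`, `β`, `q`, `x` named below, subject to `k² + t² = 1` and `β² + q² + x² = 1`.
  have h1 : inner ℝ b c ^ 2 + triple b c v ^ 2 = 1 := by
    rw [triple_sq, hbv, hcv, hb, hc, hv]; ring
  have h2 : inner ℝ ξ b ^ 2 + triple b ξ v ^ 2 + inner ℝ ξ v ^ 2 = 1 := by
    rw [triple_sq, hbv, hb, hξ, hv, real_inner_comm]; ring
  have h3 : inner ℝ ξ c = inner ℝ b c * inner ℝ ξ b + triple b c v * triple b ξ v := by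
    have : triple b c v * triple b ξ v =
        inner ℝ b b * (inner ℝ ξ c * inner ℝ v v - inner ℝ ξ v * inner ℝ c v)
        - inner ℝ ξ b * (inner ℝ b c * inner ℝ v v - inner ℝ b v * inner ℝ c v)
        + inner ℝ b v * (inner ℝ b c * inner ℝ ξ v - inner ℝ ξ c * inner ℝ b v) := by
      simp only [inner_eq_sum, triple_eq_sum]; ring
    rw [this, hbv, hcv, hb, hv]; ring
  have h4 : triple c ξ v = inner ℝ b c * triple b ξ v - triple b c v * inner ℝ ξ b := by
    have := congrArg (inner ℝ b) (triple_smul_eq c ξ v b)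
    simp only [inner_smul_right, inner_add_right] at this
    rw [hb, hbv] at this
    rw [triple_swap b c] at this
    rw [real_inner_comm b ξ]
    linarith
  have h5 : triple b c ξ = triple b c v * inner ℝ ξ v := by
    have := congrArg (inner ℝ v) (triple_smul_eq b c v ξ)
    simp only [inner_smul_right, inner_add_right] at this
    rw [hv, real_inner_comm b v, hbv, real_inner_comm c v, hcv, real_inner_comm ξ v] at this
    linarith
  unfold excessFactor longitudeStep slopeAngle
  rw [h3, h4, h5]
  set k := inner ℝ b c
  set t := triple b c v
  set β := inner ℝ ξ b
  set q := triple b ξ v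
  set x := inner ℝ ξ v
  have hx2 : 0 < x ^ 2 := by positivity
  have hβ : β ^ 2 < 1 := by nlinarith [sq_nonneg q]
  have hβ1 := abs_lt.1 ((sq_lt_one_iff_abs_lt_one β).1 hβ)
  have hγ : (k * β + t * q) ^ 2 < 1 := by
    have : (k * β + t * q) ^ 2 + (k * q - t * β) ^ 2 = β ^ 2 + q ^ 2 := by
      linear_combination (β ^ 2 + q ^ 2) * h1
    nlinarith [sq_nonneg (k * q - t * β)]
  have hγ1 := abs_lt.1 ((sq_lt_one_iff_abs_lt_one _).1 hγ)
  set p : ℂ := ⟨k - β * (k * β + t * q), -(t * x)⟩ with hp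
  set z : ℂ := ⟨1 - β - (k * β + t * q) + k, -(t * x)⟩ with hz
  set e₁ : ℂ := ⟨k * q - t * β, -x⟩ with he₁
  set e₂ : ℂ := ⟨q, -x⟩ with he₂
  have hps : p ∈ Complex.slitPlane := by
    rw [Complex.mem_slitPlane_iff]
    by_cases ht : t = 0
    · left
      have hkk : k = 1 := by
        rw [ht] at h1
        nlinarith
      simp [hp, ht, hkk]; nlinarith
    · right; simp [hp, ht, hx]
  have hconj : (⟨k - β * (k * β + t * q), t * x⟩ : ℂ) = conj p := by
    apply Complex.ext <;> simp [hp]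
  have hargp : (conj p).arg = -p.arg := by
    rw [Complex.arg_conj, if_neg (Complex.mem_slitPlane_iff_arg.1 hps).1]
  have hr : 0 < (1 - β) * (1 - (k * β + t * q)) := mul_pos (by linarith) (by linarith)
  have hzp : z = ((1 - β) * (1 - (k * β + t * q)) : ℝ) + p := by
    apply Complex.ext
    · simp [hp, hz]; ring
    · simp [hp, hz]
  -- `z` arises from `p` by adding the positive number `(1 - ⟪ξ, b⟫)(1 - ⟪ξ, c⟫)`.
  have hbound : |2 * z.arg - p.arg| < Real.pi := by
    rw [hzp]; exact abs_two_mul_arg_sub_arg_lt hr hps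
  -- This is the claim modulo 2π: up to positive factors, the square of the excess factor is the
  -- product of `p`, whose conjugate carries the longitude step, and the quotient of the two slope
  -- directions.
  have hkey : ((2 * (1 + k) : ℝ) : ℂ) * (p * (e₁ * conj e₂))
      = (((1 + β) * (1 + (k * β + t * q)) : ℝ) : ℂ) * (z * z) := by
    apply Complex.ext
    · simp only [hp, hz, he₁, he₂, Complex.mul_re, Complex.mul_im, Complex.conj_re,
        Complex.conj_im, Complex.ofReal_re, Complex.ofReal_im]
      linear_combination (x^2 + q^2 - β * x^2 - β * q^2 + t * q * x^2 - t * q^3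
        + t * β * q * x^2 - t * β * q^3 + 2 * k * q^2 - k * β * x^2 - k * β * q^2
        + k * β^2 * x^2 - k * β^2 * q^2) * h1 + (1 - β - t * q - t * β * q + 2 * k - k * β
        - k * β^2 - 2 * k * t * β * q + k^2 + k^2 * β - 2 * k^2 * β^2 + k^2 * t * q
        - k^2 * t * β * q + k^3 * β - k^3 * β^2) * h2
    · simp only [hp, hz, he₁, he₂, Complex.mul_re, Complex.mul_im, Complex.conj_re,
        Complex.conj_im, Complex.ofReal_re, Complex.ofReal_im]
      linear_combination (-2 * t * q^2 * x - 2 * t * β * q^2 * x + 2 * k * q * x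
        - 2 * k * β^2 * q * x) * h1 + (-2 * t * x - 2 * k * t * x) * h2
  have he₁0 : e₁ ≠ 0 := fun h => hx (by simpa [he₁] using congrArg Complex.im h)
  have he₂0 : e₂ ≠ 0 := fun h => hx (by simpa [he₂] using congrArg Complex.im h)
  have hp0 : p ≠ 0 := Complex.slitPlane_ne_zero hps
  have hz0 : z ≠ 0 := by
    intro h0
    rw [h0, mul_zero, mul_zero] at hkey
    have : ((2 * (1 + k) : ℝ) : ℂ) ≠ 0 := by
      rw [Complex.ofReal_ne_zero]; linarith
    exact mul_ne_zero this (mul_ne_zero hp0 (mul_ne_zero he₁0 (by simpa using he₂0))) hkey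
  have hang : ((2 * z.arg : ℝ) : Real.Angle) = ((p.arg + (e₁.arg - e₂.arg) : ℝ) : Real.Angle) := by
    have := congrArg Complex.arg hkey
    rw [Complex.arg_real_mul _ (by linarith), Complex.arg_real_mul _ (mul_pos (by linarith) (by linarith))] at this
    have := congrArg (fun r : ℝ => (r : Real.Angle)) this
    rw [Complex.arg_mul_coe_angle hp0 (mul_ne_zero he₁0 (by simpa using he₂0)),
      Complex.arg_mul_coe_angle he₁0 (by simpa using he₂0), Complex.arg_conj_coe_angle,
      Complex.arg_mul_coe_angle hz0 hz0] at this
    rw [two_mul, Real.Angle.coe_add, Real.Angle.coe_add, Real.Angle.coe_sub, ← this, sub_eq_add_neg]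
  rw [hconj, hargp]
  have hsign : |e₁.arg - e₂.arg| < Real.pi := by
    rcases lt_or_gt_of_ne hx with h | h
    · have a1 : 0 < e₁.arg := arg_pos_of_im_pos (by simpa [he₁] using h)
      have a2 : 0 < e₂.arg := arg_pos_of_im_pos (by simpa [he₂] using h)
      have a3 : e₁.arg < Real.pi := arg_lt_pi_of_im_pos (by simpa [he₁] using h)
      have a4 : e₂.arg < Real.pi := arg_lt_pi_of_im_pos (by simpa [he₂] using h)
      rw [abs_lt]; constructor <;> linarith
    · have a1 : e₁.arg < 0 := Complex.arg_neg_iff.2 (by simpa [he₁] using h)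
      have a2 : e₂.arg < 0 := Complex.arg_neg_iff.2 (by simpa [he₂] using h)
      have a3 := Complex.neg_pi_lt_arg e₁
      have a4 := Complex.neg_pi_lt_arg e₂
      rw [abs_lt]; constructor <;> linarith
  rw [abs_lt] at hbound hsign
  have := eq_of_coe_eq hang (by linarith) (by linarith)
  linarith

/-- The length of an edge in terms of the directions at its ends. -/
theorem edgeLength_eq {ξ u v : E3} (hu : u ∈ unitSphere) (hv : v ∈ unitSphere)
    (huv : cross u v ≠ 0) (hx : inner ℝ ξ u ≠ 0) (hy : inner ℝ ξ v ≠ 0) :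
    edgeLength u v = slopeAngle ξ (‖cross u v‖⁻¹ • cross u v) v
      - slopeAngle ξ (‖cross u v‖⁻¹ • cross u v) u
      + (if inner ℝ ξ u < 0 ∧ 0 < inner ℝ ξ v then 2 * Real.pi else 0) := by
  have hpi := Real.pi_pos
  have hs : 0 < ‖cross u v‖ := norm_pos_iff.2 huv
  have hu' := slopeAngle_sign ξ (‖cross u v‖⁻¹ • cross u v) u
  have hv' := slopeAngle_sign ξ (‖cross u v‖⁻¹ • cross u v) v
  rw [mem_unitSphere] at hu hv
  have hcs : inner ℝ u v ^ 2 + ‖cross u v‖ ^ 2 = 1 := by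
    rw [← real_inner_self_eq_norm_sq, inner_cross_cross, hu, hv, real_inner_comm u v]; ring
  have hU : slopeAngle ξ (‖cross u v‖⁻¹ • cross u v) u =
      Complex.arg ⟨inner ℝ ξ u * inner ℝ u v - inner ℝ ξ v, -(‖cross u v‖ * inner ℝ ξ u)⟩ := by
    rw [slopeAngle, ← Complex.arg_real_mul _ hs]
    congr 1
    have : triple (cross u v) ξ u = inner ℝ ξ u * inner ℝ u v - inner ℝ ξ v * inner ℝ u u := by
      simp only [inner_eq_sum, triple_eq_sum, cross_apply_zero, cross_apply_one,
        cross_apply_two]; ring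
    apply Complex.ext
    · simp only [triple_smul_left, this, hu, Complex.re_ofReal_mul]
      field_simp
    · simp
  have hV : slopeAngle ξ (‖cross u v‖⁻¹ • cross u v) v =
      Complex.arg ⟨inner ℝ ξ u - inner ℝ ξ v * inner ℝ u v, -(‖cross u v‖ * inner ℝ ξ v)⟩ := by
    rw [slopeAngle, ← Complex.arg_real_mul _ hs]
    congr 1
    have : triple (cross u v) ξ v = inner ℝ ξ u * inner ℝ v v - inner ℝ ξ v * inner ℝ u v := by
      simp only [inner_eq_sum, triple_eq_sum, cross_apply_zero, cross_apply_one,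
        cross_apply_two]; ring
    apply Complex.ext
    · simp only [triple_smul_left, this, hv, Complex.re_ofReal_mul]
      field_simp
    · simp
  have hl0 : 0 < edgeLength u v := arg_pos_of_im_pos hs
  have hl1 : edgeLength u v < Real.pi := arg_lt_pi_of_im_pos hs
  have hmod : (edgeLength u v : Real.Angle)
      = ((slopeAngle ξ (‖cross u v‖⁻¹ • cross u v) v
        - slopeAngle ξ (‖cross u v‖⁻¹ • cross u v) u : ℝ) : Real.Angle) := by
    rw [Real.Angle.coe_sub, eq_sub_iff_add_eq, hU, hV, edgeLength, ← Complex.arg_mul_coe_angle]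
    · congr 2
      apply Complex.ext
      · simp; linear_combination inner ℝ ξ u * hcs
      · simp; ring
    · intro h; have := congrArg Complex.im h; simp at this; exact huv this
    · intro h; have := congrArg Complex.im h; simp [hx] at this; exact huv this
  -- Slope angles lie in `(0, π)` below the plane orthogonal to `ξ` and in `(-π, 0)` above it. Only
  -- an upward crossing passes the branch cut, so only there 2π must be added.
  rcases lt_or_gt_of_ne hx with h1 | h1 <;> rcases lt_or_gt_of_ne hy with h2 | h2
  · rw [if_neg (by intro h; linarith [h.2]), add_zero]
    have := hu'.2 h1; have := hv'.2 h2
    exact eq_of_coe_eq hmod (by linarith) (by linarith)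
  · rw [if_pos ⟨h1, h2⟩]
    have := hu'.2 h1; have := hv'.1 h2
    refine eq_of_coe_eq ?_ (by linarith) (by linarith)
    rw [hmod, Real.Angle.coe_add, Real.Angle.coe_two_pi, add_zero]
  · rw [if_neg (by intro h; linarith [h.1]), add_zero]
    have := hu'.1 h1; have := hv'.2 h2
    exact eq_of_coe_eq hmod (by linarith) (by linarith)
  · rw [if_neg (by intro h; linarith [h.1]), add_zero]
    have := hu'.1 h1; have := hv'.1 h2
    exact eq_of_coe_eq hmod (by linarith) (by linarith)

/-! ### Regular polygons and the index of their polar. -/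

/-- Closed spherical polygons whose edges have lengths strictly between `0` and `π`, and which do
not turn back at any vertex. -/
structure IsRegularPolygon {n : ℕ} [NeZero n] (W : Fin n → E3) : Prop where
  mem_sphere : ∀ i, W i ∈ unitSphere
  cross_ne : ∀ i, cross (W i) (W (i + 1)) ≠ 0
  polar_ne : ∀ i, polar W (i + 1) ≠ -polar W i

/-- The winding number of the polar polygon, by means of the theorem of Gauss and Bonnet. -/
def polarIndex {n : ℕ} [NeZero n] (W : Fin n → E3) (ξ : E3) : ℝ :=
  (2 * Real.pi - ∑ i, (edgeLength (W i) (W (i + 1))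
    + 2 * (excessFactor ξ (polar W i) (polar W (i + 1))).arg)) / (4 * Real.pi)

theorem inv_norm_smul_mem_unitSphere {v : E3} (h : v ≠ 0) : ‖v‖⁻¹ • v ∈ unitSphere := by
  rw [unitSphere, mem_sphere_zero_iff_norm, norm_smul, norm_inv, norm_norm,
    inv_mul_cancel₀ (norm_ne_zero_iff.2 h)]

theorem inner_cross_left (u v : E3) : inner ℝ (cross u v) u = 0 := by
  simp [inner_eq_sum]; ring

theorem inner_cross_right (u v : E3) : inner ℝ (cross u v) v = 0 := by
  simp [inner_eq_sum]; ring

section Regular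

variable {n : ℕ} [NeZero n] {W : Fin n → E3} {ξ : E3}

theorem inner_polar_left (W : Fin n → E3) (i : Fin n) : inner ℝ (polar W i) (W i) = 0 := by
  rw [polar, inner_smul_left, inner_cross_left, mul_zero]

theorem inner_polar_right (W : Fin n → E3) (i : Fin n) : inner ℝ (polar W i) (W (i + 1)) = 0 := by
  rw [polar, inner_smul_left, inner_cross_right, mul_zero]

theorem IsRegularPolygon.polar_mem (hW : IsRegularPolygon W) (i : Fin n) :
    polar W i ∈ unitSphere := inv_norm_smul_mem_unitSphere (hW.cross_ne i)

/-- If the polar turned to its antipode, three consecutive vertices `u`, `v`, `w` would lie on a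
great circle with `w = a u + b v` and `a > 0`. Then `w` lies on the edge `u v` or `u` on the edge `v
w`, according to the sign of `b`, so two edges overlap. -/
theorem IsSimplePolygon.isRegularPolygon (hW : IsSimplePolygon W) : IsRegularPolygon W := by
  have hc : ∀ i, cross (W i) (W (i + 1)) ≠ 0 := fun i =>
    cross_ne_zero (hW.mem_sphere i) (hW.mem_sphere _) (hW.ne_succ i).symm
      (fun h => hW.ne_neg_succ i (by rw [h, neg_neg]))
  refine ⟨hW.mem_sphere, hc, fun i h => ?_⟩
  have h3 := hW.three_le
  have hn : ∀ i : Fin n, i ≠ i + 1 := by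
    intro i h
    have : (1 : Fin n) = 0 := by simpa using h
    rw [Fin.one_eq_zero_iff] at this; omega
  have hn2 : ∀ i : Fin n, i ≠ i + 1 + 1 := by
    intro i h
    have h1 : (1 : Fin n) + 1 = 0 := by
      rw [add_assoc] at h; simpa using h
    have := congrArg Fin.val h1
    simp only [Fin.val_add, Fin.val_one', Fin.val_zero] at this
    rw [Nat.mod_eq_of_lt (by omega : 1 < n), Nat.mod_eq_of_lt (by omega : 1 + 1 < n)] at this
    omega
  set u := W i with hu
  set v := W (i + 1) with hv
  set w := W (i + 1 + 1) with hw
  set r := ‖cross u v‖⁻¹ with hr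
  set s := ‖cross v w‖⁻¹ with hs
  have hr0 : 0 < r := inv_pos.2 (norm_pos_iff.2 (hc i))
  have hs0 : 0 < s := inv_pos.2 (norm_pos_iff.2 (hc (i + 1)))
  have h' : s • cross v w = -(r • cross u v) := h
  have ht : triple u v w = 0 := by
    have h1 : r * triple u v w = 0 := by
      have : inner ℝ (-(r • cross u v)) w = 0 := by
        rw [← h', inner_smul_left, inner_cross_right, mul_zero]
      rw [inner_neg_left, inner_smul_left, neg_eq_zero] at this
      simpa [triple] using this
    exact (mul_eq_zero.1 h1).resolve_left hr0.ne'
  obtain ⟨a, b, hab⟩ := exists_eq_smul_add_smul (hc i) ht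
  have hvw : cross v w = (-a) • cross u v := by
    change w = a • u + b • v at hab
    rw [hab]; apply E3.ext <;> simp <;> ring
  have ha : 0 < a := by
    rw [hvw, smul_smul, ← neg_smul] at h'
    have := smul_left_injective ℝ (hc i) h'
    nlinarith
  have aw : w ∈ arc v w := ⟨hW.mem_sphere _, 0, 1, le_rfl, zero_le_one, by simp⟩
  have au : u ∈ arc u v := ⟨hW.mem_sphere _, 1, 0, zero_le_one, le_rfl, by simp⟩
  rcases le_or_gt 0 b with hb | hb
  · have aw' : w ∈ arc u v := ⟨hW.mem_sphere _, a, b, ha.le, hb, hab⟩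
    rcases hW.edges_disjoint i (i + 1) (hn i) w aw' aw with h1 | h1
    · exact hW.ne_succ (i + 1) h1.2
    · exact hn2 i h1.1
  · have au' : u ∈ arc v w := by
      refine ⟨hW.mem_sphere _, -(b / a), 1 / a, ?_, by positivity, ?_⟩
      · rw [neg_nonneg]; exact div_nonpos_of_nonpos_of_nonneg hb.le ha.le
      · change w = a • u + b • v at hab
        rw [hab, smul_add, smul_smul, smul_smul, one_div_mul_cancel ha.ne', one_smul,
          add_comm u, ← add_assoc, ← add_smul]
        have : -(b / a) + 1 / a * b = 0 := by ring
        rw [this, zero_smul, zero_add]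
    rcases hW.edges_disjoint i (i + 1) (hn i) u au au' with h1 | h1
    · exact hW.ne_succ i h1.2.symm
    · exact hn2 i h1.1

/-- Both ends of the polar edge number `i` are orthogonal to `W (i + 1)`, the vertex shared by the
edges `i` and `i + 1`. -/
theorem inner_eq_zero_of_mem_trace (h : ξ ∈ trace (polar W)) : ∃ i, inner ℝ ξ (W i) = 0 := by
  obtain ⟨i, -, a, b, -, -, rfl⟩ := mem_iUnion.1 h
  refine ⟨i + 1, ?_⟩
  rw [inner_add_left, inner_smul_left, inner_smul_left, inner_polar_left, inner_polar_right]
  simp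

/-- The index at points in general position. -/
theorem four_pi_mul_polarIndex (hW : IsRegularPolygon W) (hξ : ξ ∈ unitSphere)
    (hx : ∀ i, inner ℝ ξ (W i) ≠ 0) :
    4 * Real.pi * polarIndex W ξ = 2 * Real.pi
      - ∑ i, (if inner ℝ ξ (W i) < 0 ∧ 0 < inner ℝ ξ (W (i + 1)) then 2 * Real.pi else 0)
      + ∑ i, longitudeStep ξ (polar W i) (polar W (i + 1)) := by
  have hpi := Real.pi_pos
  have h1 : ∀ i, edgeLength (W i) (W (i + 1))
      + 2 * (excessFactor ξ (polar W i) (polar W (i + 1))).arg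
      = (slopeAngle ξ (polar W (i + 1)) (W (i + 1)) - slopeAngle ξ (polar W i) (W i))
        + (if inner ℝ ξ (W i) < 0 ∧ 0 < inner ℝ ξ (W (i + 1)) then 2 * Real.pi else 0)
        - longitudeStep ξ (polar W i) (polar W (i + 1)) := by
    intro i
    have e1 := edgeLength_eq (ξ := ξ) (hW.mem_sphere i) (hW.mem_sphere (i + 1)) (hW.cross_ne i)
      (hx i) (hx (i + 1))
    have e2 := two_mul_arg_excessFactor hξ (hW.polar_mem i) (hW.polar_mem (i + 1))
      (hW.mem_sphere (i + 1)) (inner_polar_right W i) (inner_polar_left W (i + 1)) (hx (i + 1))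
      (hW.polar_ne i)
    rw [e1]
    change _ = _ at e2
    unfold polar at *
    linarith
  -- At each polar vertex, the edge length and the areas of the adjacent triangles contribute slope
  -- angles that cancel around the polygon. Only the crossings and the longitude steps remain.
  have h2 : ∑ i, (slopeAngle ξ (polar W (i + 1)) (W (i + 1)) - slopeAngle ξ (polar W i) (W i))
      = 0 := by
    rw [Finset.sum_sub_distrib, sub_eq_zero]
    exact Equiv.sum_comp (Equiv.addRight (1 : Fin n)) (fun i => slopeAngle ξ (polar W i) (W i))
  rw [polarIndex, mul_div_cancel₀ _ (by positivity), Finset.sum_congr rfl (fun i _ => h1 i),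
    Finset.sum_sub_distrib, Finset.sum_add_distrib, h2]
  ring

theorem IsPlaneChart.turn_eq {φ : E3 →ₗ[ℝ] ℂ} (hφ : IsPlaneChart ξ φ) (b c : E3) :
    turn (φ b) (φ c) = longitudeStep ξ b c := by
  rw [turn, hφ]; rfl

theorem IsPlaneChart.ne_zero {φ : E3 →ₗ[ℝ] ℂ} (hφ : IsPlaneChart ξ φ) (hξ : ξ ∈ unitSphere)
    {b v : E3} (hb : b ∈ unitSphere) (hbv : inner ℝ b v = 0) (hx : inner ℝ ξ v ≠ 0) :
    φ b ≠ 0 := by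
  intro h
  have h1 := congrArg Complex.re (hφ b b)
  rw [h, mem_unitSphere.1 hb] at h1
  simp at h1
  have h2 : inner ℝ (ξ - inner ℝ ξ b • b) (ξ - inner ℝ ξ b • b) = 0 := by
    rw [inner_sub_left, inner_sub_right, inner_sub_right, inner_smul_left, inner_smul_right,
      inner_smul_left, inner_smul_right, mem_unitSphere.1 hb, mem_unitSphere.1 hξ,
      real_inner_comm ξ b]
    simp; linarith
  rw [inner_self_eq_zero, sub_eq_zero] at h2
  rw [h2, inner_smul_left, hbv, mul_zero] at hx
  exact hx rfl

/-- Longitude is well defined modulo 2π along the projected polar polygon, which closes up. -/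
theorem exists_int_sum_longitudeStep (hW : IsRegularPolygon W) (hξ : ξ ∈ unitSphere)
    (hx : ∀ i, inner ℝ ξ (W i) ≠ 0) :
    ∃ k : ℤ, ∑ i, longitudeStep ξ (polar W i) (polar W (i + 1)) = 2 * Real.pi * k := by
  obtain ⟨φ, hφ⟩ := exists_isPlaneChart hξ
  have h0 : ∀ i, φ (polar W i) ≠ 0 := fun i =>
    hφ.ne_zero hξ (hW.polar_mem i) (inner_polar_left W i) (hx i)
  have h1 : ((∑ i, longitudeStep ξ (polar W i) (polar W (i + 1)) : ℝ) : Real.Angle) = 0 := by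
    rw [← Real.Angle.coe_coeHom, map_sum]
    have : ∀ i, Real.Angle.coeHom (longitudeStep ξ (polar W i) (polar W (i + 1)))
        = ((φ (polar W (i + 1))).arg : Real.Angle) - ((φ (polar W i)).arg : Real.Angle) := by
      intro i
      rw [Real.Angle.coe_coeHom, ← hφ.turn_eq, coe_turn (h0 _) (h0 _)]
    rw [Finset.sum_congr rfl (fun i _ => this i), Finset.sum_sub_distrib, sub_eq_zero]
    exact Equiv.sum_comp (Equiv.addRight (1 : Fin n))
      (fun i => ((φ (polar W i)).arg : Real.Angle))
  obtain ⟨k, hk⟩ := Real.Angle.coe_eq_zero_iff.1 h1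
  exact ⟨k, by rw [← hk, zsmul_eq_mul]; ring⟩

/-- Half-integrality is all that is needed: together with continuity it makes the index locally
constant. -/
theorem exists_int_two_mul_polarIndex_of_inner_ne (hW : IsRegularPolygon W) (hξ : ξ ∈ unitSphere)
    (hx : ∀ i, inner ℝ ξ (W i) ≠ 0) : ∃ k : ℤ, 2 * polarIndex W ξ = k := by
  have hpi := Real.pi_pos
  have h := four_pi_mul_polarIndex hW hξ hx
  obtain ⟨k, hk⟩ := exists_int_sum_longitudeStep hW hξ hx
  have h2 : ∑ i, (if inner ℝ ξ (W i) < 0 ∧ 0 < inner ℝ ξ (W (i + 1)) then 2 * Real.pi else 0)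
      = 2 * Real.pi * ((∑ i, if inner ℝ ξ (W i) < 0 ∧ 0 < inner ℝ ξ (W (i + 1)) then 1 else 0 : ℤ)
        : ℝ) := by
    push_cast
    rw [Finset.mul_sum]
    exact Finset.sum_congr rfl fun i _ => by split_ifs <;> simp
  rw [hk, h2] at h
  refine ⟨1 - (∑ i, if inner ℝ ξ (W i) < 0 ∧ 0 < inner ℝ ξ (W (i + 1)) then 1 else 0) + k, ?_⟩
  rw [Int.cast_add, Int.cast_sub, Int.cast_one]
  have : 2 * Real.pi * (2 * polarIndex W ξ) = 2 * Real.pi * (1 - ((∑ i, if inner ℝ ξ (W i) < 0 ∧ 0 < inner ℝ ξ (W (i + 1)) then 1 else 0 : ℤ) : ℝ) + k) := by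
    linarith
  exact mul_left_cancel₀ (by positivity) this

/-- The area of the triangle over an edge is continuous as long as the factor stays off the branch
cut, and it reaches the cut only when `ξ` is on the edge, that is, when the apex `-ξ` is antipodal
to a point of it. -/
theorem excessFactor_mem_slitPlane {ξ b c : E3} (hξ : ξ ∈ unitSphere) (hb : b ∈ unitSphere)
    (hc : c ∈ unitSphere) (hbc : c ≠ -b) (h : ξ ∉ arc b c) :
    excessFactor ξ b c ∈ Complex.slitPlane := by
  rw [Complex.mem_slitPlane_iff]
  by_contra! hcon
  obtain ⟨h1, h2⟩ := hcon
  simp only [excessFactor, neg_eq_zero] at h1 h2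
  by_cases e : b = c
  · subst e
    have : ξ ≠ b := by
      rintro rfl; exact h ⟨hξ, 1, 0, zero_le_one, le_rfl, by simp⟩
    have := inner_lt_one hξ hb this
    rw [mem_unitSphere.1 hb] at h1
    linarith
  · obtain ⟨s, t, hst⟩ := exists_eq_smul_add_smul
      (cross_ne_zero hb hc e (fun h => hbc (by rw [h, neg_neg]))) h2
    have k1 := inner_lt_one hb hc e
    have k2 := neg_one_lt_inner hb hc (fun h => hbc (by rw [h, neg_neg]))
    have hξ' := mem_unitSphere.1 hξ
    rw [hst] at h1 hξ'
    simp only [inner_add_left, inner_add_right, inner_smul_left, inner_smul_right,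
      mem_unitSphere.1 hb, mem_unitSphere.1 hc, real_inner_comm b c] at h1 hξ'
    simp only [conj_trivial, mul_one] at h1 hξ'
    set k := inner ℝ b c
    -- The real part of the factor is `(1 + k)(1 - (s + t))`. The unit norm reads `(s + t)² - 2st(1
    -- - k) = 1`, which yields `0 ≤ s * t` next.
    have h3 : 1 ≤ s + t := by
      by_contra! h4
      nlinarith
    have h4 : 0 ≤ s * t := by nlinarith
    apply h
    refine ⟨hξ, s, t, ?_, ?_, hst⟩ <;> by_contra! h5 <;> nlinarith

theorem continuous_cross : Continuous fun p : E3 × E3 => cross p.1 p.2 := by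
  unfold cross
  refine (PiLp.continuous_toLp 2 _).comp ?_
  refine continuous_pi fun i => ?_
  fin_cases i <;> simp [crossProduct] <;> fun_prop

theorem ContinuousAt.cross {X : Type*} [TopologicalSpace X] {u v : X → E3} {x : X}
    (hu : ContinuousAt u x) (hv : ContinuousAt v x) :
    ContinuousAt (fun y => _root_.cross (u y) (v y)) x :=
  continuous_cross.continuousAt.comp (hu.prodMk hv)

theorem ContinuousAt.complex_mk {X : Type*} [TopologicalSpace X] {u v : X → ℝ} {x : X}
    (hu : ContinuousAt u x) (hv : ContinuousAt v x) :
    ContinuousAt (fun y => (⟨u y, v y⟩ : ℂ)) x := by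
  have : (fun y => (⟨u y, v y⟩ : ℂ)) = fun y => (u y : ℂ) + (v y : ℂ) * Complex.I := by
    funext y; exact Complex.mk_eq_add_mul_I _ _
  rw [this]
  exact (Complex.continuous_ofReal.continuousAt.comp hu).add
    ((Complex.continuous_ofReal.continuousAt.comp hv).mul continuousAt_const)

theorem ContinuousAt.excessFactor {X : Type*} [TopologicalSpace X] {u v w : X → E3} {x : X}
    (hu : ContinuousAt u x) (hv : ContinuousAt v x) (hw : ContinuousAt w x) :
    ContinuousAt (fun y => _root_.excessFactor (u y) (v y) (w y)) x := by
  unfold _root_.excessFactor triple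
  exact (((continuousAt_const.sub (hu.inner hv)).sub (hu.inner hw)).add
    (hv.inner hw)).complex_mk ((hv.cross hw).inner hu).neg

theorem continuousAt_edgeLength {X : Type*} [TopologicalSpace X] {u v : X → E3} {x : X}
    (hu : ContinuousAt u x) (hv : ContinuousAt v x) (h : cross (u x) (v x) ≠ 0) :
    ContinuousAt (fun y => edgeLength (u y) (v y)) x := by
  unfold edgeLength
  refine ContinuousAt.comp (Complex.continuousAt_arg ?_)
    ((hu.inner hv).complex_mk (hu.cross hv).norm)
  rw [Complex.mem_slitPlane_iff]
  right
  simpa using h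

theorem continuousAt_polar {X : Type*} [TopologicalSpace X] {H : X → Fin n → E3} {x : X}
    (hH : ContinuousAt H x) {i : Fin n} (h : cross (H x i) (H x (i + 1)) ≠ 0) :
    ContinuousAt (fun y => polar (H y) i) x := by
  have h1 : ∀ j, ContinuousAt (fun y => H y j) x := fun j => continuousAt_pi.1 hH j
  unfold polar
  exact (((h1 _).cross (h1 _)).norm.inv₀ (by simpa using h)).smul ((h1 _).cross (h1 _))

theorem continuousAt_arg_excessFactor {X : Type*} [TopologicalSpace X] {H : X → Fin n → E3}
    {ζ : X → E3} {x : X} (hH : ContinuousAt H x) (hζ : ContinuousAt ζ x)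
    (hr : IsRegularPolygon (H x)) (hx : ζ x ∈ unitSphere) {i : Fin n}
    (ht : ζ x ∉ arc (polar (H x) i) (polar (H x) (i + 1))) :
    ContinuousAt (fun y => (excessFactor (ζ y) (polar (H y) i) (polar (H y) (i + 1))).arg) x :=
  ContinuousAt.comp (g := Complex.arg)
    (f := fun y => excessFactor (ζ y) (polar (H y) i) (polar (H y) (i + 1)))
    (Complex.continuousAt_arg
      (excessFactor_mem_slitPlane hx (hr.polar_mem i) (hr.polar_mem _) (hr.polar_ne i) ht))
    (ContinuousAt.excessFactor hζ (continuousAt_polar hH (hr.cross_ne i))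
      (continuousAt_polar hH (hr.cross_ne (i + 1))))

theorem continuousAt_polarIndex {X : Type*} [TopologicalSpace X] {H : X → Fin n → E3}
    {ζ : X → E3} {x : X} (hH : ContinuousAt H x) (hζ : ContinuousAt ζ x)
    (hr : IsRegularPolygon (H x)) (hx : ζ x ∈ unitSphere) (ht : ζ x ∉ trace (polar (H x))) :
    ContinuousAt (fun y => polarIndex (H y) (ζ y)) x := by
  have h1 : ∀ j, ContinuousAt (fun y => H y j) x := fun j => continuousAt_pi.1 hH j
  unfold polarIndex
  refine (continuousAt_const.sub (tendsto_finsetSum _ fun i _ => ?_)).div_const _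
  refine (continuousAt_edgeLength (h1 _) (h1 _) (hr.cross_ne i)).add
    (continuousAt_const.mul (continuousAt_arg_excessFactor hH hζ hr hx ?_))
  exact fun h => ht (mem_iUnion.2 ⟨i, h⟩)

/-- The directions that are not orthogonal to any vertex are dense in the sphere. -/
theorem mem_closure_inner_ne (hW : ∀ i, W i ∈ unitSphere) {x : E3} (hx : x ∈ unitSphere) :
    x ∈ closure {ξ | ξ ∈ unitSphere ∧ ∀ i, inner ℝ ξ (W i) ≠ 0} := by
  have hd : Dense (⋂ i, {v : E3 | inner ℝ v (W i) ≠ 0}) := by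
    refine dense_iInter_of_isOpen (fun i => ?_) (fun i => ?_)
    · exact isOpen_ne_fun (by fun_prop) continuous_const
    · intro v
      by_cases h : inner ℝ v (W i) = 0
      · have hc : Tendsto (fun s : ℝ => v + s • W i) (𝓝[≠] 0) (𝓝 v) := by
          have : Continuous fun s : ℝ => v + s • W i := by fun_prop
          have := this.tendsto 0
          simp only [zero_smul, add_zero] at this
          exact this.mono_left nhdsWithin_le_nhds
        refine mem_closure_of_tendsto hc ?_
        filter_upwards [self_mem_nhdsWithin] with s hs
        simp only [inner_add_left, inner_smul_left, h, mem_unitSphere.1 (hW i)]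
        simpa using hs
      · exact subset_closure h
  have hx0 : x ≠ 0 := by rintro rfl; simp [mem_unitSphere] at hx
  rw [mem_closure_iff_nhds]
  intro U hU
  have hc : ContinuousAt (fun v : E3 => ‖v‖⁻¹ • v) x :=
    (continuousAt_id.norm.inv₀ (by simpa using hx0)).smul continuousAt_id
  have hxx : ‖x‖⁻¹ • x = x := by
    rw [unitSphere, mem_sphere_zero_iff_norm] at hx
    rw [hx]; simp
  have hU' := hc.preimage_mem_nhds (by rw [hxx]; exact hU)
  obtain ⟨v, hv1, hv2⟩ := mem_closure_iff_nhds.1 (hd x) _ hU'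
  rw [mem_iInter] at hv2
  have hv0 : v ≠ 0 := by
    rintro rfl; exact hv2 0 (by simp)
  refine ⟨_, hv1, inv_norm_smul_mem_unitSphere hv0, fun i => ?_⟩
  rw [inner_smul_left]
  exact mul_ne_zero (by simpa using hv0) (hv2 i)

/-- The directions in general position are dense and the integers are closed in the reals, so the
property extends by continuity. -/
theorem exists_int_two_mul_polarIndex (hW : IsRegularPolygon W) (hξ : ξ ∈ unitSphere)
    (h : ξ ∉ trace (polar W)) : ∃ k : ℤ, 2 * polarIndex W ξ = k := by
  have hc : ContinuousAt (fun η => 2 * polarIndex W η) ξ :=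
    continuousAt_const.mul
      (continuousAt_polarIndex (H := fun _ : E3 => W) continuousAt_const continuousAt_id hW hξ h)
  have h1 := hc.continuousWithinAt.mem_closure (mem_closure_inner_ne hW.mem_sphere hξ)
    (t := range ((↑) : ℤ → ℝ)) (fun η hη => by
      obtain ⟨k, hk⟩ := exists_int_two_mul_polarIndex_of_inner_ne hW hη.1 hη.2
      exact ⟨k, hk.symm⟩)
  rw [Int.isClosedEmbedding_coe_real.isClosed_range.closure_eq] at h1
  obtain ⟨k, hk⟩ := h1
  exact ⟨k, hk.symm⟩

theorem IsPreconnected.eq_of_two_mul_mem_int {X : Type*} [TopologicalSpace X] {s : Set X}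
    (hs : IsPreconnected s) {f : X → ℝ} (hf : ContinuousOn f s)
    (hk : ∀ x ∈ s, ∃ k : ℤ, 2 * f x = k) {x y : X} (hx : x ∈ s) (hy : y ∈ s) : f x = f y := by
  have key : ∀ x ∈ s, ∀ y ∈ s, ¬ f x < f y := by
    intro x hx y hy hlt
    obtain ⟨k, hk1⟩ := hk x hx
    obtain ⟨l, hl1⟩ := hk y hy
    have hkl : k + 1 ≤ l := by
      have : (k : ℝ) < l := by linarith
      exact_mod_cast this
    have hkl' : (k : ℝ) + 1 ≤ l := by exact_mod_cast hkl
    -- A quarter above a half-integer is not a half-integer, yet it would be an intermediate value.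
    obtain ⟨z, hz, hz1⟩ := (hs.image f hf).Icc_subset (mem_image_of_mem f hx)
      (mem_image_of_mem f hy) (show f x + 1 / 4 ∈ Icc (f x) (f y) from ⟨by linarith, by linarith⟩)
    obtain ⟨m, hm⟩ := hk z hz
    have h2 : (2 * m : ℝ) = 2 * k + 1 := by linarith
    have h3 : 2 * m = 2 * k + 1 := by exact_mod_cast h2
    omega
  exact le_antisymm (not_lt.1 (key y hy x hx)) (not_lt.1 (key x hx y hy))

theorem polarIndex_eq_of_mem_component (hW : IsRegularPolygon W) {η : E3}
    (hη : η ∈ connectedComponentIn (unitSphere \ trace (polar W)) ξ) :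
    polarIndex W η = polarIndex W ξ := by
  have hξ : ξ ∈ unitSphere \ trace (polar W) := by
    by_contra h
    rw [connectedComponentIn_eq_empty h] at hη
    exact hη
  have hsub := connectedComponentIn_subset (unitSphere \ trace (polar W)) ξ
  refine isPreconnected_connectedComponentIn.eq_of_two_mul_mem_int ?_ ?_ hη
    (mem_connectedComponentIn hξ)
  · intro x hx
    exact (continuousAt_polarIndex (H := fun _ : E3 => W) continuousAt_const continuousAt_id hW
      (hsub hx).1 (hsub hx).2).continuousWithinAt
  · exact fun x hx => exists_int_two_mul_polarIndex hW (hsub hx).1 (hsub hx).2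

end Regular

theorem polarIndex_eq_of_deformation {n : ℕ} [NeZero n] {H : unitInterval → Fin n → E3} {ξ : E3}
    (hH : Continuous H) (hr : ∀ t, IsRegularPolygon (H t)) (hξ : ξ ∈ unitSphere)
    (ht : ∀ t, ξ ∉ trace (polar (H t))) : polarIndex (H 0) ξ = polarIndex (H 1) ξ :=
  isPreconnected_univ.eq_of_two_mul_mem_int (f := fun t => polarIndex (H t) ξ)
    (fun t _ => (continuousAt_polarIndex hH.continuousAt continuousAt_const (hr t) hξ
      (ht t)).continuousWithinAt)
    (fun t _ => exists_int_two_mul_polarIndex (hr t) hξ (ht t)) (mem_univ _) (mem_univ _)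

/-! ### The jump of the index across a polar edge. -/

section Crossing

variable {n : ℕ} [NeZero n] {W : Fin n → E3} {ξ η x : E3} {i : Fin n}

/-- On the open edge the factor is on the negative real axis, where the argument jumps by 2π. The
index, which contains twice the argument over 4π, jumps by 1. -/
theorem excessFactor_of_mem_openArc {b c x : E3} (hb : b ∈ unitSphere) (hc : c ∈ unitSphere)
    (hbc : b ≠ c) (hbc' : c ≠ -b) (hx : x ∈ openArc b c) :
    (excessFactor x b c).re < 0 ∧ (excessFactor x b c).im = 0 := by
  obtain ⟨hx1, s, t, hs, ht, rfl⟩ := hx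
  have k1 := inner_lt_one hb hc hbc
  have k2 := neg_one_lt_inner hb hc (fun h => hbc' (by rw [h, neg_neg]))
  rw [mem_unitSphere] at hx1
  simp only [excessFactor]
  simp only [inner_add_left, inner_add_right, inner_smul_left, inner_smul_right,
    mem_unitSphere.1 hb, mem_unitSphere.1 hc, real_inner_comm b c, conj_trivial, mul_one,
    triple_add_right, triple_smul_right, triple_self_left, triple_self_right] at hx1 ⊢
  set k := inner ℝ b c
  have h1 : 1 < s + t := by
    by_contra! h
    nlinarith [mul_pos hs ht]
  exact ⟨by nlinarith, by ring⟩

/-- The index beside an edge, in terms of the limit of the contribution of this edge. -/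
theorem polarIndex_eq_of_tendsto (hW : IsRegularPolygon W) (hξ : ξ ∈ unitSphere)
    (ht : triple (polar W i) (polar W (i + 1)) ξ ≠ 0)
    (hxi : x ∈ openArc (polar W i) (polar W (i + 1)))
    (hxj : ∀ j, j ≠ i → x ∉ arc (polar W j) (polar W (j + 1)))
    (harc : arc ξ x ∩ trace (polar W) ⊆ {x}) :
    (0 < triple (polar W i) (polar W (i + 1)) ξ → polarIndex W ξ = (2 * Real.pi
      - ∑ j, (edgeLength (W j) (W (j + 1)) + if j = i then 0 else
        2 * (excessFactor x (polar W j) (polar W (j + 1))).arg)) / (4 * Real.pi) + 1 / 2) ∧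
    (triple (polar W i) (polar W (i + 1)) ξ < 0 → polarIndex W ξ = (2 * Real.pi
      - ∑ j, (edgeLength (W j) (W (j + 1)) + if j = i then 0 else
        2 * (excessFactor x (polar W j) (polar W (j + 1))).arg)) / (4 * Real.pi) - 1 / 2) := by
  have hpi := Real.pi_pos
  set b := polar W i with hb
  set c := polar W (i + 1) with hc
  set R := (2 * Real.pi - ∑ j, (edgeLength (W j) (W (j + 1)) + if j = i then 0 else
        2 * (excessFactor x (polar W j) (polar W (j + 1))).arg)) / (4 * Real.pi) with hR
  have hx := hxi.1
  have htx : triple b c x = 0 := by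
    obtain ⟨-, s, t, -, -, rfl⟩ := hxi
    simp [triple_add_right, triple_smul_right, triple_self_left, triple_self_right]
  have hbc : b ≠ c := by
    intro h
    apply ht
    rw [h]; simp only [triple_eq_sum]; ring
  set γ : ℝ → E3 := fun s => (1 - s) • ξ + s • x with hγ
  set ρ : ℝ → E3 := fun s => ‖γ s‖⁻¹ • γ s with hρ
  have hξ0 : ξ ≠ 0 := by rintro rfl; simp [mem_unitSphere] at hξ
  have hx0 : x ≠ 0 := by rintro rfl; simp [mem_unitSphere] at hx
  have hnormξ : ‖ξ‖ = 1 := by simpa [unitSphere] using hξ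
  have hnormx : ‖x‖ = 1 := by simpa [unitSphere] using hx
  have hγ1 : γ 1 = x := by simp [hγ]
  have hγ0 : γ 0 = ξ := by simp [hγ]
  have hρ1 : ρ 1 = x := by simp only [hρ, hγ1, hnormx]; simp
  have hρ0 : ρ 0 = ξ := by simp only [hρ, hγ0, hnormξ]; simp
  have hγt : ∀ s, triple b c (γ s) = (1 - s) * triple b c ξ := by
    intro s; simp only [hγ, triple_add_right, triple_smul_right, htx, mul_zero, add_zero]
  have hγne : ∀ s, γ s ≠ 0 := by
    intro s h
    have h1 := hγt s
    rw [h] at h1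
    have h2 : (1 - s) * triple b c ξ = 0 := by rw [← h1]; simp [triple]
    rcases mul_eq_zero.1 h2 with h3 | h3
    · have : s = 1 := by linarith
      rw [this, hγ1] at h; exact hx0 h
    · exact ht h3
  have hγc : Continuous γ := by fun_prop
  have hρc : Continuous ρ :=
    (hγc.norm.inv₀ (fun s => by simpa using hγne s)).smul hγc
  have hρt : ∀ s, triple b c (ρ s) = ‖γ s‖⁻¹ * ((1 - s) * triple b c ξ) := by
    intro s; simp only [hρ, triple_smul_right, hγt]
  have hρpos : ∀ s, 0 < ‖γ s‖⁻¹ := fun s => inv_pos.2 (norm_pos_iff.2 (hγne s))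
  have hρS : ∀ s, ρ s ∈ unitSphere := fun s => inv_norm_smul_mem_unitSphere (hγne s)
  have hoff : ∀ s ∈ Ico (0 : ℝ) 1, ρ s ∉ trace (polar W) := by
    intro s hs hmem
    have h1 : ρ s ∈ arc ξ x := by
      refine ⟨hρS s, ‖γ s‖⁻¹ * (1 - s), ‖γ s‖⁻¹ * s, mul_nonneg (hρpos s).le (by linarith [hs.2]),
        mul_nonneg (hρpos s).le hs.1, ?_⟩
      simp only [hρ]
      rw [mul_smul, mul_smul, ← smul_add]
    have h2 : ρ s = x := harc ⟨h1, hmem⟩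
    have h3 := hρt s
    rw [h2, htx] at h3
    have : (1 - s) ≠ 0 := by linarith [hs.2]
    exact mul_ne_zero (hρpos s).ne' (mul_ne_zero this ht) h3.symm
  -- The path `ρ` runs from `ξ` to `x` and meets the polar polygon only at its end, so the index can
  -- be computed as a limit at `x`.
  have hconst : ∀ s ∈ Ico (0 : ℝ) 1, polarIndex W (ρ s) = polarIndex W ξ := by
    intro s hs
    have := isPreconnected_Ico.eq_of_two_mul_mem_int (f := fun s => polarIndex W (ρ s))
      (s := Ico (0 : ℝ) 1) (fun s hs => (continuousAt_polarIndex (H := fun _ : ℝ => W)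
        continuousAt_const hρc.continuousAt hW (hρS s) (hoff s hs)).continuousWithinAt)
      (fun s hs => exists_int_two_mul_polarIndex hW (hρS s) (hoff s hs)) hs
      (show (0 : ℝ) ∈ Ico (0 : ℝ) 1 by simp)
    simpa only [hρ0] using this
  have hev : ∀ᶠ s in 𝓝[<] (1 : ℝ), s ∈ Ico (0 : ℝ) 1 :=
    Ico_mem_nhdsLT (by norm_num)
  -- All terms but that of the edge `i` are continuous at `x`; `θ` is the one-sided limit of the
  -- exceptional argument.
  have key : ∀ θ : ℝ, Tendsto (fun s => (excessFactor (ρ s) b c).arg) (𝓝[<] 1) (𝓝 θ) →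
      polarIndex W ξ = R - 2 * θ / (4 * Real.pi) := by
    intro θ hθ
    have h1 : Tendsto (fun s => polarIndex W (ρ s)) (𝓝[<] 1) (𝓝 (polarIndex W ξ)) := by
      refine tendsto_const_nhds.congr' ?_
      filter_upwards [hev] with s hs
      exact (hconst s hs).symm
    have h2 : Tendsto (fun s => polarIndex W (ρ s)) (𝓝[<] 1) (𝓝 ((2 * Real.pi
        - ∑ j, (edgeLength (W j) (W (j + 1)) + if j = i then 2 * θ else
        2 * (excessFactor x (polar W j) (polar W (j + 1))).arg)) / (4 * Real.pi))) := by
      unfold polarIndex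
      refine (tendsto_const_nhds.sub (tendsto_finsetSum _ fun j _ =>
        tendsto_const_nhds.add ?_)).div_const _
      split_ifs with hj
      · subst hj
        exact hθ.const_mul 2
      · have := (continuousAt_arg_excessFactor (H := fun _ : ℝ => W) (ζ := ρ) (x := 1) (i := j)
          continuousAt_const hρc.continuousAt hW (hρS 1) (by rw [hρ1]; exact hxj j hj)).tendsto
        rw [hρ1] at this
        exact (this.mono_left nhdsWithin_le_nhds).const_mul 2
    rw [tendsto_nhds_unique h1 h2, hR]
    have h3 : ∑ j, (edgeLength (W j) (W (j + 1)) + if j = i then 2 * θ else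
        2 * (excessFactor x (polar W j) (polar W (j + 1))).arg)
        = ∑ j, (edgeLength (W j) (W (j + 1)) + if j = i then 0 else
        2 * (excessFactor x (polar W j) (polar W (j + 1))).arg) + 2 * θ := by
      have : ∀ j, (edgeLength (W j) (W (j + 1)) + if j = i then 2 * θ else
          2 * (excessFactor x (polar W j) (polar W (j + 1))).arg)
          = (edgeLength (W j) (W (j + 1)) + if j = i then 0 else
          2 * (excessFactor x (polar W j) (polar W (j + 1))).arg)
            + if j = i then 2 * θ else 0 := by
        intro j; split_ifs <;> ring
      rw [Finset.sum_congr rfl (fun j _ => this j), Finset.sum_add_distrib]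
      simp
    rw [h3]; ring
  obtain ⟨hre, him⟩ := excessFactor_of_mem_openArc (hW.polar_mem i) (hW.polar_mem (i + 1)) hbc
    (hW.polar_ne i) hxi
  have hz : Tendsto (fun s => excessFactor (ρ s) b c) (𝓝[<] 1) (𝓝 (excessFactor x b c)) := by
    have := (ContinuousAt.excessFactor (hρc.continuousAt (x := 1))
      (continuousAt_const (y := b)) (continuousAt_const (y := c))).tendsto
    rw [hρ1] at this
    exact this.mono_left nhdsWithin_le_nhds
  constructor
  · intro hpos
    -- On the left of the edge the factor has negative imaginary part and its argument tends to
    -- `-π`; on the right it tends to `π`.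
    have h1 := (Complex.tendsto_arg_nhdsWithin_im_neg_of_re_neg_of_im_zero hre him).comp
      (tendsto_nhdsWithin_iff.2 ⟨hz, by
        filter_upwards [hev] with s hs
        show (excessFactor (ρ s) b c).im < 0
        simp only [excessFactor, hρt]
        have := mul_pos (hρpos s) (mul_pos (by linarith [hs.2] : 0 < 1 - s) hpos)
        linarith⟩)
    rw [key _ h1]
    field_simp
    ring
  · intro hneg
    have h1 := (Complex.tendsto_arg_nhdsWithin_im_nonneg_of_re_neg_of_im_zero hre him).comp
      (tendsto_nhdsWithin_iff.2 ⟨hz, by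
        filter_upwards [hev] with s hs
        show 0 ≤ (excessFactor (ρ s) b c).im
        simp only [excessFactor, hρt]
        have := mul_pos (hρpos s) (mul_pos (by linarith [hs.2] : 0 < 1 - s) (neg_pos.2 hneg))
        linarith⟩)
    rw [key _ h1]
    field_simp
    ring

theorem arc_comm (u v : E3) : arc u v = arc v u := by
  ext x
  constructor <;> rintro ⟨h, a, b, ha, hb, rfl⟩ <;> exact ⟨h, b, a, hb, ha, add_comm _ _⟩

theorem arc_subset_arc {u v x : E3} (hx : x ∈ arc u v) : arc u x ⊆ arc u v := by
  obtain ⟨-, a, b, ha, hb, rfl⟩ := hx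
  rintro y ⟨hy, c, d, hc, hd, rfl⟩
  refine ⟨hy, c + d * a, d * b, by positivity, by positivity, ?_⟩
  rw [smul_add, smul_smul, smul_smul, add_smul, add_assoc]

theorem not_mem_trace_of_crossing (ht : triple (polar W i) (polar W (i + 1)) ξ ≠ 0)
    (hξ : ξ ∈ unitSphere) (hx : arc ξ η ∩ trace (polar W) = {x})
    (hxi : x ∈ openArc (polar W i) (polar W (i + 1))) : ξ ∉ trace (polar W) := by
  intro h
  have : ξ ∈ arc ξ η ∩ trace (polar W) := ⟨⟨hξ, 1, 0, zero_le_one, le_rfl, by simp⟩, h⟩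
  rw [hx] at this
  obtain ⟨-, s, t, -, -, e⟩ := hxi
  rw [mem_singleton_iff.1 this, e] at ht
  simp [triple_add_right, triple_smul_right, triple_self_left, triple_self_right] at ht

theorem polarIndex_crossing (hW : IsRegularPolygon W) (hξ : ξ ∈ unitSphere) (hη : η ∈ unitSphere)
    (hleft : 0 < triple (polar W i) (polar W (i + 1)) ξ)
    (hright : triple (polar W i) (polar W (i + 1)) η < 0)
    (hx : arc ξ η ∩ trace (polar W) = {x})
    (hxi : x ∈ openArc (polar W i) (polar W (i + 1)))
    (hxj : ∀ j, j ≠ i → x ∉ arc (polar W j) (polar W (j + 1))) :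
    polarIndex W η = polarIndex W ξ - 1 := by
  have hxm : x ∈ arc ξ η := (hx.symm.subset (mem_singleton x)).1
  have h1 := (polarIndex_eq_of_tendsto hW hξ hleft.ne' hxi hxj (fun y hy => by
    rw [← hx]; exact ⟨arc_subset_arc hxm hy.1, hy.2⟩)).1 hleft
  have h2 := (polarIndex_eq_of_tendsto hW hη hright.ne hxi hxj (fun y hy => by
    rw [← hx, arc_comm]; exact ⟨arc_subset_arc (by rwa [arc_comm]) hy.1, hy.2⟩)).2 hright
  rw [h1, h2]; ring

end Crossing

/-! ### Invariance under relabelling and subdivision of edges. -/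

section Relabel

variable {n : ℕ} [NeZero n] {W : Fin n → E3}

theorem isRegularPolygon_relabel (hW : IsRegularPolygon W) :
    IsRegularPolygon (fun i => W (i + 1)) :=
  ⟨fun _ => hW.mem_sphere _, fun _ => hW.cross_ne _, fun _ => hW.polar_ne _⟩

theorem trace_relabel (P : Fin n → E3) : trace (fun i => P (i + 1)) = trace P :=
  (Equiv.addRight (1 : Fin n)).surjective.iUnion_comp (fun i => arc (P i) (P (i + 1)))

theorem polarIndex_relabel (W : Fin n → E3) (ξ : E3) :
    polarIndex (fun i => W (i + 1)) ξ = polarIndex W ξ := by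
  unfold polarIndex
  congr 2
  exact Equiv.sum_comp (Equiv.addRight (1 : Fin n)) (fun i => edgeLength (W i) (W (i + 1))
    + 2 * (excessFactor ξ (polar W i) (polar W (i + 1))).arg)

end Relabel

section Insert

/-- The product of the complex numbers of the two halves is that of the whole edge, and all three
arguments lie in `(0, π)`. -/
theorem edgeLength_add_edgeLength {u v p : E3} (hu : u ∈ unitSphere) (hv : v ∈ unitSphere)
    (huv : cross u v ≠ 0) (hp : p ∈ openArc u v) :
    edgeLength u p + edgeLength p v = edgeLength u v := by
  obtain ⟨hp1, a, b, ha, hb, rfl⟩ := hp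
  have hs : 0 < ‖cross u v‖ := norm_pos_iff.2 huv
  have h1 : cross u (a • u + b • v) = b • cross u v := by apply E3.ext <;> simp <;> ring
  have h2 : cross (a • u + b • v) v = a • cross u v := by apply E3.ext <;> simp <;> ring
  rw [mem_unitSphere] at hu hv hp1
  have hcs : inner ℝ u v ^ 2 + ‖cross u v‖ ^ 2 = 1 := by
    rw [← real_inner_self_eq_norm_sq, inner_cross_cross, hu, hv, real_inner_comm u v]; ring
  simp only [inner_add_left, inner_add_right, inner_smul_left, inner_smul_right, hu, hv,
    real_inner_comm u v, conj_trivial, mul_one] at hp1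
  unfold edgeLength
  rw [h1, h2, norm_smul, norm_smul, Real.norm_of_nonneg ha.le, Real.norm_of_nonneg hb.le]
  simp only [inner_add_left, inner_add_right, inner_smul_left, inner_smul_right, hu, hv,
    conj_trivial, mul_one]
  set c := inner ℝ u v
  set s := ‖cross u v‖
  have p1 := arg_pos_of_im_pos (z := ⟨a + b * c, b * s⟩) (mul_pos hb hs)
  have p2 := arg_pos_of_im_pos (z := ⟨a * c + b, a * s⟩) (mul_pos ha hs)
  have p3 := arg_pos_of_im_pos (z := ⟨c, s⟩) hs
  have q1 := arg_lt_pi_of_im_pos (z := ⟨a + b * c, b * s⟩) (mul_pos hb hs)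
  have q2 := arg_lt_pi_of_im_pos (z := ⟨a * c + b, a * s⟩) (mul_pos ha hs)
  have q3 := arg_lt_pi_of_im_pos (z := ⟨c, s⟩) hs
  refine eq_of_coe_eq ?_ (by linarith) (by linarith)
  rw [Real.Angle.coe_add, ← Complex.arg_mul_coe_angle]
  · congr 2
    apply Complex.ext
    · simp only [Complex.mul_re]; linear_combination c * hp1 - a * b * hcs
    · simp only [Complex.mul_im]; linear_combination s * hp1
  · intro h; rw [h] at p1; simp at p1
  · intro h; rw [h] at p2; simp at p2

variable {m : ℕ} {W : Fin (m + 1) → E3} {p ξ : E3}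

theorem snoc_add_one (V : Fin (m + 1) → E3) (p : E3) (i : Fin (m + 2)) :
    (Fin.snoc V p : Fin (m + 2) → E3) (i + 1)
      = Fin.lastCases (V 0) (fun j => Fin.lastCases p (fun k => V k.succ) j) i := by
  induction i using Fin.lastCases with
  | last =>
    rw [Fin.last_add_one, Fin.lastCases_last]
    exact Fin.snoc_castSucc (α := fun _ => E3) p V 0
  | cast j =>
    rw [Fin.coeSucc_eq_succ, Fin.lastCases_castSucc]
    induction j using Fin.lastCases with
    | last => rw [Fin.lastCases_last, Fin.succ_last, Fin.snoc_last]
    | cast k => rw [Fin.lastCases_castSucc, Fin.succ_castSucc, Fin.snoc_castSucc]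

theorem inv_norm_smul_smul {a : ℝ} (ha : 0 < a) (v : E3) :
    ‖a • v‖⁻¹ • a • v = ‖v‖⁻¹ • v := by
  rw [norm_smul, Real.norm_of_nonneg ha.le, smul_smul, mul_inv, mul_comm a⁻¹, mul_assoc,
    inv_mul_cancel₀ ha.ne', mul_one]

/-- Both halves of the subdivided edge span the same oriented plane, so the polar polygon merely
repeats its last vertex. -/
theorem polar_snoc (hp : p ∈ openArc (W (Fin.last m)) (W 0)) :
    polar (Fin.snoc (α := fun _ => E3) W p : Fin (m + 2) → E3)
      = Fin.snoc (α := fun _ => E3) (polar W) (polar W (Fin.last m)) := by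
  obtain ⟨-, a, b, ha, hb, rfl⟩ := hp
  have h1 : cross (W (Fin.last m)) (a • W (Fin.last m) + b • W 0)
    = b • cross (W (Fin.last m)) (W 0) := by apply E3.ext <;> simp <;> ring
  have h2 : cross (a • W (Fin.last m) + b • W 0) (W 0)
    = a • cross (W (Fin.last m)) (W 0) := by apply E3.ext <;> simp <;> ring
  funext i
  unfold polar
  rw [snoc_add_one]
  induction i using Fin.lastCases with
  | last =>
    rw [Fin.snoc_last, Fin.snoc_last, Fin.lastCases_last, h2, inv_norm_smul_smul ha,
      Fin.last_add_one]
  | cast j =>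
    rw [Fin.snoc_castSucc, Fin.snoc_castSucc, Fin.lastCases_castSucc]
    induction j using Fin.lastCases with
    | last => rw [Fin.lastCases_last, h1, inv_norm_smul_smul hb, Fin.last_add_one]
    | cast k => rw [Fin.lastCases_castSucc, Fin.coeSucc_eq_succ]

theorem isRegularPolygon_snoc (hW : IsRegularPolygon W)
    (hp : p ∈ openArc (W (Fin.last m)) (W 0)) :
    IsRegularPolygon (Fin.snoc (α := fun _ => E3) W p : Fin (m + 2) → E3) := by
  have hp' := hp
  obtain ⟨hp1, a, b, ha, hb, rfl⟩ := hp
  have h1 : cross (W (Fin.last m)) (a • W (Fin.last m) + b • W 0)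
    = b • cross (W (Fin.last m)) (W 0) := by apply E3.ext <;> simp <;> ring
  have h2 : cross (a • W (Fin.last m) + b • W 0) (W 0)
    = a • cross (W (Fin.last m)) (W 0) := by apply E3.ext <;> simp <;> ring
  have hl := hW.cross_ne (Fin.last m)
  have hl' := hW.polar_ne (Fin.last m)
  rw [Fin.last_add_one] at hl hl'
  refine ⟨fun i => ?_, fun i => ?_, fun i => ?_⟩
  · induction i using Fin.lastCases with
    | last => rw [Fin.snoc_last]; exact hp1
    | cast j => rw [Fin.snoc_castSucc]; exact hW.mem_sphere j
  · rw [snoc_add_one]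
    induction i using Fin.lastCases with
    | last => rw [Fin.snoc_last, Fin.lastCases_last, h2]; exact smul_ne_zero ha.ne' hl
    | cast j =>
      rw [Fin.snoc_castSucc, Fin.lastCases_castSucc]
      induction j using Fin.lastCases with
      | last => rw [Fin.lastCases_last, h1]; exact smul_ne_zero hb.ne' hl
      | cast k =>
        have := hW.cross_ne k.castSucc
        rwa [Fin.lastCases_castSucc, ← Fin.coeSucc_eq_succ]
  · rw [polar_snoc hp', snoc_add_one]
    induction i using Fin.lastCases with
    | last => rw [Fin.snoc_last, Fin.lastCases_last]; exact hl'
    | cast j =>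
      rw [Fin.snoc_castSucc, Fin.lastCases_castSucc]
      induction j using Fin.lastCases with
      | last =>
        rw [Fin.lastCases_last]
        intro h
        have h3 := mem_unitSphere.1 (hW.polar_mem (Fin.last m))
        have h4 := congrArg (inner ℝ (polar W (Fin.last m))) h
        rw [inner_neg_right, h3] at h4
        linarith
      | cast k =>
        have := hW.polar_ne k.castSucc
        rwa [Fin.lastCases_castSucc, ← Fin.coeSucc_eq_succ]

theorem trace_snoc_self (P : Fin (m + 1) → E3) :
    trace (Fin.snoc (α := fun _ => E3) P (P (Fin.last m)) : Fin (m + 2) → E3) = trace P := by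
  have key : ∀ i : Fin (m + 2), arc ((Fin.snoc (α := fun _ => E3) P (P (Fin.last m))
      : Fin (m + 2) → E3) i) ((Fin.snoc (α := fun _ => E3) P (P (Fin.last m))
      : Fin (m + 2) → E3) (i + 1)) = Fin.lastCases (arc (P (Fin.last m)) (P 0)) (fun j =>
      Fin.lastCases (arc (P (Fin.last m)) (P (Fin.last m))) (fun k => arc (P k.castSucc)
      (P k.succ)) j) i := by
    intro i
    rw [snoc_add_one]
    induction i using Fin.lastCases with
    | last => rw [Fin.snoc_last, Fin.lastCases_last, Fin.lastCases_last]
    | cast j =>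
      rw [Fin.snoc_castSucc, Fin.lastCases_castSucc, Fin.lastCases_castSucc]
      induction j using Fin.lastCases with
      | last => rw [Fin.lastCases_last, Fin.lastCases_last]
      | cast k => rw [Fin.lastCases_castSucc, Fin.lastCases_castSucc]
  unfold trace
  rw [iUnion_congr key]
  ext x
  simp only [mem_iUnion]
  constructor
  · rintro ⟨i, hi⟩
    induction i using Fin.lastCases with
    | last =>
      rw [Fin.lastCases_last] at hi
      exact ⟨Fin.last m, by rwa [Fin.last_add_one]⟩
    | cast j =>
      rw [Fin.lastCases_castSucc] at hi
      induction j using Fin.lastCases with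
      | last =>
        rw [Fin.lastCases_last] at hi
        obtain ⟨hx, a, b, ha, hb, rfl⟩ := hi
        exact ⟨Fin.last m, hx, a + b, 0, by positivity, le_rfl, by
          rw [add_smul, zero_smul, add_zero]⟩
      | cast k =>
        rw [Fin.lastCases_castSucc] at hi
        exact ⟨k.castSucc, by rwa [Fin.coeSucc_eq_succ]⟩
  · rintro ⟨i, hi⟩
    induction i using Fin.lastCases with
    | last =>
      rw [Fin.last_add_one] at hi
      exact ⟨Fin.last _, by rwa [Fin.lastCases_last]⟩
    | cast k =>
      rw [Fin.coeSucc_eq_succ] at hi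
      exact ⟨k.castSucc.castSucc, by rwa [Fin.lastCases_castSucc, Fin.lastCases_castSucc]⟩

/-- The lengths of the two halves add up, and the degenerate polar edge contributes nothing because
its factor is a positive real number. -/
theorem polarIndex_snoc (hW : IsRegularPolygon W) (hξ : ξ ∈ unitSphere)
    (ht : ξ ∉ trace (polar W)) (hp : p ∈ openArc (W (Fin.last m)) (W 0)) :
    polarIndex (Fin.snoc (α := fun _ => E3) W p : Fin (m + 2) → E3) ξ = polarIndex W ξ := by
  have hl := hW.cross_ne (Fin.last m)
  rw [Fin.last_add_one] at hl
  have hadd := edgeLength_add_edgeLength (hW.mem_sphere _) (hW.mem_sphere 0) hl hp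
  have hz : (excessFactor ξ (polar W (Fin.last m)) (polar W (Fin.last m))).arg = 0 := by
    have h1 : ξ ≠ polar W (Fin.last m) := by
      rintro rfl
      exact ht (mem_iUnion.2 ⟨Fin.last m, hξ, 1, 0, zero_le_one, le_rfl, by simp⟩)
    have h2 := inner_lt_one hξ (hW.polar_mem _) h1
    rw [Complex.arg_eq_zero_iff]
    simp only [excessFactor, mem_unitSphere.1 (hW.polar_mem (Fin.last m))]
    constructor
    · linarith
    · simp only [triple_eq_sum]; ring
  unfold polarIndex
  congr 2
  rw [polar_snoc hp, Fin.sum_univ_castSucc, Fin.sum_univ_castSucc, Fin.sum_univ_castSucc]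
  simp only [snoc_add_one, Fin.snoc_last, Fin.snoc_castSucc, Fin.lastCases_last,
    Fin.lastCases_castSucc, hz]
  simp only [Fin.last_add_one, Fin.coeSucc_eq_succ]
  linarith

end Insert

/-! ### Hopf's argument on grids of directions. -/

section Grid

/-- The four corners of an elementary square lie in a common open half-plane. -/
def SquareToward (U : ℕ → ℕ → ℂ) (i j : ℕ) : Prop :=
  ∃ z, Toward z (U i j) ∧ Toward z (U i (j + 1)) ∧ Toward z (U (i + 1) j) ∧
    Toward z (U (i + 1) (j + 1))

variable {U : ℕ → ℕ → ℂ}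

/-- Both ways around an elementary square give the same turn: the signed angle is a discrete closed
form. -/
theorem SquareToward.turn_eq {i j : ℕ} (h : SquareToward U i j) :
    turn (U i j) (U i (j + 1)) + turn (U i (j + 1)) (U (i + 1) (j + 1))
      = turn (U i j) (U (i + 1) j) + turn (U (i + 1) j) (U (i + 1) (j + 1)) := by
  obtain ⟨z, h1, h2, h3, h4⟩ := h
  rw [h1.turn_add h2 h4, h1.turn_add h3 h4]

theorem turn_strip {j a b : ℕ} (hab : a ≤ b) (h : ∀ i, a ≤ i → i < b → SquareToward U i j) :
    turn (U a j) (U a (j + 1))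
      + ∑ i ∈ Finset.Ico a b, turn (U i (j + 1)) (U (i + 1) (j + 1))
      = ∑ i ∈ Finset.Ico a b, turn (U i j) (U (i + 1) j) + turn (U b j) (U b (j + 1)) := by
  induction b, hab using Nat.le_induction with
  | base => simp
  | succ b hab ih =>
    rw [Finset.sum_Ico_succ_top hab, Finset.sum_Ico_succ_top hab]
    have h1 := ih (fun i h1 h2 => h i h1 (by omega))
    have h2 := (h b hab (by omega)).turn_eq
    linarith

/-- Summing over squares cancels interior sides, so the turn between opposite corners is independent
of the path. -/
theorem turn_rectangle {a b c d : ℕ} (hab : a ≤ b) (hcd : c ≤ d)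
    (h : ∀ i j, a ≤ i → i < b → c ≤ j → j < d → SquareToward U i j) :
    ∑ j ∈ Finset.Ico c d, turn (U a j) (U a (j + 1))
      + ∑ i ∈ Finset.Ico a b, turn (U i d) (U (i + 1) d)
      = ∑ i ∈ Finset.Ico a b, turn (U i c) (U (i + 1) c)
        + ∑ j ∈ Finset.Ico c d, turn (U b j) (U b (j + 1)) := by
  induction d, hcd using Nat.le_induction with
  | base => simp
  | succ d hcd ih =>
    rw [Finset.sum_Ico_succ_top hcd, Finset.sum_Ico_succ_top hcd]
    have h1 := ih (fun i j h1 h2 h3 h4 => h i j h1 h2 h3 (by omega))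
    have h2 := turn_strip hab (fun i h1 h2 => h i d h1 h2 hcd (by omega))
    linarith

/-- The discrete form of Hopf's argument for the theorem of turning tangents. -/
theorem turn_triangle {m : ℕ} (hs : ∀ i j, i + 1 < j → j ≤ m → SquareToward U i j)
    (ht : ∀ i, i < m → ∃ z, Toward z (U i (i + 1)) ∧ Toward z (U i (i + 2)) ∧
      Toward z (U (i + 1) (i + 2))) :
    ∑ k ∈ Finset.Ico 0 m, turn (U k (k + 1)) (U (k + 1) (k + 2))
      = ∑ j ∈ Finset.Ico 1 (m + 1), turn (U 0 j) (U 0 (j + 1))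
        + ∑ i ∈ Finset.Ico 0 m, turn (U i (m + 1)) (U (i + 1) (m + 1)) := by
  induction m with
  | zero => simp
  | succ m ih =>
    have h1 := ih (fun i j h1 h2 => hs i j h1 (by omega)) (fun i hi => ht i (by omega))
    have h2 := turn_strip (U := U) (j := m + 1) (Nat.zero_le m)
      (fun i _ hi => hs i (m + 1) (by omega) le_rfl)
    -- The squares stop short of the diagonal of consecutive secants; the last triangle of the new
    -- column closes the gap.
    obtain ⟨z, z1, z2, z3⟩ := ht m (by omega)
    have h3 : turn (U m (m + 1)) (U m (m + 1 + 1)) + turn (U m (m + 1 + 1))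
        (U (m + 1) (m + 1 + 1)) = turn (U m (m + 1)) (U (m + 1) (m + 2)) := z1.turn_add z2 z3
    rw [Finset.sum_Ico_succ_top (Nat.zero_le m), Finset.sum_Ico_succ_top (by omega),
      Finset.sum_Ico_succ_top (Nat.zero_le m)]
    linarith

end Grid

/-! ### Separating planes and secant directions. -/

/-- Finitely many vectors without a nontrivial nonnegative relation lie in an open half-space. -/
theorem exists_inner_pos {ι : Type*} [Fintype ι] [Nonempty ι] (u : ι → E3)
    (h : ∀ w : ι → ℝ, (∀ i, 0 ≤ w i) → ∑ i, w i • u i = 0 → ∀ i, w i = 0) :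
    ∃ g : E3, ∀ i, 0 < inner ℝ g (u i) := by
  classical
  set f : (ι → ℝ) →ₗ[ℝ] E3 := Fintype.linearCombination ℝ u with hf
  have hfc : Continuous f := f.continuous_of_finiteDimensional
  have hcl : IsClosed (f '' stdSimplex ℝ ι) := ((isCompact_stdSimplex ℝ ι).image hfc).isClosed
  have hcv : Convex ℝ (f '' stdSimplex ℝ ι) := (convex_stdSimplex ℝ ι).linear_image f
  have h0 : (0 : E3) ∉ f '' stdSimplex ℝ ι := by
    rintro ⟨w, ⟨hw0, hw1⟩, hw⟩
    have := h w hw0 (by rw [← hw, hf, Fintype.linearCombination_apply])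
    rw [Finset.sum_eq_zero (fun i _ => this i)] at hw1
    exact zero_ne_one hw1
  -- The convex hull of the vectors is compact and misses 0; a functional separating it from 0 is
  -- positive on all of them.
  obtain ⟨l, r, hl0, hl⟩ := geometric_hahn_banach_point_closed hcv hcl h0
  refine ⟨(InnerProductSpace.toDual ℝ E3).symm l, fun i => ?_⟩
  rw [InnerProductSpace.toDual_symm_apply]
  have := hl (u i) ⟨Pi.single i 1, single_mem_stdSimplex ℝ i, by
    rw [hf, Fintype.linearCombination_apply_single, one_smul]⟩
  rw [map_zero] at hl0
  linarith

/-- The convex cones spanned by `a`, `b` and by `c`, `d` are pointed and meet only in `0`. -/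
def ConesDisjoint (a b c d : E3) : Prop :=
  ∀ r s t u : ℝ, 0 ≤ r → 0 ≤ s → 0 ≤ t → 0 ≤ u → r • a + s • b = t • c + u • d →
    r = 0 ∧ s = 0 ∧ t = 0 ∧ u = 0

/-- Apply the preceding alternative to `-a`, `-b`, `c`, `d`. -/
theorem ConesDisjoint.exists_separating {a b c d : E3} (h : ConesDisjoint a b c d) :
    ∃ g : E3, inner ℝ g a < 0 ∧ inner ℝ g b < 0 ∧ 0 < inner ℝ g c ∧ 0 < inner ℝ g d := by
  obtain ⟨g, hg⟩ := exists_inner_pos ![-a, -b, c, d] (by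
    intro w hw h0
    simp only [Fin.sum_univ_four, Matrix.cons_val] at h0
    have := h (w 0) (w 1) (w 2) (w 3) (hw 0) (hw 1) (hw 2) (hw 3) (by
      rw [← sub_eq_zero, ← neg_eq_zero, ← h0]; module)
    intro i; fin_cases i <;> simp [this])
  have h0 := hg 0; have h1 := hg 1; have h2 := hg 2; have h3 := hg 3
  simp only [Matrix.cons_val, inner_neg_right] at h0 h1 h2 h3
  exact ⟨g, by linarith, by linarith, h2, h3⟩

theorem eq_zero_of_triple_ne_zero {a b c : E3} (h : triple a b c ≠ 0) {r s t : ℝ}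
    (h0 : r • a + s • b + t • c = 0) : r = 0 ∧ s = 0 ∧ t = 0 := by
  have e : ∀ p q : E3, triple p q (r • a + s • b + t • c) = 0 := by
    intro p q; rw [h0]; simp [triple]
  have h1 := e b c; have h2 := e c a; have h3 := e a b
  simp only [triple_add_right, triple_smul_right, triple_self_left, triple_self_right] at h1 h2 h3
  have e1 : triple b c a = triple a b c := (triple_rotate a b c).symm
  have e2 : triple c a b = triple a b c := triple_rotate c a b
  rw [e1] at h1; rw [e2] at h2
  simp only [mul_zero, add_zero, zero_add, mul_eq_zero, h, or_false] at h1 h2 h3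
  exact ⟨h1, h2, h3⟩

section Secant

variable {ξ : E3} {φ : E3 →ₗ[ℝ] ℂ}

/-- The direction from `v` to `w` in the central projection along `ξ`. -/
def secant (ξ : E3) (φ : E3 →ₗ[ℝ] ℂ) (v w : E3) : ℂ :=
  φ (inner ℝ ξ v • w - inner ℝ ξ w • v)

theorem secant_swap (v w : E3) : secant ξ φ w v = -secant ξ φ v w := by
  rw [secant, secant, ← map_neg, neg_sub]

theorem secant_smul_smul (r s : ℝ) (v w : E3) :
    secant ξ φ (r • v) (s • w) = ((r * s : ℝ) : ℂ) * secant ξ φ v w := by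
  rw [secant, secant, ← Complex.real_smul, ← map_smul, inner_smul_right, inner_smul_right]
  congr 1
  module

/-- The vector under the chart is orthogonal to `ξ`, so its product with `g` can be computed in the
plane. -/
theorem IsPlaneChart.toward_secant (hφ : IsPlaneChart ξ φ) {g v w : E3}
    (h : 0 < inner ℝ ξ v * inner ℝ g w - inner ℝ ξ w * inner ℝ g v) :
    Toward (φ g) (secant ξ φ v w) := by
  rw [Toward, secant, hφ]
  simp only [inner_sub_right, inner_smul_right]
  nlinarith

theorem IsPlaneChart.im_secant (hφ : IsPlaneChart ξ φ) (hξ : ξ ∈ unitSphere) (a b c : E3) :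
    (conj (secant ξ φ a b) * secant ξ φ a c).im = inner ℝ ξ a * triple a b c := by
  rw [secant, secant, hφ]
  have : triple (inner ℝ ξ a • b - inner ℝ ξ b • a) (inner ℝ ξ a • c - inner ℝ ξ c • a) ξ
      = inner ℝ ξ a * triple a b c * inner ℝ ξ ξ := by
    simp only [inner_eq_sum, triple_eq_sum, PiLp.sub_apply, PiLp.smul_apply, smul_eq_mul]; ring
  simp only [this, mem_unitSphere.1 hξ, mul_one]

/-- Two consecutive segments that are not aligned have directions in an open half-plane. -/
theorem exists_toward_consecutive (hφ : IsPlaneChart ξ φ) {a b c : E3} (hb : 0 < inner ℝ ξ b)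
    (h : triple a b c ≠ 0) :
    ∃ z, Toward z (secant ξ φ a b) ∧ Toward z (secant ξ φ b c) := by
  obtain ⟨g, hg⟩ := exists_inner_pos ![inner ℝ ξ a • b - inner ℝ ξ b • a,
      inner ℝ ξ b • c - inner ℝ ξ c • b] (by
    intro w hw h0
    simp only [Fin.sum_univ_two, Matrix.cons_val] at h0
    have := eq_zero_of_triple_ne_zero h (r := -(w 0 * inner ℝ ξ b))
      (s := w 0 * inner ℝ ξ a - w 1 * inner ℝ ξ c) (t := w 1 * inner ℝ ξ b) (by
        rw [← h0]; module)
    intro i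
    fin_cases i
    · have := this.1; simpa [hb.ne'] using this
    · have := this.2.2; simpa [hb.ne'] using this)
  have h0 := hg 0; have h1 := hg 1
  simp only [Matrix.cons_val, inner_sub_right, inner_smul_right] at h0 h1
  exact ⟨φ g, hφ.toward_secant h0, hφ.toward_secant h1⟩

theorem Toward.of_ofReal_mul {z v : ℂ} {r : ℝ} (hr : 0 < r) (h : Toward z (r * v)) :
    Toward z v := by
  unfold Toward at *
  rw [mul_left_comm, Complex.re_ofReal_mul] at h; exact pos_of_mul_pos_right h hr.le

/-- The third side of a triangle points between the other two. -/
theorem toward_secant_third {z : ℂ} {a b c : E3} (hb : 0 < inner ℝ ξ b) (ha : 0 ≤ inner ℝ ξ a)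
    (hc : 0 ≤ inner ℝ ξ c) (hac : 0 < inner ℝ ξ a ∨ 0 < inner ℝ ξ c)
    (h1 : Toward z (secant ξ φ a b)) (h2 : Toward z (secant ξ φ b c)) :
    Toward z (secant ξ φ a c) := by
  have key : (inner ℝ ξ b : ℂ) * secant ξ φ a c
      = (inner ℝ ξ a : ℂ) * secant ξ φ b c + (inner ℝ ξ c : ℂ) * secant ξ φ a b := by
    simp only [secant, ← Complex.real_smul, ← map_smul, ← map_add]
    congr 1
    module
  apply Toward.of_ofReal_mul hb
  rw [key]
  unfold Toward at *
  rw [mul_add, mul_left_comm, mul_left_comm (conj z), Complex.add_re, Complex.re_ofReal_mul,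
    Complex.re_ofReal_mul]
  rcases hac with h | h
  · have := mul_pos h h2; have := mul_nonneg hc h1.le; linarith
  · have := mul_nonneg ha h2.le; have := mul_pos h h1; linarith

/-- A plane separating two disjoint edges gives one half-plane for all secants from one edge to the
other. Vectors orthogonal to `ξ` are points at infinity of the projection; the side conditions
exclude secants between two of them. -/
theorem exists_toward_square (hφ : IsPlaneChart ξ φ) {a b c d : E3} (h : ConesDisjoint a b c d)
    (ha : 0 ≤ inner ℝ ξ a) (hb : 0 ≤ inner ℝ ξ b) (hc : 0 ≤ inner ℝ ξ c) (hd : 0 ≤ inner ℝ ξ d) :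
    ∃ z, (0 < inner ℝ ξ a ∨ 0 < inner ℝ ξ c → Toward z (secant ξ φ a c)) ∧
      (0 < inner ℝ ξ a ∨ 0 < inner ℝ ξ d → Toward z (secant ξ φ a d)) ∧
      (0 < inner ℝ ξ b ∨ 0 < inner ℝ ξ c → Toward z (secant ξ φ b c)) ∧
      (0 < inner ℝ ξ b ∨ 0 < inner ℝ ξ d → Toward z (secant ξ φ b d)) := by
  obtain ⟨g, g1, g2, g3, g4⟩ := h.exists_separating
  have key : ∀ v w : E3, 0 ≤ inner ℝ ξ v → 0 ≤ inner ℝ ξ w → inner ℝ g v < 0 → 0 < inner ℝ g w →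
      (0 < inner ℝ ξ v ∨ 0 < inner ℝ ξ w) → Toward (φ g) (secant ξ φ v w) := by
    intro v w hv hw gv gw hvw
    apply hφ.toward_secant
    rcases hvw with h | h
    · have := mul_pos h gw; have := mul_nonneg hw (neg_pos.2 gv).le; linarith
    · have := mul_nonneg hv gw.le; have := mul_pos h (neg_pos.2 gv); linarith
  exact ⟨φ g, key a c ha hc g1 g3, key a d ha hd g1 g4, key b c hb hc g2 g3, key b d hb hd g2 g4⟩

/-- The secant directions of a sequence of points. The value at the corner `(0, m)`, where the
secant may degenerate, is replaced. -/
def secantGrid (ξ : E3) (φ : E3 →ₗ[ℝ] ℂ) (q : ℕ → E3) (m i j : ℕ) : ℂ :=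
  -- The summands are the values at the two neighbours of the corner, so the sum lies in every
  -- half-plane that contains both.
  if i = 0 ∧ j = m then secant ξ φ (q 0) (q (m - 1)) + secant ξ φ (q 1) (q m)
  else secant ξ φ (q i) (q j)

theorem secantGrid_of_ne {q : ℕ → E3} {m i j : ℕ} (h : ¬(i = 0 ∧ j = m)) :
    secantGrid ξ φ q m i j = secant ξ φ (q i) (q j) := if_neg h

theorem secantGrid_corner {q : ℕ → E3} {m : ℕ} :
    secantGrid ξ φ q m 0 m = secant ξ φ (q 0) (q (m - 1)) + secant ξ φ (q 1) (q m) :=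
  if_pos ⟨rfl, rfl⟩

end Secant

/-! ### Turning of simple chains and polygons in a hemisphere. -/

section Turning

variable {ξ : E3} {φ : E3 →ₗ[ℝ] ℂ} {q : ℕ → E3} {M : ℕ}

/-- A simple polygonal chain in a hemisphere whose ends lie on the boundary circle turns by less
than `π` in total. -/
theorem abs_sum_turn_chord_lt (hφ : IsPlaneChart ξ φ) (hM : 1 ≤ M) (h0 : inner ℝ ξ (q 0) = 0)
    (hm : inner ℝ ξ (q (M + 1)) = 0) (hpos : ∀ k, 0 < k → k ≤ M → 0 < inner ℝ ξ (q k))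
    (htr : ∀ k, k < M → triple (q k) (q (k + 1)) (q (k + 2)) ≠ 0)
    (hd : ∀ i j, i + 1 < j → j ≤ M → ConesDisjoint (q i) (q (i + 1)) (q j) (q (j + 1))) :
    |∑ k ∈ Finset.Ico 0 M, turn (secant ξ φ (q k) (q (k + 1)))
      (secant ξ φ (q (k + 1)) (q (k + 2)))| < Real.pi := by
  have hnn : ∀ k, k ≤ M + 1 → 0 ≤ inner ℝ ξ (q k) := by
    intro k hk
    rcases Nat.eq_zero_or_pos k with rfl | h1
    · exact h0.ge
    · rcases Nat.lt_or_ge M k with h2 | h2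
      · rw [show k = M + 1 by omega, hm]
      · exact (hpos k h1 h2).le
  have hne : ∀ {i j : ℕ}, ¬(i = 0 ∧ j = M + 1) →
      secantGrid ξ φ q (M + 1) i j = secant ξ φ (q i) (q j) := fun h => secantGrid_of_ne h
  have hc : secantGrid ξ φ q (M + 1) 0 (M + 1)
      = secant ξ φ (q 0) (q M) + secant ξ φ (q 1) (q (M + 1)) := secantGrid_corner
  -- For `M = 1` the first and last edges are adjacent, so they are handled as consecutive segments
  -- instead of being separated.
  obtain ⟨z, z1, z2, z3⟩ : ∃ z, Toward z (secant ξ φ (q 0) (q M)) ∧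
      Toward z (secant ξ φ (q 1) (q (M + 1))) ∧ (1 < M → Toward z (secant ξ φ (q 1) (q M))) := by
    rcases hM.lt_or_eq with h | h
    · obtain ⟨z, z1, -, z3, z4⟩ := exists_toward_square hφ (hd 0 M (by omega) le_rfl)
        (hnn 0 (by omega)) (hnn 1 (by omega)) (hnn M (by omega)) (hnn (M + 1) le_rfl)
      exact ⟨z, z1 (Or.inr (hpos M hM le_rfl)), z4 (Or.inl (hpos 1 one_pos hM)),
        fun _ => z3 (Or.inl (hpos 1 one_pos hM))⟩
    · subst h
      obtain ⟨z, z1, z2⟩ := exists_toward_consecutive hφ (hpos 1 one_pos le_rfl) (htr 0 one_pos)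
      exact ⟨z, z1, z2, fun h => absurd h (lt_irrefl 1)⟩
  have hsq : ∀ i j, i + 1 < j → j ≤ M → SquareToward (secantGrid ξ φ q (M + 1)) i j := by
    intro i j hij hj
    by_cases hcor : i = 0 ∧ j = M
    · obtain ⟨rfl, rfl⟩ := hcor
      refine ⟨z, ?_, ?_, ?_, ?_⟩
      · rw [hne (by omega)]; exact z1
      · rw [hc]; exact z1.add z2
      · rw [hne (by omega)]; exact z3 (by omega)
      · rw [hne (by omega)]; exact z2
    · obtain ⟨z, w1, w2, w3, w4⟩ := exists_toward_square hφ (hd i j hij hj) (hnn i (by omega))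
        (hnn (i + 1) (by omega)) (hnn j (by omega)) (hnn (j + 1) (by omega))
      have hj0 := hpos j (by omega) hj
      have hi0 := hpos (i + 1) (by omega) (by omega)
      refine ⟨z, ?_, ?_, ?_, ?_⟩
      · rw [hne (by omega)]; exact w1 (Or.inr hj0)
      · rw [hne (by omega)]
        refine w2 ?_
        rcases Nat.eq_zero_or_pos i with rfl | h
        · exact Or.inr (hpos _ (by omega) (by omega))
        · exact Or.inl (hpos _ h (by omega))
      · rw [hne (by omega)]; exact w3 (Or.inr hj0)
      · rw [hne (by omega)]; exact w4 (Or.inl hi0)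
  have key := turn_triangle hsq (fun i hi => by
    obtain ⟨z', w1, w2⟩ := exists_toward_consecutive hφ (hpos (i + 1) (by omega) (by omega))
      (htr i hi)
    refine ⟨z', ?_, ?_, ?_⟩
    · rw [hne (by omega)]; exact w1
    · by_cases hcor : i = 0 ∧ i + 2 = M + 1
      · obtain ⟨rfl, h⟩ := hcor
        have : M = 1 := by omega
        subst this
        change Toward z' (secantGrid ξ φ q (1 + 1) 0 (1 + 1))
        rw [hc]; exact w1.add w2
      · rw [hne hcor]
        refine toward_secant_third (hpos (i + 1) (by omega) (by omega)) (hnn i (by omega))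
          (hnn (i + 2) (by omega)) ?_ w1 w2
        rcases Nat.eq_zero_or_pos i with rfl | h
        · exact Or.inr (hpos _ (by omega) (by omega))
        · exact Or.inl (hpos _ h (by omega))
    · rw [hne (by omega)]; exact w2)
  have hl : ∑ k ∈ Finset.Ico 0 M, turn (secantGrid ξ φ q (M + 1) k (k + 1))
      (secantGrid ξ φ q (M + 1) (k + 1) (k + 2)) = ∑ k ∈ Finset.Ico 0 M,
      turn (secant ξ φ (q k) (q (k + 1))) (secant ξ φ (q (k + 1)) (q (k + 2))) := by
    refine Finset.sum_congr rfl fun k _ => ?_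
    rw [hne (by omega), hne (by omega)]
  -- As `q 0` and `q (M + 1)` are at infinity, secants from the former are all parallel, and so are
  -- those to the latter. Along the legs of the triangle only the corner turns, and it does so
  -- inside a half-plane, hence by less than π.
  have s0 : ∀ j, secant ξ φ (q 0) (q j) = (inner ℝ ξ (q j) : ℂ) * -φ (q 0) := by
    intro j
    rw [secant, h0, zero_smul, zero_sub, map_neg, map_smul, Complex.real_smul, mul_neg]
  have s1 : ∀ i, secant ξ φ (q i) (q (M + 1)) = (inner ℝ ξ (q i) : ℂ) * φ (q (M + 1)) := by
    intro j
    rw [secant, hm, zero_smul, sub_zero, map_smul, Complex.real_smul]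
  rw [hl, Finset.sum_Ico_succ_top hM,
    Finset.sum_eq_sum_Ico_succ_bot (by omega : 0 < M) (fun i => turn (secantGrid ξ φ q (M + 1) i (M + 1))
      (secantGrid ξ φ q (M + 1) (i + 1) (M + 1)))] at key
  rw [Finset.sum_eq_zero (s := Finset.Ico 1 M), Finset.sum_eq_zero (s := Finset.Ico (0 + 1) M),
    hne (by omega), hc, hne (by omega), zero_add, add_zero, z1.turn_add (z1.add z2) z2] at key
  · rw [key]; exact z1.abs_turn_lt z2
  · intro i hi
    rw [Finset.mem_Ico] at hi
    rw [hne (by omega), hne (by omega), s1, s1,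
      turn_ofReal_mul_left (hpos i (by omega) (by omega)),
      turn_ofReal_mul_right (hpos (i + 1) (by omega) (by omega)), turn_self]
  · intro j hj
    rw [Finset.mem_Ico] at hj
    rw [hne (by omega), hne (by omega), s0, s0,
      turn_ofReal_mul_left (hpos j (by omega) (by omega)),
      turn_ofReal_mul_right (hpos (j + 1) (by omega) (by omega)), turn_self]

/-- A simple closed polygon `q 0, …, q M` in an open hemisphere, without aligned edges. -/
structure IsHemisphericPolygon (ξ : E3) (q : ℕ → E3) (M : ℕ) : Prop where
  two_le : 2 ≤ M
  closed : q (M + 1) = q 0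
  pos : ∀ k, k ≤ M + 1 → 0 < inner ℝ ξ (q k)
  triple_ne : ∀ k, k < M → triple (q k) (q (k + 1)) (q (k + 2)) ≠ 0
  triple_ne_zero : triple (q M) (q 0) (q 1) ≠ 0
  disjoint : ∀ i j, i + 1 < j → j ≤ M → ¬(i = 0 ∧ j = M) →
    ConesDisjoint (q i) (q (i + 1)) (q j) (q (j + 1))

/-- At the closing vertex the first and last edges are adjacent. The reversed path `q 1`, `q 0`, `q
M` replaces the separation. -/
theorem IsHemisphericPolygon.exists_toward_corner (h : IsHemisphericPolygon ξ q M)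
    (hφ : IsPlaneChart ξ φ) : ∃ z, Toward z (secant ξ φ (q 0) (q M)) ∧
      Toward z (secant ξ φ (q 1) (q (M + 1))) ∧ Toward z (secant ξ φ (q 1) (q M)) := by
  have h1 : triple (q 1) (q 0) (q M) ≠ 0 := by
    rw [triple_swap, neg_ne_zero, ← triple_rotate]; exact h.triple_ne_zero
  obtain ⟨z, z1, z2⟩ := exists_toward_consecutive hφ (h.pos 0 (by omega)) h1
  refine ⟨z, z2, by rw [h.closed]; exact z1, ?_⟩
  have h2 := h.two_le
  exact toward_secant_third (h.pos 0 (by omega)) (h.pos 1 (by omega)).le (h.pos M (by omega)).le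
    (Or.inl (h.pos 1 (by omega))) z1 z2

theorem IsHemisphericPolygon.squareToward (h : IsHemisphericPolygon ξ q M)
    (hφ : IsPlaneChart ξ φ) {i j : ℕ} (hij : i + 1 < j) (hj : j ≤ M) :
    SquareToward (secantGrid ξ φ q (M + 1)) i j := by
  have hne : ∀ {i j : ℕ}, ¬(i = 0 ∧ j = M + 1) →
      secantGrid ξ φ q (M + 1) i j = secant ξ φ (q i) (q j) := fun h => secantGrid_of_ne h
  have hc : secantGrid ξ φ q (M + 1) 0 (M + 1)
      = secant ξ φ (q 0) (q M) + secant ξ φ (q 1) (q (M + 1)) := secantGrid_corner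
  by_cases hcor : i = 0 ∧ j = M
  · obtain ⟨rfl, rfl⟩ := hcor
    obtain ⟨z, z1, z2, z3⟩ := h.exists_toward_corner hφ
    refine ⟨z, ?_, ?_, ?_, ?_⟩
    · rw [hne (by omega)]; exact z1
    · rw [hc]; exact z1.add z2
    · rw [hne (by omega)]; exact z3
    · rw [hne (by omega)]; exact z2
  · have p1 := h.pos i (by omega)
    have p2 := h.pos (i + 1) (by omega)
    obtain ⟨z, w1, w2, w3, w4⟩ := exists_toward_square hφ (h.disjoint i j hij hj hcor) p1.le p2.le
      (h.pos j (by omega)).le (h.pos (j + 1) (by omega)).le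
    refine ⟨z, ?_, ?_, ?_, ?_⟩
    · rw [hne (by omega)]; exact w1 (Or.inl p1)
    · rw [hne (by omega)]; exact w2 (Or.inl p1)
    · rw [hne (by omega)]; exact w3 (Or.inl p2)
    · rw [hne (by omega)]; exact w4 (Or.inl p2)

/-- A supporting plane at `v` puts all secants from `v` into one half-plane, so sums of turns
between them telescope. -/
theorem toward_secant_of_support_left (hφ : IsPlaneChart ξ φ) {g v w : E3}
    (hv : 0 < inner ℝ ξ v) (gv : inner ℝ g v = 0) (gw : 0 < inner ℝ g w) :
    Toward (φ g) (secant ξ φ v w) :=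
  hφ.toward_secant (by rw [gv, mul_zero, sub_zero]; exact mul_pos hv gw)

theorem toward_secant_of_support_right (hφ : IsPlaneChart ξ φ) {g v w : E3}
    (hw : 0 < inner ℝ ξ w) (gw : inner ℝ g w = 0) (gv : 0 < inner ℝ g v) :
    Toward (φ (-g)) (secant ξ φ v w) :=
  hφ.toward_secant (by
    rw [inner_neg_left, inner_neg_left, gw, neg_zero, mul_zero, zero_sub, mul_neg, neg_neg]
    exact mul_pos hw gv)

/-- The theorem of turning tangents: the orientation can be read off at any extreme vertex. -/
theorem IsHemisphericPolygon.sum_turn (h : IsHemisphericPolygon ξ q M) (hξ : ξ ∈ unitSphere)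
    (hφ : IsPlaneChart ξ φ) {g : E3} (g0 : inner ℝ g (q 0) = 0)
    (g1 : ∀ k, 0 < k → k ≤ M → 0 < inner ℝ g (q k)) :
    ∑ k ∈ Finset.Ico 0 M, turn (secant ξ φ (q k) (q (k + 1)))
      (secant ξ φ (q (k + 1)) (q (k + 2))) + turn (secant ξ φ (q M) (q 0))
      (secant ξ φ (q 0) (q 1))
      = if 0 < triple (q M) (q 0) (q 1) then 2 * Real.pi else -(2 * Real.pi) := by
  have hM := h.two_le
  have hne : ∀ {i j : ℕ}, ¬(i = 0 ∧ j = M + 1) →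
      secantGrid ξ φ q (M + 1) i j = secant ξ φ (q i) (q j) := fun h => secantGrid_of_ne h
  have hc : secantGrid ξ φ q (M + 1) 0 (M + 1)
      = secant ξ φ (q 0) (q M) + secant ξ φ (q 1) (q (M + 1)) := secantGrid_corner
  have key := turn_triangle (fun i j hij hj => h.squareToward hφ hij hj) (fun i hi => by
    obtain ⟨z', w1, w2⟩ := exists_toward_consecutive hφ (h.pos (i + 1) (by omega))
      (h.triple_ne i hi)
    refine ⟨z', ?_, ?_, ?_⟩
    · rw [hne (by omega)]; exact w1
    · rw [hne (by omega)]
      exact toward_secant_third (h.pos (i + 1) (by omega)) (h.pos i (by omega)).le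
        (h.pos (i + 2) (by omega)).le (Or.inl (h.pos i (by omega))) w1 w2
    · rw [hne (by omega)]; exact w2)
  have hl : ∑ k ∈ Finset.Ico 0 M, turn (secantGrid ξ φ q (M + 1) k (k + 1))
      (secantGrid ξ φ q (M + 1) (k + 1) (k + 2)) = ∑ k ∈ Finset.Ico 0 M,
      turn (secant ξ φ (q k) (q (k + 1))) (secant ξ φ (q (k + 1)) (q (k + 2))) := by
    refine Finset.sum_congr rfl fun k _ => ?_
    rw [hne (by omega), hne (by omega)]
  have r1 : ∑ j ∈ Finset.Ico 1 M, turn (secantGrid ξ φ q (M + 1) 0 j)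
      (secantGrid ξ φ q (M + 1) 0 (j + 1))
      = turn (secant ξ φ (q 0) (q 1)) (secant ξ φ (q 0) (q M)) := by
    rw [← Toward.sum_turn (z := φ g) (fun j => secant ξ φ (q 0) (q j)) 1 M (by omega)
      (fun k k1 k2 => toward_secant_of_support_left hφ (h.pos 0 (by omega)) g0 (g1 k k1 k2))]
    refine Finset.sum_congr rfl fun k hk => ?_
    rw [Finset.mem_Ico] at hk
    rw [hne (by omega), hne (by omega)]
  have r2 : ∑ i ∈ Finset.Ico (0 + 1) M, turn (secantGrid ξ φ q (M + 1) i (M + 1))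
      (secantGrid ξ φ q (M + 1) (i + 1) (M + 1))
      = turn (secant ξ φ (q 0) (q 1)) (secant ξ φ (q 0) (q M)) := by
    rw [← turn_neg_neg, ← secant_swap, ← secant_swap,
      ← Toward.sum_turn (z := φ (-g)) (fun j => secant ξ φ (q j) (q 0)) 1 M (by omega)
      (fun k k1 k2 => toward_secant_of_support_right hφ (h.pos 0 (by omega)) g0 (g1 k k1 k2))]
    refine Finset.sum_congr rfl fun k hk => ?_
    rw [Finset.mem_Ico] at hk
    rw [hne (by omega), hne (by omega), h.closed]
  obtain ⟨z, z1, z2, -⟩ := h.exists_toward_corner hφ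
  rw [hl, Finset.sum_Ico_succ_top (by omega),
    Finset.sum_eq_sum_Ico_succ_bot (by omega : 0 < M) (fun i => turn (secantGrid ξ φ q (M + 1) i (M + 1))
      (secantGrid ξ φ q (M + 1) (i + 1) (M + 1))),
    r1, r2, hc, hne (by omega), hne (by omega)] at key
  have hmid := z1.turn_add (z1.add z2) z2
  have hlast : turn (secant ξ φ (q M) (q 0)) (secant ξ φ (q 0) (q 1))
      = turn (secant ξ φ (q 0) (q M)) (-secant ξ φ (q 0) (q 1)) := by
    rw [secant_swap (q 0) (q M), ← turn_neg_neg, neg_neg]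
  have hq1 : secant ξ φ (q (0 + 1)) (q (M + 1)) = -secant ξ φ (q 0) (q 1) := by
    rw [h.closed, secant_swap]
  rw [hq1] at key
  rw [show (1 : ℕ) = 0 + 1 from rfl, hq1] at hmid
  -- With `u`, `v` the directions from `q 0` to `q 1` and `q M`, the total is `2 * (turn u v + turn
  -- v (-u))`. The sign found here makes each bracket a half turn to the left or right.
  have him : (conj (secant ξ φ (q 0) (q 1)) * secant ξ φ (q 0) (q M)).im
      = inner ℝ ξ (q 0) * triple (q M) (q 0) (q 1) := by
    rw [hφ.im_secant hξ, triple_rotate (q M)]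
  have hp0 := h.pos 0 (by omega)
  split_ifs with hs
  · have := turn_neg_of_pos (by rw [him]; exact mul_pos hp0 hs)
    rw [hlast]
    linarith
  · have hs' : triple (q M) (q 0) (q 1) < 0 :=
      lt_of_le_of_ne (not_lt.1 hs) h.triple_ne_zero
    have := turn_neg_of_neg (by rw [him]; exact mul_neg_of_pos_of_neg hp0 hs')
    rw [hlast]
    linarith

/-- A counterclockwise polygon visits no extreme vertex between the ends of an edge of its hull. -/
theorem IsHemisphericPolygon.no_extreme_between (h : IsHemisphericPolygon ξ q M)
    (hξ : ξ ∈ unitSphere) (hpos : 0 < triple (q M) (q 0) (q 1)) {b c : ℕ} (hc0 : 0 < c)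
    (hcb : c < b) (hbM : b ≤ M)
    (hab : ∀ k, 0 < k → k ≤ M → k ≠ b → 0 < triple (q 0) (q b) (q k))
    {g₀ g₁ g₂ : E3} (h₀ : inner ℝ g₀ (q 0) = 0) (h₀' : ∀ k, 0 < k → k ≤ M → 0 < inner ℝ g₀ (q k))
    (h₁ : inner ℝ g₁ (q b) = 0) (h₁' : ∀ k, k ≤ M → k ≠ b → 0 < inner ℝ g₁ (q k))
    (h₂ : inner ℝ g₂ (q c) = 0) (h₂' : ∀ k, k ≤ M → k ≠ c → 0 < inner ℝ g₂ (q k)) : False := by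
  obtain ⟨φ, hφ⟩ := exists_isPlaneChart hξ
  have hM := h.two_le
  have hne : ∀ {i j : ℕ}, ¬(i = 0 ∧ j = M + 1) →
      secantGrid ξ φ q (M + 1) i j = secant ξ φ (q i) (q j) := fun h => secantGrid_of_ne h
  have hc : secantGrid ξ φ q (M + 1) 0 (M + 1)
      = secant ξ φ (q 0) (q M) + secant ξ φ (q 1) (q (M + 1)) := secantGrid_corner
  -- The rectangle of secants from `q 0, …, q c` to `q b, …, q (M + 1)`. Its sides telescope thanks
  -- to the supports at `q 0`, `q b` and `q c`.
  have key := turn_rectangle (U := secantGrid ξ φ q (M + 1)) (a := 0) (b := c) (c := b)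
    (d := M + 1) (by omega) (by omega)
    (fun i j _ hi hj hj' => h.squareToward hφ (by omega) (by omega))
  have t0 : ∀ k, 0 < k → k ≤ M → Toward (φ g₀) (secant ξ φ (q 0) (q k)) := fun k k1 k2 =>
    toward_secant_of_support_left hφ (h.pos 0 (by omega)) h₀ (h₀' k k1 k2)
  have r1 : ∑ j ∈ Finset.Ico b M, turn (secantGrid ξ φ q (M + 1) 0 j)
      (secantGrid ξ φ q (M + 1) 0 (j + 1))
      = turn (secant ξ φ (q 0) (q b)) (secant ξ φ (q 0) (q M)) := by
    rw [← Toward.sum_turn (z := φ g₀) (fun j => secant ξ φ (q 0) (q j)) b M (by omega)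
      (fun k k1 k2 => t0 k (by omega) k2)]
    refine Finset.sum_congr rfl fun k hk => ?_
    rw [Finset.mem_Ico] at hk
    rw [hne (by omega), hne (by omega)]
  have r2 : ∑ i ∈ Finset.Ico (0 + 1) c, turn (secantGrid ξ φ q (M + 1) i (M + 1))
      (secantGrid ξ φ q (M + 1) (i + 1) (M + 1))
      = turn (secant ξ φ (q 0) (q 1)) (secant ξ φ (q 0) (q c)) := by
    rw [← turn_neg_neg, ← secant_swap, ← secant_swap,
      ← Toward.sum_turn (z := φ (-g₀)) (fun j => secant ξ φ (q j) (q 0)) 1 c (by omega)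
      (fun k k1 k2 => toward_secant_of_support_right hφ (h.pos 0 (by omega)) h₀
        (h₀' k k1 (by omega)))]
    refine Finset.sum_congr rfl fun k hk => ?_
    rw [Finset.mem_Ico] at hk
    rw [hne (by omega), hne (by omega), h.closed]
  have r3 : ∑ i ∈ Finset.Ico 0 c, turn (secantGrid ξ φ q (M + 1) i b)
      (secantGrid ξ φ q (M + 1) (i + 1) b)
      = turn (secant ξ φ (q 0) (q b)) (secant ξ φ (q c) (q b)) := by
    rw [← Toward.sum_turn (z := φ (-g₁)) (fun j => secant ξ φ (q j) (q b)) 0 c (by omega)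
      (fun k k1 k2 => toward_secant_of_support_right hφ (h.pos b (by omega)) h₁
        (h₁' k (by omega) (by omega)))]
    refine Finset.sum_congr rfl fun k hk => ?_
    rw [Finset.mem_Ico] at hk
    rw [hne (by omega), hne (by omega)]
  have r4 : ∑ j ∈ Finset.Ico b (M + 1), turn (secantGrid ξ φ q (M + 1) c j)
      (secantGrid ξ φ q (M + 1) c (j + 1))
      = turn (secant ξ φ (q c) (q b)) (secant ξ φ (q c) (q (M + 1))) := by
    rw [← Toward.sum_turn (z := φ g₂) (fun j => secant ξ φ (q c) (q j)) b (M + 1) (by omega)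
      (fun k k1 k2 => toward_secant_of_support_left hφ (h.pos c (by omega)) h₂ (by
        rcases Nat.lt_or_ge M k with h3 | h3
        · rw [show k = M + 1 by omega, h.closed]; exact h₂' 0 (by omega) (by omega)
        · exact h₂' k h3 (by omega)))]
    refine Finset.sum_congr rfl fun k hk => ?_
    rw [Finset.mem_Ico] at hk
    rw [hne (by omega), hne (by omega)]
  obtain ⟨z, z1, z2, -⟩ := h.exists_toward_corner hφ
  rw [Finset.sum_Ico_succ_top (by omega), Finset.sum_eq_sum_Ico_succ_bot hc0,
    r1, r2, r3, r4, hc, hne (by omega), hne (by omega)] at key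
  have hmid := z1.turn_add (z1.add z2) z2
  have hq1 : secant ξ φ (q (0 + 1)) (q (M + 1)) = -secant ξ φ (q 0) (q 1) := by
    rw [h.closed, secant_swap]
  rw [hq1] at key
  rw [show (1 : ℕ) = 0 + 1 from rfl, hq1] at hmid
  have hp0 := h.pos 0 (by omega)
  -- The side of `key` through the corner `(0, M + 1)` equals π plus the positive angle of `e6`. The
  -- other side is below π, being the sum of the negative angle of `e7` and an angle of at most π.
  have e1 := turn_neg_of_pos (u := secant ξ φ (q 0) (q (0 + 1))) (v := secant ξ φ (q 0) (q M)) (by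
    rw [hφ.im_secant hξ, ← triple_rotate (q M)]; exact mul_pos hp0 hpos)
  have e2 := (t0 b (by omega) hbM).turn_eq (t0 M (by omega) le_rfl)
  have e3 := (t0 (0 + 1) (by omega) (by omega)).turn_eq (t0 M (by omega) le_rfl)
  have e4 := (t0 (0 + 1) (by omega) (by omega)).turn_eq (t0 c hc0 (by omega))
  have e5 := (t0 b (by omega) hbM).turn_eq (t0 c hc0 (by omega))
  have hq := hab c hc0 (by omega) (by omega)
  have e6 : 0 < turn (secant ξ φ (q 0) (q b)) (secant ξ φ (q 0) (q c)) :=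
    arg_pos_of_im_pos (by rw [hφ.im_secant hξ]; exact mul_pos hp0 hq)
  have e7 : turn (secant ξ φ (q 0) (q b)) (secant ξ φ (q c) (q b)) < 0 := by
    rw [secant_swap (q b) (q 0), secant_swap (q b) (q c), turn_neg_neg]
    refine Complex.arg_neg_iff.2 ?_
    rw [hφ.im_secant hξ, triple_swap]
    have := mul_pos (h.pos b (by omega)) hq
    linarith
  have e8 := turn_le_pi (secant ξ φ (q c) (q b)) (secant ξ φ (q c) (q (M + 1)))
  linarith

end Turning

/-! ### Cyclic indices. -/

section Cyclic

variable {n : ℕ} [NeZero n]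

/-- The index that comes `k` steps after `i`, cyclically. -/
def step (i : Fin n) (k : ℕ) : Fin n := i + Fin.ofNat n k

theorem step_zero (i : Fin n) : step i 0 = i := by
  simp [step]

theorem step_succ (i : Fin n) (k : ℕ) : step i (k + 1) = step i k + 1 := by
  rw [step, step, add_assoc]
  congr 1
  apply Fin.ext
  simp [Fin.val_add, Fin.ofNat]

theorem step_eq_iff (i : Fin n) (k l : ℕ) : step i k = step i l ↔ k % n = l % n := by
  rw [step, step, add_right_inj, Fin.ext_iff]
  simp [Fin.ofNat]

theorem step_self (i : Fin n) : step i n = i := by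
  have := (step_eq_iff i n 0).2 (by simp)
  rw [this, step_zero]

theorem step_add_period (i : Fin n) (k : ℕ) : step i (n + k) = step i k :=
  (step_eq_iff i _ _).2 (by simp)

theorem step_injOn (i : Fin n) {k l : ℕ} (hk : k < n) (hl : l < n) (h : step i k = step i l) :
    k = l := by
  have := (step_eq_iff i k l).1 h
  rwa [Nat.mod_eq_of_lt hk, Nat.mod_eq_of_lt hl] at this

theorem step_sub_val (i j : Fin n) : step i (j - i).val = j := by
  rw [step]
  have : Fin.ofNat n (j - i).val = j - i := by
    apply Fin.ext; simp [Fin.ofNat, Nat.mod_eq_of_lt (j - i).isLt]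
  rw [this, add_sub_cancel]

theorem sum_eq_sum_step {A : Type*} [AddCommMonoid A] (f : Fin n → A) (i : Fin n) :
    ∑ j, f j = ∑ k ∈ Finset.Ico 0 n, f (step i k) := by
  rw [← Equiv.sum_comp (Equiv.addLeft i) f, ← Finset.range_eq_Ico,
    ← Fin.sum_univ_eq_sum_range (fun k => f (step i k))]
  refine Finset.sum_congr rfl fun k _ => ?_
  rw [step]
  congr 2
  apply Fin.ext; simp [Fin.ofNat, Nat.mod_eq_of_lt k.isLt]

end Cyclic

/-! ### The index of a polygon in an open hemisphere. -/

section Polygon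

variable {n : ℕ} [NeZero n] {W : Fin n → E3} {ξ : E3}

/-- The secant vector of an edge is `(u × v) × ξ`: the projected normal of the edge, rotated by a
right angle about `ξ` and rescaled. Thus `W` turns in projection exactly as its polar polygon moves
in longitude. -/
theorem turn_secant_secant {φ : E3 →ₗ[ℝ] ℂ} (hφ : IsPlaneChart ξ φ) (hξ : ξ ∈ unitSphere)
    (hW : IsRegularPolygon W) (i : Fin n) :
    turn (secant ξ φ (W i) (W (i + 1))) (secant ξ φ (W (i + 1)) (W (i + 1 + 1)))
      = longitudeStep ξ (polar W i) (polar W (i + 1)) := by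
  have hr := inv_pos.2 (norm_pos_iff.2 (hW.cross_ne i))
  have hs := inv_pos.2 (norm_pos_iff.2 (hW.cross_ne (i + 1)))
  rw [turn, secant, secant, hφ, longitudeStep, ← Complex.arg_real_mul _ (mul_pos hr hs)]
  congr 1
  have h1 : ∀ u v : E3, inner ℝ ξ u • v - inner ℝ ξ v • u = cross (cross u v) ξ := by
    intro u v
    apply E3.ext <;> simp [inner_eq_sum] <;> ring
  have h2 : ∀ a b : E3, inner ℝ (cross a ξ) (cross b ξ)
      = inner ℝ a b * inner ℝ ξ ξ - inner ℝ ξ a * inner ℝ ξ b := by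
    intro a b; rw [inner_cross_cross, real_inner_comm ξ a]
  have h3 : ∀ a : E3, inner ℝ ξ (cross a ξ) = 0 := by
    intro a; rw [real_inner_comm, inner_cross_right]
  have h4 : ∀ a b : E3, triple (cross a ξ) (cross b ξ) ξ = triple a b ξ * inner ℝ ξ ξ := by
    intro a b
    simp only [triple_eq_sum, inner_eq_sum, cross_apply_zero, cross_apply_one, cross_apply_two]
    ring
  rw [h1, h1, h2, h3, h4, mem_unitSphere.1 hξ]
  apply Complex.ext
  · simp only [polar, Complex.re_ofReal_mul, inner_smul_left, inner_smul_right, conj_trivial]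
    ring
  · simp only [polar, Complex.im_ofReal_mul, triple_smul_left, triple_smul_middle]
    ring

/-- The cone over a part of an edge of `W`, reflected by a sign. -/
def InSector (σ : ℝ) (u v a : E3) : Prop :=
  ∃ r s : ℝ, 0 ≤ r ∧ 0 ≤ s ∧ a = σ • (r • u + s • v)

theorem InSector.add {σ : ℝ} {u v a b : E3} (ha : InSector σ u v a) (hb : InSector σ u v b)
    {r s : ℝ} (hr : 0 ≤ r) (hs : 0 ≤ s) : InSector σ u v (r • a + s • b) := by
  obtain ⟨r1, s1, h1, h2, rfl⟩ := ha
  obtain ⟨r2, s2, h3, h4, rfl⟩ := hb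
  exact ⟨r * r1 + s * r2, r * s1 + s * s2, by positivity, by positivity, by module⟩

theorem InSector.mem_arc {σ : ℝ} (hσ : σ * σ = 1) {u v a : E3} (ha : InSector σ u v a)
    (h : a ≠ 0) : (‖a‖⁻¹ * σ) • a ∈ arc u v := by
  have ha0 := inv_pos.2 (norm_pos_iff.2 h)
  obtain ⟨r, s, hr, hs, he⟩ := ha
  have hn : |σ| = 1 := by
    have := abs_mul_abs_self σ
    rw [hσ] at this
    nlinarith [abs_nonneg σ]
  refine ⟨?_, ‖a‖⁻¹ * r, ‖a‖⁻¹ * s, by positivity, by positivity, ?_⟩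
  · rw [unitSphere, mem_sphere_zero_iff_norm, norm_smul, norm_mul, norm_inv, norm_norm,
      Real.norm_eq_abs, hn, mul_one, inv_mul_cancel₀ (norm_ne_zero_iff.2 h)]
  · have : σ • a = r • u + s • v := by rw [he, smul_smul, hσ, one_smul]
    rw [mul_smul, this, smul_add, smul_smul, smul_smul]

/-- A common vector of the two cones, normalized and reflected by `σ`, lies on both edges, hence is
a shared vertex. By `h1` and `h2` that vertex is on the wrong side of the plane orthogonal to `ξ`.
-/
theorem conesDisjoint_of_simple (hW : IsSimplePolygon W) {σ : ℝ} (hσ : σ * σ = 1) {i j : Fin n}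
    (hij : i ≠ j) (h1 : j = i + 1 → σ * inner ℝ ξ (W j) < 0)
    (h2 : i = j + 1 → σ * inner ℝ ξ (W i) < 0) {a b c d : E3}
    (ha : InSector σ (W i) (W (i + 1)) a) (hb : InSector σ (W i) (W (i + 1)) b)
    (hc : InSector σ (W j) (W (j + 1)) c) (hd : InSector σ (W j) (W (j + 1)) d)
    (xa : 0 ≤ inner ℝ ξ a) (xb : 0 ≤ inner ℝ ξ b) (xc : 0 ≤ inner ℝ ξ c) (xd : 0 ≤ inner ℝ ξ d)
    (na : a ≠ 0) (nb : b ≠ 0) (nc : c ≠ 0) (nd : d ≠ 0)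
    (hab : 0 < inner ℝ ξ a ∨ 0 < inner ℝ ξ b) (hcd : 0 < inner ℝ ξ c ∨ 0 < inner ℝ ξ d) :
    ConesDisjoint a b c d := by
  have pointed : ∀ a b : E3, 0 ≤ inner ℝ ξ a → 0 ≤ inner ℝ ξ b → a ≠ 0 → b ≠ 0 →
      (0 < inner ℝ ξ a ∨ 0 < inner ℝ ξ b) → ∀ r s : ℝ, 0 ≤ r → 0 ≤ s → r • a + s • b = 0 →
      r = 0 ∧ s = 0 := by
    intro a b xa xb na nb hab r s hr hs h
    have hx : r * inner ℝ ξ a + s * inner ℝ ξ b = 0 := by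
      rw [← inner_smul_right, ← inner_smul_right, ← inner_add_right, h, inner_zero_right]
    have e1 := mul_nonneg hr xa
    have e2 := mul_nonneg hs xb
    rcases hab with h3 | h3
    · have : r = 0 := (mul_eq_zero.1 (by linarith : r * inner ℝ ξ a = 0)).resolve_right h3.ne'
      subst this
      rw [zero_smul, zero_add] at h
      exact ⟨rfl, (smul_eq_zero.1 h).resolve_right nb⟩
    · have : s = 0 := (mul_eq_zero.1 (by linarith : s * inner ℝ ξ b = 0)).resolve_right h3.ne'
      subst this
      rw [zero_smul, add_zero] at h
      exact ⟨(smul_eq_zero.1 h).resolve_right na, rfl⟩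
  intro r s t u hr hs ht hu he
  by_cases hy : r • a + s • b = 0
  · have e1 := pointed a b xa xb na nb hab r s hr hs hy
    have e2 := pointed c d xc xd nc nd hcd t u ht hu (he ▸ hy)
    exact ⟨e1.1, e1.2, e2.1, e2.2⟩
  · exfalso
    have m1 := (ha.add hb hr hs).mem_arc hσ hy
    have m2 := (hc.add hd ht hu).mem_arc hσ (he ▸ hy)
    rw [← he] at m2
    have hx : 0 ≤ inner ℝ ξ (r • a + s • b) := by
      rw [inner_add_right, inner_smul_right, inner_smul_right]; positivity
    have key : ∀ w : E3, (‖r • a + s • b‖⁻¹ * σ) • (r • a + s • b) = w →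
        0 ≤ σ * inner ℝ ξ w := by
      intro w hw
      rw [← hw, inner_smul_right]
      have : σ * (‖r • a + s • b‖⁻¹ * σ * inner ℝ ξ (r • a + s • b))
          = (σ * σ) * (‖r • a + s • b‖⁻¹ * inner ℝ ξ (r • a + s • b)) := by ring
      rw [this, hσ, one_mul]; positivity
    rcases hW.edges_disjoint i j hij _ m1 m2 with h | h
    · exact absurd (key _ h.2) (not_le.2 (h1 h.1))
    · exact absurd (key _ h.2) (not_le.2 (h2 h.1))

theorem fin_ne_add_one (h : 3 ≤ n) (i : Fin n) : i ≠ i + 1 := by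
  intro h1
  have : (1 : Fin n) = 0 := by simpa using h1
  rw [Fin.one_eq_zero_iff] at this; omega

theorem isHemisphericPolygon_of_simple {M : ℕ} {W : Fin (M + 1) → E3} (hW : IsSimplePolygon W)
    {σ : ℝ} (hσ : σ * σ = 1) (hx : ∀ i, 0 < σ * inner ℝ ξ (W i))
    (ht : ∀ i, triple (W i) (W (i + 1)) (W (i + 1 + 1)) ≠ 0) (i₀ : Fin (M + 1)) :
    IsHemisphericPolygon ξ (fun k => σ • W (step i₀ k)) M := by
  have h3 := hW.three_le
  have hσ0 : σ ≠ 0 := by rintro rfl; simp at hσ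
  have hx' : ∀ i, 0 < inner ℝ ξ (σ • W i) := fun i => by rw [inner_smul_right]; exact hx i
  have hne : ∀ i, σ • W i ≠ 0 := fun i h => by
    have := hx' i; rw [h, inner_zero_right] at this; exact lt_irrefl _ this
  refine ⟨by omega, by simp only [step_self, step_zero], fun k _ => hx' _, fun k _ => ?_, ?_,
    fun i j hij hj hcor => ?_⟩
  · simp only [step_succ, triple_smul_left, triple_smul_middle, triple_smul_right]
    exact mul_ne_zero hσ0 (mul_ne_zero hσ0 (mul_ne_zero hσ0 (ht _)))
  · have e : i₀ = step i₀ M + 1 := by rw [← step_succ, step_self]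
    have := ht (step i₀ M)
    simp only [triple_smul_left, triple_smul_middle, triple_smul_right, step_zero, step_succ _ 0]
    rw [← e] at this
    exact mul_ne_zero hσ0 (mul_ne_zero hσ0 (mul_ne_zero hσ0 this))
  · have hs : ∀ k, InSector σ (W (step i₀ k)) (W (step i₀ k + 1)) (σ • W (step i₀ k)) := fun k =>
      ⟨1, 0, zero_le_one, le_rfl, by simp⟩
    have hs' : ∀ k, InSector σ (W (step i₀ k)) (W (step i₀ k + 1)) (σ • W (step i₀ (k + 1))) :=
      fun k => ⟨0, 1, le_rfl, zero_le_one, by simp [step_succ]⟩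
    refine conesDisjoint_of_simple hW hσ ?_ ?_ ?_ (hs i) (hs' i) (hs j) (hs' j) (hx' _).le
      (hx' _).le (hx' _).le (hx' _).le (hne _) (hne _) (hne _) (hne _) (Or.inl (hx' _))
      (Or.inl (hx' _))
    · intro h
      have := step_injOn i₀ (by omega) (by omega) h
      omega
    · intro h
      rw [← step_succ] at h
      have := step_injOn i₀ (by omega) (by omega) h
      omega
    · intro h
      rw [← step_succ] at h
      rcases Nat.lt_or_ge j M with h4 | h4
      · have := step_injOn i₀ (by omega) (by omega) h
        omega
      · have h5 : j = M := by omega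
        rw [h5, step_self] at h
        have := step_injOn i₀ (k := i) (l := 0) (by omega) (by omega) (by rw [h, step_zero])
        omega

theorem secant_smul_smul_self {φ : E3 →ₗ[ℝ] ℂ} {σ : ℝ} (hσ : σ * σ = 1) (v w : E3) :
    secant ξ φ (σ • v) (σ • w) = secant ξ φ v w := by
  rw [secant_smul_smul, hσ]; simp

/-- The index of a polygon in an open hemisphere is determined by the turn at an extreme vertex. -/
theorem polarIndex_of_hemisphere (hW : IsSimplePolygon W) (hξ : ξ ∈ unitSphere)
    {σ : ℝ} (hσ : σ * σ = 1) (hx : ∀ i, 0 < σ * inner ℝ ξ (W i))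
    (ht : ∀ i, triple (W i) (W (i + 1)) (W (i + 1 + 1)) ≠ 0) (i₀ : Fin n) {g : E3}
    (g0 : inner ℝ g (W i₀) = 0) (g1 : ∀ j, j ≠ i₀ → 0 < inner ℝ g (W j)) :
    polarIndex W ξ = if 0 < σ * triple (W (i₀ - 1)) (W i₀) (W (i₀ + 1)) then 1 else 0 := by
  have hpi := Real.pi_pos
  have hr := hW.isRegularPolygon
  obtain ⟨M, rfl⟩ : ∃ M, n = M + 1 := ⟨n - 1, by have := hW.three_le; omega⟩
  obtain ⟨φ, hφ⟩ := exists_isPlaneChart hξ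
  have hH := isHemisphericPolygon_of_simple hW hσ hx ht i₀
  have hx0 : ∀ i, inner ℝ ξ (W i) ≠ 0 := fun i h => by
    have := hx i; rw [h, mul_zero] at this; exact lt_irrefl _ this
  have hF := four_pi_mul_polarIndex hr hξ hx0
  -- There are no crossings, so 4π times the index is 2π plus the total turn ±2π.
  have hj : ∑ i, (if inner ℝ ξ (W i) < 0 ∧ 0 < inner ℝ ξ (W (i + 1)) then 2 * Real.pi else 0)
      = 0 := by
    refine Finset.sum_eq_zero fun i _ => if_neg ?_
    rintro ⟨h1, h2⟩
    have := hx i; have := hx (i + 1)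
    rcases le_or_gt 0 σ with h | h <;> nlinarith
  have hs := hH.sum_turn hξ hφ (g := σ • g) (by
    rw [inner_smul_left, inner_smul_right, step_zero, g0]; simp) (by
    intro k k1 k2
    rw [inner_smul_left, inner_smul_right, conj_trivial, ← mul_assoc, hσ, one_mul]
    refine g1 _ fun h => ?_
    have := step_injOn i₀ (k := k) (l := 0) (by omega) (by omega) (by rw [h, step_zero])
    omega)
  have e : step i₀ M = i₀ - 1 := by
    rw [eq_sub_iff_add_eq, ← step_succ, step_self]
  simp only [secant_smul_smul_self hσ, triple_smul_left, triple_smul_middle,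
    triple_smul_right] at hs
  rw [show σ * (σ * (σ * triple (W (step i₀ M)) (W (step i₀ 0)) (W (step i₀ 1))))
    = (σ * σ) * (σ * triple (W (step i₀ M)) (W (step i₀ 0)) (W (step i₀ 1))) by ring, hσ, one_mul,
    e, step_zero, step_succ i₀ 0, step_zero] at hs
  have hsum : ∑ i, longitudeStep ξ (polar W i) (polar W (i + 1))
      = if 0 < σ * triple (W (i₀ - 1)) (W i₀) (W (i₀ + 1)) then 2 * Real.pi
        else -(2 * Real.pi) := by
    rw [← hs, sum_eq_sum_step _ i₀, Finset.sum_Ico_succ_top (Nat.zero_le M)]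
    congr 1
    · refine Finset.sum_congr rfl fun k _ => ?_
      rw [step_succ i₀ (k + 1), step_succ i₀ k, turn_secant_secant hφ hξ hr]
    · rw [← turn_secant_secant hφ hξ hr, e, sub_add_cancel]
  rw [hj, hsum] at hF
  have : 4 * Real.pi ≠ 0 := by positivity
  split_ifs at hF ⊢
  · refine mul_left_cancel₀ this ?_; linarith
  · refine mul_left_cancel₀ this ?_; linarith

end Polygon

/-! ### Polygons that cross the circle orthogonal to the axis. -/

section SignChanges

variable {n : ℕ} [NeZero n] {W : Fin n → E3} {ξ : E3}

theorem secant_start {φ : E3 →ₗ[ℝ] ℂ} {σ : ℝ} (hσ : σ * σ = 1) (r s : ℝ) (v w : E3) :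
    secant ξ φ (σ • (r • v + s • w)) (σ • w) = (r : ℂ) * secant ξ φ v w := by
  rw [secant_smul_smul_self hσ, secant, secant, ← Complex.real_smul, ← map_smul]
  congr 1
  simp only [inner_add_right, inner_smul_right]
  module

theorem secant_end {φ : E3 →ₗ[ℝ] ℂ} {σ : ℝ} (hσ : σ * σ = 1) (r s : ℝ) (v w : E3) :
    secant ξ φ (σ • v) (σ • (r • v + s • w)) = (s : ℂ) * secant ξ φ v w := by
  rw [secant_smul_smul_self hσ, secant, secant, ← Complex.real_smul, ← map_smul]
  congr 1
  simp only [inner_add_right, inner_smul_right]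
  module

theorem triple_combination (σ a b c d : ℝ) (u v w : E3) :
    triple (σ • (a • u + b • v)) (σ • v) (σ • (c • v + d • w))
      = σ * σ * σ * (a * d * triple u v w) := by
  simp [triple_eq_sum]; ring

/-- The total turn of the chain between two consecutive crossings of the circle orthogonal
to `ξ`. -/
theorem abs_sum_turn_run_lt (hW : IsSimplePolygon W) {φ : E3 →ₗ[ℝ] ℂ} (hφ : IsPlaneChart ξ φ)
    (ht : ∀ i, triple (W i) (W (i + 1)) (W (i + 1 + 1)) ≠ 0) (i₀ : Fin n) {σ : ℝ}
    (hσ : σ * σ = 1) {e M : ℕ} (hM : 1 ≤ M) (hMn : M < n)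
    (h0 : σ * inner ℝ ξ (W (step i₀ e)) < 0)
    (hpos : ∀ k, 0 < k → k ≤ M → 0 < σ * inner ℝ ξ (W (step i₀ (e + k))))
    (h1 : σ * inner ℝ ξ (W (step i₀ (e + M + 1))) < 0) :
    |∑ k ∈ Finset.Ico 0 M, turn
      (secant ξ φ (W (step i₀ (e + k))) (W (step i₀ (e + k + 1))))
      (secant ξ φ (W (step i₀ (e + k + 1))) (W (step i₀ (e + k + 1 + 1))))| < Real.pi := by
  have hn3 := hW.three_le
  have hσ0 : σ ≠ 0 := by rintro rfl; simp at hσ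
  -- coefficients of the vertices of the truncated chain
  set y : ℕ → ℝ := fun k => σ * inner ℝ ξ (W (step i₀ (e + k))) with hy
  have hys : ∀ k, inner ℝ ξ (σ • W (step i₀ (e + k))) = y k := fun k => by
    rw [inner_smul_right]
  have y0 : y 0 < 0 := h0
  have ypos : ∀ k, 0 < k → k ≤ M → 0 < y k := hpos
  have yM : y (M + 1) < 0 := h1
  -- The coefficients make `a` and `b` orthogonal to `ξ`: up to scale, they are the points where the
  -- edges that enter and leave the run cross the circle.
  set a : E3 := σ • (y 1 • W (step i₀ e) + (-y 0) • W (step i₀ (e + 1))) with ha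
  set b : E3 := σ • ((-y (M + 1)) • W (step i₀ (e + M)) + y M • W (step i₀ (e + M + 1))) with hb
  set p : ℕ → E3 := fun k => if k = 0 then a else if k = M + 1 then b
    else σ • W (step i₀ (e + k)) with hp
  have p0 : p 0 = a := by simp [hp]
  have pM : p (M + 1) = b := by simp [hp]
  have pk : ∀ k, 0 < k → k ≤ M → p k = σ • W (step i₀ (e + k)) := by
    intro k k1 k2
    simp only [hp]
    rw [if_neg (by omega), if_neg (by omega)]
  have xa : inner ℝ ξ a = 0 := by
    have e0 := hys 0; have e1 := hys 1
    rw [inner_smul_right] at e0 e1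
    rw [ha, inner_smul_right, inner_add_right, inner_smul_right, inner_smul_right, mul_add,
      mul_left_comm, mul_left_comm σ (-y 0), e1, show σ * inner ℝ ξ (W (step i₀ e)) = y 0 from rfl]
    ring
  have xb : inner ℝ ξ b = 0 := by
    have e0 := hys M; have e1 := hys (M + 1)
    rw [inner_smul_right] at e0 e1
    rw [hb, inner_smul_right, inner_add_right, inner_smul_right, inner_smul_right, mul_add,
      mul_left_comm, mul_left_comm σ (y M), e0,
      show σ * inner ℝ ξ (W (step i₀ (e + M + 1))) = y (M + 1) from rfl]
    ring
  have hcr : ∀ k, cross (W (step i₀ k)) (W (step i₀ (k + 1))) ≠ 0 := by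
    intro k; rw [step_succ]; exact hW.isRegularPolygon.cross_ne _
  have na : a ≠ 0 := by
    intro h
    have : cross a (W (step i₀ (e + 1))) = (σ * y 1) • cross (W (step i₀ e)) (W (step i₀ (e + 1))) := by
      rw [ha]; apply E3.ext <;> simp <;> ring
    have h2 : cross a (W (step i₀ (e + 1))) = 0 := by rw [h]; apply E3.ext <;> simp
    rw [h2, eq_comm, smul_eq_zero] at this
    rcases this with h3 | h3
    · exact mul_ne_zero hσ0 (ypos 1 one_pos hM).ne' h3
    · exact hcr e h3
  have nb : b ≠ 0 := by
    intro h
    have : cross (W (step i₀ (e + M))) b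
        = (σ * y M) • cross (W (step i₀ (e + M))) (W (step i₀ (e + M + 1))) := by
      rw [hb]; apply E3.ext <;> simp <;> ring
    have h2 : cross (W (step i₀ (e + M))) b = 0 := by rw [h]; apply E3.ext <;> simp
    rw [h2, eq_comm, smul_eq_zero] at this
    rcases this with h3 | h3
    · exact mul_ne_zero hσ0 (ypos M hM le_rfl).ne' h3
    · exact hcr _ h3
  have xk : ∀ k, 0 < k → k ≤ M → 0 < inner ℝ ξ (p k) := by
    intro k k1 k2; rw [pk k k1 k2, hys]; exact ypos k k1 k2
  have xnn : ∀ k, k ≤ M + 1 → 0 ≤ inner ℝ ξ (p k) := by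
    intro k hk
    rcases Nat.eq_zero_or_pos k with rfl | k1
    · rw [p0, xa]
    · rcases Nat.lt_or_ge M k with k2 | k2
      · rw [show k = M + 1 by omega, pM, xb]
      · exact (xk k k1 k2).le
  have hne : ∀ k, k ≤ M + 1 → p k ≠ 0 := by
    intro k hk
    rcases Nat.eq_zero_or_pos k with rfl | k1
    · rw [p0]; exact na
    · rcases Nat.lt_or_ge M k with k2 | k2
      · rw [show k = M + 1 by omega, pM]; exact nb
      · intro h; have := xk k k1 k2; rw [h, inner_zero_right] at this; exact lt_irrefl _ this
  -- every vertex is a combination of the ends of the edges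
  have left : ∀ k, k ≤ M → ∃ r s : ℝ, 0 < r ∧ 0 ≤ s ∧
      p k = σ • (r • W (step i₀ (e + k)) + s • W (step i₀ (e + k + 1))) := by
    intro k hk
    rcases Nat.eq_zero_or_pos k with rfl | k1
    · exact ⟨y 1, -y 0, ypos 1 one_pos hM, by linarith, by rw [p0]; rfl⟩
    · exact ⟨1, 0, one_pos, le_rfl, by rw [pk k k1 hk, one_smul, zero_smul, add_zero]⟩
  have right : ∀ k, k ≤ M → ∃ r s : ℝ, 0 ≤ r ∧ 0 < s ∧
      p (k + 1) = σ • (r • W (step i₀ (e + k)) + s • W (step i₀ (e + k + 1))) := by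
    intro k hk
    rcases hk.lt_or_eq with k1 | rfl
    · exact ⟨0, 1, le_rfl, one_pos, by
        rw [pk (k + 1) (by omega) k1, one_smul, zero_smul, zero_add]; rfl⟩
    · exact ⟨-y (k + 1), y k, by linarith, ypos k hM le_rfl, by rw [pM]⟩
  have mid : ∀ k, k < M → p (k + 1) = σ • W (step i₀ (e + k + 1)) := fun k hk =>
    pk (k + 1) (by omega) hk
  have key := abs_sum_turn_chord_lt hφ hM (by rw [p0, xa]) (by rw [pM, xb]) xk (by
    intro k hk
    obtain ⟨r, s, hr, hs, e1⟩ := left k hk.le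
    obtain ⟨r', s', hr', hs', e2⟩ := right (k + 1) hk
    have e3 : e + (k + 1) = e + k + 1 := by ring
    rw [e3] at e2
    rw [e1, e2, mid k hk, triple_combination]
    have := ht (step i₀ (e + k))
    rw [← step_succ, ← step_succ] at this
    exact mul_ne_zero (mul_ne_zero (mul_ne_zero hσ0 hσ0) hσ0)
      (mul_ne_zero (mul_ne_zero hr.ne' hs'.ne') this)) (by
    intro i j hij hj
    have hs : ∀ k, k ≤ M → InSector σ (W (step i₀ (e + k))) (W (step i₀ (e + k) + 1)) (p k) ∧
        InSector σ (W (step i₀ (e + k))) (W (step i₀ (e + k) + 1)) (p (k + 1)) := by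
      intro k hk
      rw [← step_succ]
      obtain ⟨r, s, hr, hs, e1⟩ := left k hk
      obtain ⟨r', s', hr', hs', e2⟩ := right k hk
      exact ⟨⟨r, s, hr.le, hs, e1⟩, ⟨r', s', hr', hs'.le, e2⟩⟩
    have hst : ∀ k l, k < l → l < k + n → step i₀ (e + l) ≠ step i₀ (e + k) := by
      intro k l hkl hl h
      rw [step_eq_iff] at h
      have h2 := Nat.sub_mod_eq_zero_of_mod_eq h
      have h3 : e + l - (e + k) = l - k := by omega
      rw [h3] at h2
      have := Nat.le_of_dvd (by omega) (Nat.dvd_of_mod_eq_zero h2)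
      omega
    refine conesDisjoint_of_simple (ξ := ξ) hW hσ (i := step i₀ (e + i)) (j := step i₀ (e + j))
      (fun h => hst i j (by omega) (by omega) h.symm) ?_ ?_ (hs i (by omega)).1
      (hs i (by omega)).2 (hs j hj).1 (hs j hj).2 (xnn _ (by omega)) (xnn _ (by omega))
      (xnn _ (by omega)) (xnn _ (by omega)) (hne _ (by omega)) (hne _ (by omega))
      (hne _ (by omega)) (hne _ (by omega)) (Or.inr (xk _ (by omega) (by omega)))
      (Or.inl (xk _ (by omega) (by omega)))
    · intro h
      rw [← step_succ] at h
      exact absurd h (hst (i + 1) j (by omega) (by omega))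
    · intro h
      rw [← step_succ] at h
      -- If `M + 1 = n`, the first and last edges of the run share the vertex `step i₀ e`, which
      -- lies on the other side of the circle.
      by_cases hc : i = 0 ∧ j = M
      · rw [hc.1]; exact h0
      · by_cases hc2 : j + 1 < i + n
        · exact absurd h.symm (hst i (j + 1) (by omega) hc2)
        · omega)
  have hsum : ∑ k ∈ Finset.Ico 0 M, turn (secant ξ φ (p k) (p (k + 1)))
      (secant ξ φ (p (k + 1)) (p (k + 2))) = ∑ k ∈ Finset.Ico 0 M, turn
      (secant ξ φ (W (step i₀ (e + k))) (W (step i₀ (e + k + 1))))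
      (secant ξ φ (W (step i₀ (e + k + 1))) (W (step i₀ (e + k + 1 + 1)))) := by
    refine Finset.sum_congr rfl fun k hk => ?_
    rw [Finset.mem_Ico] at hk
    obtain ⟨r, s, hr, hs, e1⟩ := left k hk.2.le
    obtain ⟨r', s', hr', hs', e2⟩ := right (k + 1) hk.2
    have e3 : e + (k + 1) = e + k + 1 := by ring
    rw [e3] at e2
    rw [e1, e2, mid k hk.2, secant_start hσ, secant_end hσ, turn_ofReal_mul_left hr,
      turn_ofReal_mul_right hs']
  rw [← hsum]; exact key

/-- If the polygon crosses the circle orthogonal to `ξ`, then the total turn is less than `π` times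
the number of crossings. -/
theorem sum_longitudeStep_lt (hW : IsSimplePolygon W) (hξ : ξ ∈ unitSphere)
    (hx : ∀ i, inner ℝ ξ (W i) ≠ 0)
    (ht : ∀ i, triple (W i) (W (i + 1)) (W (i + 1 + 1)) ≠ 0) {i₀ : Fin n}
    (h0 : inner ℝ ξ (W i₀) * inner ℝ ξ (W (i₀ + 1)) < 0) :
    ∑ i, longitudeStep ξ (polar W i) (polar W (i + 1))
      < ∑ i, if inner ℝ ξ (W i) * inner ℝ ξ (W (i + 1)) < 0 then Real.pi else 0 := by
  have hpi := Real.pi_pos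
  have hn3 := hW.three_le
  have hr := hW.isRegularPolygon
  obtain ⟨φ, hφ⟩ := exists_isPlaneChart hξ
  set x : ℕ → ℝ := fun k => inner ℝ ξ (W (step i₀ k)) with hxdef
  have hx0 : ∀ k, x k ≠ 0 := fun k => hx _
  have hC0 : x 0 * x 1 < 0 := by
    simp only [hxdef]; rw [step_succ, step_zero]; exact h0
  have hper : ∀ k, x (n + k) = x k := fun k => by simp only [hxdef, step_add_period]
  set T : ℕ → ℝ := fun k => turn (secant ξ φ (W (step i₀ k)) (W (step i₀ (k + 1))))
      (secant ξ φ (W (step i₀ (k + 1))) (W (step i₀ (k + 1 + 1)))) with hT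
  set c : ℕ → ℝ := fun k => if x k * x (k + 1) < 0 then Real.pi else 0 with hc
  have hc0 : ∀ k, 0 ≤ c k := by intro k; simp only [hc]; split_ifs <;> linarith
  -- Strong induction over the crossing edges: the run since the previous crossing `e` turns by less
  -- than π, and the term `c e = π` pays for it.
  have main : ∀ k, 0 < k → k ≤ n → x k * x (k + 1) < 0 →
      ∑ j ∈ Finset.Ico 0 k, T j < ∑ j ∈ Finset.Ico 0 k, c j := by
    intro k
    induction k using Nat.strong_induction_on with
    | _ k ih =>
      intro hk hkn hCk
      obtain ⟨e, he, hCe, hmax⟩ : ∃ e, e < k ∧ x e * x (e + 1) < 0 ∧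
          ∀ j, e < j → j < k → ¬ x j * x (j + 1) < 0 := by
        classical
        refine ⟨Nat.findGreatest (fun e => x e * x (e + 1) < 0) (k - 1), ?_, ?_, ?_⟩
        · have := Nat.findGreatest_le (P := fun e => x e * x (e + 1) < 0) (k - 1)
          omega
        · exact Nat.findGreatest_spec (P := fun e => x e * x (e + 1) < 0) (Nat.zero_le (k - 1)) hC0
        · intro j h1 h2
          exact Nat.findGreatest_is_greatest h1 (by omega)
      -- all vertices of the run lie on the same side
      obtain ⟨σ, hσ, hσ1⟩ : ∃ σ : ℝ, σ * σ = 1 ∧ 0 < σ * x (e + 1) := by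
        rcases lt_or_gt_of_ne (hx0 (e + 1)) with h | h
        · exact ⟨-1, by norm_num, by linarith⟩
        · exact ⟨1, by norm_num, by linarith⟩
      have same : ∀ i, e + 1 + i ≤ k → 0 < σ * x (e + 1 + i) := by
        intro i
        induction i with
        | zero => intro _; exact hσ1
        | succ i ih2 =>
          intro hi
          have h1 := ih2 (by omega)
          have h2 := not_lt.1 (hmax (e + 1 + i) (by omega) (by omega))
          have h3 : 0 < x (e + 1 + i) * x (e + 1 + i + 1) :=
            lt_of_le_of_ne h2 (mul_ne_zero (hx0 _) (hx0 _)).symm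
          have h4 : (σ * x (e + 1 + i)) * (σ * x (e + 1 + i + 1))
              = σ * σ * (x (e + 1 + i) * x (e + 1 + i + 1)) := by ring
          rw [hσ, one_mul] at h4
          show 0 < σ * x (e + 1 + i + 1)
          exact pos_of_mul_pos_right (by rw [h4]; exact h3) h1.le
      have flip : ∀ a b : ℝ, a * b < 0 → 0 < σ * a → σ * b < 0 := by
        intro a b hab ha
        have h4 : (σ * a) * (σ * b) = σ * σ * (a * b) := by ring
        rw [hσ, one_mul] at h4
        by_contra! h5
        have := mul_nonneg ha.le h5
        linarith
      -- A run cannot go all the way round: with a single crossing, the sign could not return to its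
      -- initial value.
      have hek : k - e < n := by
        by_contra! h
        have he0 : e = 0 := by omega
        have hkn' : k = n := by omega
        subst he0
        have h1 := same (n - 1) (by omega)
        rw [show 0 + 1 + (n - 1) = n + 0 by omega, hper] at h1
        have := flip _ _ hC0 h1
        rw [zero_add] at hσ1
        linarith
      have run := abs_sum_turn_run_lt hW hφ ht i₀ hσ (e := e) (M := k - e) (by omega) hek
        (flip _ _ (by rw [mul_comm]; exact hCe) hσ1) (by
          intro i h1 h2
          have := same (i - 1) (by omega)
          rwa [show e + 1 + (i - 1) = e + i by omega] at this) (by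
          rw [show e + (k - e) = k by omega]
          have := same (k - e - 1) (by omega)
          rw [show e + 1 + (k - e - 1) = k by omega] at this
          exact flip _ _ hCk this)
      have hsplitT := Finset.sum_Ico_consecutive T (Nat.zero_le e) he.le
      have hsplitc := Finset.sum_Ico_consecutive c (Nat.zero_le e) he.le
      have hrun : ∑ j ∈ Finset.Ico e k, T j < Real.pi := by
        rw [Finset.sum_Ico_eq_sum_range, Finset.range_eq_Ico]
        exact (abs_lt.1 run).2
      have hce : Real.pi ≤ ∑ j ∈ Finset.Ico e k, c j := by
        have h1 : c e = Real.pi := if_pos hCe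
        rw [← h1]
        exact Finset.single_le_sum (fun j _ => hc0 j) (Finset.mem_Ico.2 ⟨le_rfl, he⟩)
      rcases Nat.eq_zero_or_pos e with h1 | h1
      · have a1 : ∑ j ∈ Finset.Ico 0 e, T j = 0 := by rw [h1]; simp
        have a2 : ∑ j ∈ Finset.Ico 0 e, c j = 0 := by rw [h1]; simp
        linarith
      · have := ih e he h1 (by omega) hCe
        linarith
  have hfin := main n (by omega) le_rfl (by
    have h1 := hper 0; have h2 := hper 1
    rw [add_zero] at h1
    rw [h1, h2]; exact hC0)
  rw [sum_eq_sum_step _ i₀, sum_eq_sum_step (fun i => if inner ℝ ξ (W i) * inner ℝ ξ (W (i + 1)) < 0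
    then Real.pi else 0) i₀]
  refine lt_of_eq_of_lt ?_ (lt_of_lt_of_eq hfin ?_)
  · refine Finset.sum_congr rfl fun k _ => ?_
    simp only [hT]
    rw [step_succ i₀ (k + 1), step_succ i₀ k, turn_secant_secant hφ hξ hr]
  · refine Finset.sum_congr rfl fun k _ => ?_
    simp only [hc, hxdef, step_succ]

/-- Where the index is positive, the polygon lies in an open hemisphere. -/
theorem exists_sign_of_polarIndex_pos (hW : IsSimplePolygon W) (hξ : ξ ∈ unitSphere)
    (hx : ∀ i, inner ℝ ξ (W i) ≠ 0)
    (ht : ∀ i, triple (W i) (W (i + 1)) (W (i + 1 + 1)) ≠ 0) (hF : 1 / 2 ≤ polarIndex W ξ) :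
    ∃ σ : ℝ, σ * σ = 1 ∧ ∀ i, 0 < σ * inner ℝ ξ (W i) := by
  have hpi := Real.pi_pos
  by_cases hC : ∃ i, inner ℝ ξ (W i) * inner ℝ ξ (W (i + 1)) < 0
  · exfalso
    obtain ⟨i₀, hi₀⟩ := hC
    have h1 := sum_longitudeStep_lt hW hξ hx ht hi₀
    have h2 := four_pi_mul_polarIndex hW.isRegularPolygon hξ hx
    set s : Fin n → ℝ := fun i => if 0 < inner ℝ ξ (W i) then Real.pi else 0 with hs
    -- Upward and downward crossings alternate. Thus counting the upward ones with weight 2π equals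
    -- counting all with weight π, up to a telescoping term.
    have h3 : ∀ i, (if inner ℝ ξ (W i) < 0 ∧ 0 < inner ℝ ξ (W (i + 1)) then 2 * Real.pi else 0)
        = (if inner ℝ ξ (W i) * inner ℝ ξ (W (i + 1)) < 0 then Real.pi else 0)
          + (s (i + 1) - s i) := by
      intro i
      simp only [hs]
      rcases lt_or_gt_of_ne (hx i) with a | a <;> rcases lt_or_gt_of_ne (hx (i + 1)) with b | b
      · rw [if_neg (by intro h; linarith [h.2]), if_neg (by nlinarith), if_neg (by linarith),
          if_neg (by linarith)]; ring
      · rw [if_pos ⟨a, b⟩, if_pos (by nlinarith), if_pos b, if_neg (by linarith)]; ring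
      · rw [if_neg (by intro h; linarith [h.1]), if_pos (by nlinarith), if_neg (by linarith),
          if_pos a]; ring
      · rw [if_neg (by intro h; linarith [h.1]), if_neg (by nlinarith), if_pos b, if_pos a]; ring
    have h4 : ∑ i, (s (i + 1) - s i) = 0 := by
      rw [Finset.sum_sub_distrib, sub_eq_zero]
      exact Equiv.sum_comp (Equiv.addRight (1 : Fin n)) s
    rw [Finset.sum_congr rfl (fun i _ => h3 i), Finset.sum_add_distrib, h4] at h2
    nlinarith
  · push Not at hC
    have hp : ∀ i, 0 < inner ℝ ξ (W i) * inner ℝ ξ (W (i + 1)) := fun i =>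
      lt_of_le_of_ne (hC i) (mul_ne_zero (hx _) (hx _)).symm
    obtain ⟨σ, hσ, hσ1⟩ : ∃ σ : ℝ, σ * σ = 1 ∧ 0 < σ * inner ℝ ξ (W 0) := by
      rcases lt_or_gt_of_ne (hx 0) with h | h
      · exact ⟨-1, by norm_num, by linarith⟩
      · exact ⟨1, by norm_num, by linarith⟩
    refine ⟨σ, hσ, fun i => ?_⟩
    have key : ∀ k, 0 < σ * inner ℝ ξ (W (step 0 k)) := by
      intro k
      induction k with
      | zero => rw [step_zero]; exact hσ1
      | succ k ih =>
        have h4 : (σ * inner ℝ ξ (W (step 0 k))) * (σ * inner ℝ ξ (W (step 0 (k + 1))))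
            = σ * σ * (inner ℝ ξ (W (step 0 k)) * inner ℝ ξ (W (step 0 (k + 1)))) := by ring
        rw [hσ, one_mul, step_succ] at h4
        rw [step_succ]
        exact pos_of_mul_pos_right (by rw [h4]; exact hp _) ih.le
    have := key (i - 0).val
    rwa [step_sub_val] at this

end SignChanges

/-! ### One-sided polygons and the rules of the winding number. -/

/-- Closed spherical polygons such that all other vertices lie strictly on the side `σ` of the great
circle through any edge. -/
structure IsOneSidedPolygon {n : ℕ} [NeZero n] (σ : ℝ) (W : Fin n → E3) : Prop where
  three_le : 3 ≤ n
  mul_self : σ * σ = 1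
  mem_sphere : ∀ i, W i ∈ unitSphere
  pos : ∀ i j, j ≠ i → j ≠ i + 1 → 0 < σ * triple (W i) (W (i + 1)) (W j)

section OneSided

variable {n : ℕ} [NeZero n] {W : Fin n → E3} {ξ : E3} {σ : ℝ}

theorem fin_add_two_ne (h : 3 ≤ n) (i : Fin n) : i + 1 + 1 ≠ i := by
  intro h1
  have h2 : step i 2 = step i 0 := by rw [step_succ i 1, step_succ i 0, step_zero, h1]
  have := step_injOn i (by omega) (by omega) h2
  omega

/-- The plane of a polar edge is orthogonal to the shared vertex `W (i + 1)`; which side is the left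
one depends on the turn of `W` there. -/
theorem triple_polar_polar (W : Fin n → E3) (i : Fin n) (x : E3) :
    triple (polar W i) (polar W (i + 1)) x
      = ‖cross (W i) (W (i + 1))‖⁻¹ * (‖cross (W (i + 1)) (W (i + 1 + 1))‖⁻¹ *
        (triple (W i) (W (i + 1)) (W (i + 1 + 1)) * inner ℝ x (W (i + 1)))) := by
  have h : triple (cross (W i) (W (i + 1))) (cross (W (i + 1)) (W (i + 1 + 1))) x
      = triple (W i) (W (i + 1)) (W (i + 1 + 1)) * inner ℝ x (W (i + 1)) := by
    rw [triple, cross_cross_cross, real_inner_smul_left, real_inner_comm]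
  rw [polar, polar, triple_smul_left, triple_smul_middle, h]

theorem IsOneSidedPolygon.triple_pos (hW : IsOneSidedPolygon σ W) (i : Fin n) :
    0 < σ * triple (W i) (W (i + 1)) (W (i + 1 + 1)) :=
  hW.pos i _ (fin_add_two_ne hW.three_le i) (fin_ne_add_one hW.three_le (i + 1)).symm

theorem IsOneSidedPolygon.cross_ne (hW : IsOneSidedPolygon σ W) (i : Fin n) :
    cross (W i) (W (i + 1)) ≠ 0 := by
  intro h
  have := hW.triple_pos i
  rw [triple, h, inner_zero_left, mul_zero] at this
  exact lt_irrefl _ this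

/-- Pairing with the vertices decides the side of the edges of the polar polygon. -/
theorem IsOneSidedPolygon.triple_polar (hW : IsOneSidedPolygon σ W) (i : Fin n) :
    ∃ r : ℝ, 0 < r ∧ ∀ x, triple (polar W i) (polar W (i + 1)) x
      = r * (σ * inner ℝ x (W (i + 1))) := by
  have h1 := norm_pos_iff.2 (hW.cross_ne i)
  have h2 := norm_pos_iff.2 (hW.cross_ne (i + 1))
  have h3 := hW.triple_pos i
  refine ⟨‖cross (W i) (W (i + 1))‖⁻¹ * (‖cross (W (i + 1)) (W (i + 1 + 1))‖⁻¹ *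
    (σ * triple (W i) (W (i + 1)) (W (i + 1 + 1)))), by positivity, fun x => ?_⟩
  rw [triple_polar_polar]
  linear_combination (-(‖cross (W i) (W (i + 1))‖⁻¹ * ‖cross (W (i + 1)) (W (i + 1 + 1))‖⁻¹ *
    (triple (W i) (W (i + 1)) (W (i + 1 + 1)) * inner ℝ x (W (i + 1))))) * hW.mul_self

theorem IsOneSidedPolygon.leftRegion_polar (hW : IsOneSidedPolygon σ W) :
    leftRegion (polar W) = {x | x ∈ unitSphere ∧ ∀ j, 0 < σ * inner ℝ x (W j)} := by
  ext x
  refine and_congr_right fun _ => ⟨fun h j => ?_, fun h i => ?_⟩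
  · obtain ⟨r, hr, e⟩ := hW.triple_polar (j - 1)
    have := h (j - 1)
    rw [e, sub_add_cancel] at this
    exact pos_of_mul_pos_right this hr.le
  · obtain ⟨r, hr, e⟩ := hW.triple_polar i
    rw [e]
    exact mul_pos hr (h _)

theorem IsConvexPolygon.isOneSidedPolygon (hW : IsConvexPolygon W) :
    ∃ σ, IsOneSidedPolygon σ W := by
  rcases hW.one_sided with h | h
  · exact ⟨1, hW.simple.three_le, one_mul 1, hW.simple.mem_sphere, fun i j h1 h2 => by
      rw [one_mul]; exact h i j h1 h2⟩
  · exact ⟨-1, hW.simple.three_le, by norm_num, hW.simple.mem_sphere, fun i j h1 h2 => by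
      have := h i j h1 h2; linarith⟩

/-- Every vertex of a one-sided polygon is strictly supported by a plane. -/
theorem IsOneSidedPolygon.exists_support (hW : IsOneSidedPolygon σ W) (i : Fin n) :
    ∃ g : E3, inner ℝ g (W i) = 0 ∧ ∀ j, j ≠ i → 0 < inner ℝ g (W j) := by
  obtain ⟨i, rfl⟩ : ∃ k, i = k + 1 := ⟨i - 1, (sub_add_cancel i 1).symm⟩
  -- The sum of the inward normals of the two faces at the vertex. Every other vertex is off at
  -- least one of these faces.
  refine ⟨σ • (cross (W (i + 1)) (W (i + 1 + 1)) + cross (W i) (W (i + 1))), ?_, fun j hj => ?_⟩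
  · rw [real_inner_smul_left, inner_add_left, inner_cross_left, inner_cross_right]; simp
  · rw [real_inner_smul_left, inner_add_left]
    change 0 < σ * (triple (W (i + 1)) (W (i + 1 + 1)) (W j) + triple (W i) (W (i + 1)) (W j))
    rw [mul_add]
    by_cases h1 : j = i + 1 + 1
    · rw [h1, triple_self_right, mul_zero, zero_add]
      exact hW.triple_pos i
    · have h2 := hW.pos (i + 1) j hj h1
      by_cases h3 : j = i
      · rw [h3, triple_self_left, mul_zero, add_zero]
        rwa [h3] at h2
      · exact add_pos h2 (hW.pos i j h3 hj)

end OneSided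

/-- The rules of the winding number are rules of the index of the polar polygon. -/
theorem HasWinding.polarIndex_eq {n : ℕ} [NeZero n] {W : Fin n → E3} {ξ : E3} {k : ℤ}
    (h : HasWinding W ξ k) : IsRegularPolygon W ∧ ξ ∈ unitSphere ∧ ξ ∉ trace (polar W) ∧
      polarIndex W ξ = k := by
  induction h with
  | @convex n _ W ξ hW hξ =>
    obtain ⟨σ, hσ⟩ := hW.isOneSidedPolygon
    rw [hσ.leftRegion_polar] at hξ
    refine ⟨hW.simple.isRegularPolygon, hξ.1, fun h => ?_, ?_⟩
    · obtain ⟨i, hi⟩ := inner_eq_zero_of_mem_trace h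
      have := hξ.2 i
      rw [hi, mul_zero] at this
      exact lt_irrefl _ this
    · obtain ⟨g, g0, g1⟩ := hσ.exists_support (0 + 1)
      rw [polarIndex_of_hemisphere hW.simple hξ.1 hσ.mul_self hξ.2 (fun i h => by
        have := hσ.triple_pos i
        rw [h, mul_zero] at this
        exact lt_irrefl _ this) (0 + 1) g0 g1, add_sub_cancel_right, if_pos (hσ.triple_pos 0),
        Int.cast_one]
  | component W ξ η k hη _ ih =>
    have := connectedComponentIn_subset _ _ hη
    exact ⟨ih.1, this.1, this.2, by rw [polarIndex_eq_of_mem_component ih.1 hη, ih.2.2.2]⟩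
  | cross_left_to_right W ξ η x i k hη hleft hright hx hxi hxj _ ih =>
    refine ⟨ih.1, hη, ?_, ?_⟩
    · exact not_mem_trace_of_crossing hright.ne hη (by rwa [arc_comm]) hxi
    · rw [polarIndex_crossing ih.1 ih.2.1 hη hleft hright hx hxi hxj, ih.2.2.2]; push_cast; ring
  | cross_right_to_left W ξ η x i k hξ hleft hright hx hxi hxj _ ih =>
    refine ⟨ih.1, hξ, not_mem_trace_of_crossing hleft.ne' hξ hx hxi, ?_⟩
    have := polarIndex_crossing ih.1 hξ ih.2.1 hleft hright hx hxi hxj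
    rw [ih.2.2.2] at this
    push_cast
    linarith
  | deform H ξ k hcont hsimple hξ _ ih =>
    exact ⟨(hsimple 1).isRegularPolygon, ih.2.1, hξ 1, by
      rw [← polarIndex_eq_of_deformation hcont (fun t => (hsimple t).isRegularPolygon) ih.2.1 hξ,
        ih.2.2.2]⟩
  | @insert_vertex n _ W p ξ k hW hp _ ih =>
    obtain ⟨m, rfl⟩ : ∃ m, n = m + 1 := ⟨n - 1, by have := hW.three_le; omega⟩
    have hp' : p ∈ openArc (W (Fin.last m)) (W 0) := by rwa [eq_neg_of_add_eq_zero_left (Fin.last_add_one m)]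
    have ht : ξ ∉ trace (polar (Fin.snoc (α := fun _ => E3) W p : Fin (m + 2) → E3)) := by
      rw [polar_snoc hp', trace_snoc_self]; exact ih.2.2.1
    exact ⟨isRegularPolygon_snoc ih.1 hp', ih.2.1, ht, by
      rw [polarIndex_snoc ih.1 ih.2.1 ih.2.2.1 hp', ih.2.2.2]⟩
  | @remove_vertex n _ W p ξ k hW hp _ ih =>
    obtain ⟨m, rfl⟩ : ∃ m, n = m + 1 := ⟨n - 1, by have := hW.three_le; omega⟩
    have hp' : p ∈ openArc (W (Fin.last m)) (W 0) := by rwa [eq_neg_of_add_eq_zero_left (Fin.last_add_one m)]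
    have ht : ξ ∉ trace (polar W) := by
      have := ih.2.2.1
      rwa [polar_snoc hp', trace_snoc_self] at this
    exact ⟨hW.isRegularPolygon, ih.2.1, ht, by
      rw [← polarIndex_snoc hW.isRegularPolygon ih.2.1 ht hp', ih.2.2.2]⟩
  | relabel W ξ k _ ih =>
    refine ⟨isRegularPolygon_relabel ih.1, ih.2.1, ?_, ?_⟩
    · have := trace_relabel (polar W)
      exact fun h => ih.2.2.1 (this ▸ h)
    · rw [polarIndex_relabel, ih.2.2.2]

/-! ### The convex cone over a one-sided polygon. -/

section OneSidedCone

variable {n : ℕ} [NeZero n] {V : Fin n → E3} {σ : ℝ}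

theorem IsOneSidedPolygon.nonneg (hV : IsOneSidedPolygon σ V) (i j : Fin n) :
    0 ≤ σ * triple (V i) (V (i + 1)) (V j) := by
  by_cases h1 : j = i
  · rw [h1, triple_self_left, mul_zero]
  by_cases h2 : j = i + 1
  · rw [h2, triple_self_right, mul_zero]
  exact (hV.pos i j h1 h2).le

theorem ne_zero_of_mem_unitSphere {v : E3} (h : v ∈ unitSphere) : v ≠ 0 := by
  rintro rfl
  rw [mem_unitSphere, inner_zero_left] at h
  exact zero_ne_one h

theorem eq_one_of_smul_mem_unitSphere {v : E3} {c : ℝ} (hv : v ∈ unitSphere) (hc : 0 ≤ c)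
    (h : c • v ∈ unitSphere) : c = 1 := by
  rw [mem_unitSphere] at hv h
  rw [real_inner_smul_left, inner_smul_right, hv] at h
  nlinarith

/-- A common point is in the plane of edge `i`, while the ends of edge `j` are on its nonnegative
side. An end strictly inside must have coefficient zero. -/
theorem IsOneSidedPolygon.eq_of_mem_arc_of_mem_arc (hV : IsOneSidedPolygon σ V) {i j : Fin n}
    (hij : i ≠ j) (hji : i ≠ j + 1) {x : E3} (hx : x ∈ arc (V i) (V (i + 1)))
    (hx' : x ∈ arc (V j) (V (j + 1))) : j = i + 1 ∧ x = V j := by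
  obtain ⟨hx1, a, b, -, -, e⟩ := hx
  obtain ⟨-, c, d, hc, hd, rfl⟩ := hx'
  have h0 : c * (σ * triple (V i) (V (i + 1)) (V j))
      + d * (σ * triple (V i) (V (i + 1)) (V (j + 1))) = 0 := by
    have : triple (V i) (V (i + 1)) (c • V j + d • V (j + 1)) = 0 := by
      rw [e]; simp [triple_add_right, triple_smul_right, triple_self_left, triple_self_right]
    rw [triple_add_right, triple_smul_right, triple_smul_right] at this
    linear_combination σ * this
  have h1 := mul_nonneg hc (hV.nonneg i j)
  have h2 := mul_nonneg hd (hV.nonneg i (j + 1))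
  have hd0 : d = 0 := by
    have h3 := hV.pos i (j + 1) hji.symm (fun h => hij (add_right_cancel h).symm)
    exact (mul_eq_zero.1 (by linarith)).resolve_right h3.ne'
  by_cases hj : j = i + 1
  · refine ⟨hj, ?_⟩
    rw [hd0, zero_smul, add_zero] at hx1 ⊢
    rw [eq_one_of_smul_mem_unitSphere (hV.mem_sphere j) hc hx1, one_smul]
  · have h3 := hV.pos i j hij.symm hj
    have hc0 : c = 0 := (mul_eq_zero.1 (by linarith)).resolve_right h3.ne'
    rw [hc0, hd0, zero_smul, zero_smul, add_zero] at hx1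
    exact absurd rfl (ne_zero_of_mem_unitSphere hx1)

theorem IsOneSidedPolygon.isConvexPolygon (hV : IsOneSidedPolygon σ V) : IsConvexPolygon V where
  simple :=
    { three_le := hV.three_le
      mem_sphere := hV.mem_sphere
      ne_succ := fun i h => hV.cross_ne i (by rw [h]; apply E3.ext <;> simp <;> ring)
      ne_neg_succ := fun i h => hV.cross_ne i (by rw [h]; apply E3.ext <;> simp <;> ring)
      edges_disjoint := fun i j hij x hx hx' => by
        by_cases h : i = j + 1
        · refine .inr (hV.eq_of_mem_arc_of_mem_arc hij.symm (fun h' => ?_) hx' hx)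
          exact fin_add_two_ne hV.three_le i (by rw [← h', ← h])
        · exact .inl (hV.eq_of_mem_arc_of_mem_arc hij h hx hx') }
  one_sided := by
    rcases mul_self_eq_one_iff.1 hV.mul_self with h | h
    · exact .inl fun i j h1 h2 => by simpa [h] using hV.pos i j h1 h2
    · exact .inr fun i j h1 h2 => by simpa [h] using hV.pos i j h1 h2

/-- By duality, the side of `polar V j` with respect to the polar edge `i` is the side of `V (i +
1)` with respect to the edge `j`. -/
theorem IsOneSidedPolygon.isOneSidedPolygon_polar (hV : IsOneSidedPolygon σ V) :
    IsOneSidedPolygon 1 (polar V) where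
  three_le := hV.three_le
  mul_self := one_mul 1
  mem_sphere := hV.isConvexPolygon.simple.isRegularPolygon.polar_mem
  pos i j h1 h2 := by
    obtain ⟨r, hr, e⟩ := hV.triple_polar i
    rw [one_mul, e, polar, real_inner_smul_left]
    have h3 : 0 < σ * inner ℝ (cross (V j) (V (j + 1))) (V (i + 1)) :=
      hV.pos j (i + 1) h2.symm fun h => h1 (add_right_cancel h).symm
    have h4 := inv_pos.2 (norm_pos_iff.2 (hV.cross_ne j))
    rw [mul_left_comm σ]
    positivity

/-- The convex cone over a one-sided polygon, as an intersection of half-spaces. -/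
def sideCone (σ : ℝ) (V : Fin n → E3) : Set E3 := {x | ∀ i, 0 ≤ σ * triple (V i) (V (i + 1)) x}

/-- The two coefficients are nonnegative by the inequalities of the two neighbouring faces. -/
theorem IsOneSidedPolygon.exists_eq_of_mem_face (hV : IsOneSidedPolygon σ V) {x : E3}
    (hx : x ∈ sideCone σ V) {i : Fin n} (hi : σ * triple (V i) (V (i + 1)) x = 0) :
    ∃ a b : ℝ, 0 ≤ a ∧ 0 ≤ b ∧ x = a • V i + b • V (i + 1) := by
  have hσ : σ ≠ 0 := by rintro rfl; simpa using hV.mul_self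
  obtain ⟨a, b, rfl⟩ := exists_eq_smul_add_smul (hV.cross_ne i)
    ((mul_eq_zero.1 hi).resolve_left hσ)
  refine ⟨a, b, ?_, ?_, rfl⟩
  · have h := hx (i + 1)
    rw [triple_add_right, triple_smul_right, triple_smul_right, triple_self_left, mul_zero,
      add_zero, mul_left_comm] at h
    exact nonneg_of_mul_nonneg_left h (hV.pos (i + 1) i (fin_ne_add_one hV.three_le i)
      (fin_add_two_ne hV.three_le i).symm)
  · obtain ⟨i, rfl⟩ : ∃ k, i = k + 1 := ⟨i - 1, (sub_add_cancel i 1).symm⟩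
    have h := hx i
    rw [triple_add_right, triple_smul_right, triple_smul_right, triple_self_right, mul_zero,
      zero_add, mul_left_comm] at h
    exact nonneg_of_mul_nonneg_left h (hV.triple_pos i)

/-- Move `x` in the direction `-V 0` until it first meets a face; the least ratio `t` is the
distance travelled, and the face supplies the other two terms. -/
theorem IsOneSidedPolygon.exists_eq_of_mem_sideCone (hV : IsOneSidedPolygon σ V) {x : E3}
    (hx : x ∈ sideCone σ V) : ∃ (i j : Fin n) (a b t : ℝ), 0 ≤ a ∧ 0 ≤ b ∧ 0 ≤ t ∧
      x = a • V i + b • V (i + 1) + t • V j := by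
  classical
  set T : Fin n → E3 → ℝ := fun i y => σ * triple (V i) (V (i + 1)) y
  obtain ⟨i, hi, hmin⟩ := Finset.exists_min_image
    (Finset.univ.filter fun i => 0 < T i (V 0)) (fun i => T i x / T i (V 0))
    ⟨0 + 1, by
      rw [Finset.mem_filter]
      exact ⟨Finset.mem_univ _, hV.pos (0 + 1) 0 (fin_ne_add_one hV.three_le 0)
        (fin_add_two_ne hV.three_le 0).symm⟩⟩
  rw [Finset.mem_filter] at hi
  set t := T i x / T i (V 0)
  have ht : 0 ≤ t := div_nonneg (hx i) hi.2.le
  have hT : ∀ k, T k (x - t • V 0) = T k x - t * T k (V 0) := fun k => by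
    simp only [T]
    rw [sub_eq_add_neg, ← neg_smul, triple_add_right, triple_smul_right]; ring
  have hmem : x - t • V 0 ∈ sideCone σ V := fun k => by
    change 0 ≤ T k (x - t • V 0)
    rw [hT]
    rcases (hV.nonneg k 0).eq_or_lt with h | h
    · have h1 : T k (V 0) = 0 := h.symm
      rw [h1, mul_zero, sub_zero]
      exact hx k
    · have := hmin k (Finset.mem_filter.2 ⟨Finset.mem_univ _, h⟩)
      rw [le_div_iff₀ h] at this
      exact sub_nonneg.2 this
  obtain ⟨a, b, ha, hb, e⟩ := hV.exists_eq_of_mem_face hmem (i := i) (by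
    change T i (x - t • V 0) = 0
    rw [hT, div_mul_cancel₀ _ hi.2.ne', sub_self])
  exact ⟨i, 0, a, b, t, ha, hb, ht, by rw [← e, sub_add_cancel]⟩

theorem convex_sideCone (σ : ℝ) (V : Fin n → E3) : Convex ℝ (sideCone σ V) := by
  intro x hx y hy a b ha hb _ i
  rw [triple_add_right, triple_smul_right, triple_smul_right, mul_add, mul_left_comm,
    mul_left_comm σ b]
  exact add_nonneg (mul_nonneg ha (hx i)) (mul_nonneg hb (hy i))

theorem continuous_triple (a b : E3) : Continuous fun x => triple a b x := by
  unfold triple; fun_prop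

theorem isClosed_sideCone (σ : ℝ) (V : Fin n → E3) : IsClosed (sideCone σ V) := by
  rw [show sideCone σ V = ⋂ i, {x | 0 ≤ σ * triple (V i) (V (i + 1)) x} by
    ext x; simp [sideCone]]
  exact isClosed_iInter fun i =>
    isClosed_le continuous_const (continuous_const.mul (continuous_triple _ _))

theorem IsOneSidedPolygon.frontier_sideCone (hV : IsOneSidedPolygon σ V) :
    frontier (sideCone σ V) = vertexStar V := by
  rw [(isClosed_sideCone σ V).frontier_eq]
  ext x
  constructor
  · rintro ⟨hx, hx'⟩
    by_contra h
    refine hx' (mem_interior.2 ⟨⋂ i, {x | 0 < σ * triple (V i) (V (i + 1)) x}, fun y hy i =>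
      (mem_iInter.1 hy i).le, isOpen_iInter_of_finite fun i =>
        isOpen_lt continuous_const (continuous_const.mul (continuous_triple _ _)),
      mem_iInter.2 fun i => (hx i).lt_of_ne fun h0 => h (mem_iUnion.2 ⟨i, ?_⟩)⟩)
    exact hV.exists_eq_of_mem_face hx h0.symm
  · intro hx
    obtain ⟨i, a, b, ha, hb, rfl⟩ := mem_iUnion.1 hx
    refine ⟨fun k => ?_, fun h => ?_⟩
    · rw [triple_add_right, triple_smul_right, triple_smul_right, mul_add, mul_left_comm,
        mul_left_comm σ b]
      exact add_nonneg (mul_nonneg ha (hV.nonneg _ _)) (mul_nonneg hb (hV.nonneg _ _))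
    · set p := a • V i + b • V (i + 1) with hp
      set N := cross (V i) (V (i + 1)) with hN
      -- For `t < 0` the point has left the cone through the face `i`, although it is near `p`.
      have hc : Tendsto (fun t : ℝ => p + t • σ • N) (𝓝[<] 0) (𝓝 p) := by
        have : Continuous fun t : ℝ => p + t • σ • N := by fun_prop
        have h0 := this.tendsto 0
        rw [zero_smul, add_zero] at h0
        exact h0.mono_left nhdsWithin_le_nhds
      obtain ⟨t, ht, ht0⟩ := ((hc.eventually (mem_interior_iff_mem_nhds.1 h)).and
        self_mem_nhdsWithin).exists
      have h1 := ht i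
      have h2 : triple (V i) (V (i + 1)) p = 0 := by
        simp [hp, triple_add_right, triple_smul_right, triple_self_left, triple_self_right]
      have h3 : 0 < inner ℝ N N := real_inner_self_pos.2 (hV.cross_ne i)
      rw [triple_add_right, h2, triple_smul_right, triple_smul_right, zero_add] at h1
      change 0 ≤ σ * (t * (σ * inner ℝ N N)) at h1
      have h4 : σ * (t * (σ * inner ℝ N N)) = t * inner ℝ N N := by
        linear_combination (t * inner ℝ N N) * hV.mul_self
      rw [h4] at h1
      exact absurd h1 (not_le.2 (mul_neg_of_neg_of_pos ht0 h3))

end OneSidedCone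

/-- A one-sided polygon formed by some vertices of `W` spans the convex hull of the star of `W` if
all vertices of `W` lie in its cone. -/
theorem IsOneSidedPolygon.convexHull_vertexStar {n m : ℕ} [NeZero n] [NeZero m] {W : Fin n → E3}
    {f : Fin m → Fin n} {σ : ℝ} (hV : IsOneSidedPolygon σ (W ∘ f))
    (hW : ∀ j, W j ∈ sideCone σ (W ∘ f)) :
    convexHull ℝ (vertexStar W) = sideCone σ (W ∘ f) := by
  refine (convexHull_min ?_ (convex_sideCone _ _)).antisymm fun x hx => ?_
  · intro x hx i
    obtain ⟨j, a, b, ha, hb, rfl⟩ := mem_iUnion.1 hx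
    rw [triple_add_right, triple_smul_right, triple_smul_right, mul_add, mul_left_comm,
      mul_left_comm σ b]
    exact add_nonneg (mul_nonneg ha (hW _ _)) (mul_nonneg hb (hW _ _))
  · have hray : ∀ (j : Fin n) (s : ℝ), 0 ≤ s → s • W j ∈ convexHull ℝ (vertexStar W) :=
      fun j s hs => subset_convexHull ℝ _ (mem_iUnion.2 ⟨j, s, 0, hs, le_rfl, by simp⟩)
    obtain ⟨i, j, a, b, t, ha, hb, ht, rfl⟩ := hV.exists_eq_of_mem_sideCone hx
    have hc := convex_convexHull ℝ (vertexStar W)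
    -- The factors 4, 4 and 2 compensate for taking midpoints twice.
    have h1 := hc (hray (f i) (4 * a) (by positivity)) (hray (f (i + 1)) (4 * b) (by positivity))
      (show (0 : ℝ) ≤ 1 / 2 by norm_num) (show (0 : ℝ) ≤ 1 / 2 by norm_num) (by norm_num)
    have h2 := hc h1 (hray (f j) (2 * t) (by positivity))
      (show (0 : ℝ) ≤ 1 / 2 by norm_num) (show (0 : ℝ) ≤ 1 / 2 by norm_num) (by norm_num)
    convert h2 using 1
    simp only [Function.comp_apply]
    module

/-- Every `W j` is a nonnegative combination of the selected vertices with some positive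
coefficient, so positivity on these suffices. -/
theorem IsOneSidedPolygon.leftRegion_polar_comp {n m : ℕ} [NeZero n] [NeZero m] {W : Fin n → E3}
    {f : Fin m → Fin n} {σ : ℝ} (hV : IsOneSidedPolygon σ (W ∘ f))
    (hW0 : ∀ j, W j ∈ unitSphere) (hW : ∀ j, W j ∈ sideCone σ (W ∘ f)) :
    leftRegion (polar (W ∘ f)) = {x | x ∈ unitSphere ∧ ∀ j, 0 < σ * inner ℝ x (W j)} := by
  rw [hV.leftRegion_polar]
  ext x
  refine and_congr_right fun _ => ⟨fun h j => ?_, fun h j => h (f j)⟩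
  obtain ⟨i, k, a, b, t, ha, hb, ht, e⟩ := hV.exists_eq_of_mem_sideCone (hW j)
  have h1 := mul_nonneg ha (h i).le
  have h2 := mul_nonneg hb (h (i + 1)).le
  have h3 := mul_nonneg ht (h k).le
  have h4 : σ * inner ℝ x (W j) = a * (σ * inner ℝ x ((W ∘ f) i))
      + b * (σ * inner ℝ x ((W ∘ f) (i + 1))) + t * (σ * inner ℝ x ((W ∘ f) k)) := by
    rw [e]
    simp only [inner_add_right, inner_smul_right]
    ring
  refine lt_of_le_of_ne (by rw [h4]; positivity) fun h0 => ?_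
  rw [← h0] at h4
  have ha0 := (mul_eq_zero.1 (show a * _ = 0 by linarith)).resolve_right (h i).ne'
  have hb0 := (mul_eq_zero.1 (show b * _ = 0 by linarith)).resolve_right (h (i + 1)).ne'
  have ht0 := (mul_eq_zero.1 (show t * _ = 0 by linarith)).resolve_right (h k).ne'
  rw [ha0, hb0, ht0] at e
  exact ne_zero_of_mem_unitSphere (hW0 j) (by simpa using e)

theorem exists_ne_ne {n : ℕ} (h : 3 ≤ n) (a b : Fin n) : ∃ c, c ≠ a ∧ c ≠ b := by
  have : ({a, b} : Finset (Fin n)) ≠ Finset.univ := fun e => by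
    have h1 := Finset.card_le_two (a := a) (b := b)
    rw [e, Finset.card_univ, Fintype.card_fin] at h1
    omega
  obtain ⟨c, hc⟩ := not_forall.1 (mt Finset.eq_univ_iff_forall.2 this)
  exact ⟨c, by simpa using hc⟩

theorem fin_val_sub {n : ℕ} (a b : Fin n) :
    (a - b).val = if b.val ≤ a.val then a.val - b.val else n + a.val - b.val := by
  split_ifs with h
  · exact Fin.sub_val_of_le h
  · exact Fin.coe_sub_iff_lt.2 (not_le.1 h)

/-! ### Hull vertices, hull edges and their cyclic order. -/

section Hull

variable {n : ℕ} {W : Fin n → E3} {ξ : E3} {σ : ℝ}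

/-- The vertices that are strictly supported by a plane. -/
def IsHullVertex (W : Fin n → E3) (a : Fin n) : Prop :=
  ∃ g : E3, inner ℝ g (W a) = 0 ∧ ∀ j, j ≠ a → 0 < inner ℝ g (W j)

/-- The pairs of vertices such that all others lie strictly on the side `σ`. -/
def IsHullEdge (σ : ℝ) (W : Fin n → E3) (a b : Fin n) : Prop :=
  a ≠ b ∧ ∀ j, j ≠ a → j ≠ b → 0 < σ * triple (W a) (W b) (W j)

theorem InGeneralPosition.injective (hgen : InGeneralPosition W) (h3 : 3 ≤ n) :
    Function.Injective W := by
  intro a b hab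
  by_contra h
  obtain ⟨c, h1, h2⟩ := exists_ne_ne h3 a b
  refine hgen a c b h1.symm h2 h ?_
  rw [← hab, triple_self_left]

/-- Rotate the supporting plane about the line through `W a` until it meets another vertex, the one
that maximizes the slope. General position makes the remaining inequalities strict. -/
theorem IsHullVertex.exists_isHullEdge (h3 : 3 ≤ n) (hσ : σ * σ = 1) (hgen : InGeneralPosition W)
    {a : Fin n} (h : IsHullVertex W a) : ∃ b, IsHullEdge σ W a b := by
  have hσ0 : σ ≠ 0 := by rintro rfl; simp at hσ
  obtain ⟨g, g0, g1⟩ := h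
  obtain ⟨c, hc, -⟩ := exists_ne_ne h3 a a
  have hgg : 0 < inner ℝ g g := real_inner_self_pos.2 fun h => by
    have := g1 c hc
    rw [h, inner_zero_left] at this
    exact lt_irrefl _ this
  obtain ⟨b, hb, hmax⟩ := Finset.exists_max_image (Finset.univ.erase a)
    (fun j => σ * triple (W a) (W j) g / inner ℝ g (W j)) ⟨c, by simpa using hc⟩
  have hba : b ≠ a := Finset.ne_of_mem_erase hb
  refine ⟨b, hba.symm, fun j hja hjb => ?_⟩
  refine lt_of_le_of_ne ?_ (mul_ne_zero hσ0 (hgen a b j hba.symm hjb.symm hja.symm)).symm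
  have h1 := hmax j (Finset.mem_erase.2 ⟨hja, Finset.mem_univ _⟩)
  rw [div_le_div_iff₀ (g1 j hja) (g1 b hba)] at h1
  have h2 := congrArg (fun v => inner ℝ g v) (triple_smul_eq (W a) (W b) (W j) g)
  simp only [inner_add_right, inner_smul_right, g0, mul_zero, zero_add] at h2
  have h4 : triple (W a) g (W j) = -triple (W a) (W j) g := by
    rw [triple_rotate, triple_swap, ← triple_rotate, triple_rotate, triple_rotate]
  rw [h4] at h2
  have h5 : 0 ≤ σ * triple (W a) (W b) (W j) * inner ℝ g g := by
    rw [show σ * triple (W a) (W b) (W j) * inner ℝ g g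
      = σ * (triple (W a) (W b) (W j) * inner ℝ g g) by ring, h2]
    linarith
  exact nonneg_of_mul_nonneg_left h5 hgg

/-- Tilt the plane of the edge slightly about `W b`, so that `W a` moves to the positive side; `p`
is the part of `W a` orthogonal to `W b`. -/
theorem IsHullEdge.isHullVertex (hW : ∀ i, W i ∈ unitSphere) {a b : Fin n}
    (hab : W a ≠ W b) (hab' : W a ≠ -W b) (h : IsHullEdge σ W a b) : IsHullVertex W b := by
  set p := W a - inner ℝ (W a) (W b) • W b
  have hpb : inner ℝ p (W b) = 0 := by
    rw [inner_sub_left, real_inner_smul_left, mem_unitSphere.1 (hW b), mul_one, sub_self]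
  have hpa : 0 < inner ℝ p (W a) := by
    rw [inner_sub_left, real_inner_smul_left, mem_unitSphere.1 (hW a), real_inner_comm]
    have h1 := inner_lt_one (hW b) (hW a) hab.symm
    have h2 := neg_one_lt_inner (hW b) (hW a) fun e => hab' (by rw [e, neg_neg])
    rw [real_inner_comm (W a) (W b)] at h1 h2
    rw [real_inner_comm]
    nlinarith
  have key : ∀ᶠ ε : ℝ in 𝓝[>] 0, ∀ j, j ≠ a → j ≠ b →
      0 < σ * triple (W a) (W b) (W j) + ε * inner ℝ p (W j) := by
    refine eventually_all.2 fun j => ?_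
    by_cases h1 : j = a
    · exact .of_forall fun _ h => absurd h1 h
    by_cases h2 : j = b
    · exact .of_forall fun _ _ h => absurd h2 h
    have hc : Continuous fun ε : ℝ => σ * triple (W a) (W b) (W j) + ε * inner ℝ p (W j) := by
      fun_prop
    have h0 := hc.tendsto 0
    rw [zero_mul, add_zero] at h0
    have := h0.eventually (lt_mem_nhds (h.2 j h1 h2))
    exact (this.filter_mono nhdsWithin_le_nhds).mono fun ε hε _ _ => hε
  obtain ⟨ε, hε, hε0⟩ := (key.and self_mem_nhdsWithin).exists
  have e : ∀ j, inner ℝ (σ • cross (W a) (W b) + ε • p) (W j)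
      = σ * triple (W a) (W b) (W j) + ε * inner ℝ p (W j) := fun j => by
    rw [inner_add_left, real_inner_smul_left, real_inner_smul_left, triple]
  refine ⟨σ • cross (W a) (W b) + ε • p, ?_, fun j hj => ?_⟩
  · rw [e, triple_self_right, hpb]; ring
  · rw [e]
    by_cases h1 : j = a
    · rw [h1, triple_self_left, mul_zero, zero_add]
      exact mul_pos hε0 hpa
    · exact hε j h1 hj

theorem IsHullEdge.not_symm (h3 : 3 ≤ n) {a b : Fin n} (h : IsHullEdge σ W a b) :
    ¬IsHullEdge σ W b a := by
  intro h'
  obtain ⟨c, h1, h2⟩ := exists_ne_ne h3 a b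
  have h4 := h.2 c h1 h2
  have h5 := h'.2 c h2 h1
  rw [triple_swap] at h5
  linarith

variable [NeZero n]

/-- A vertex closest to the great circle orthogonal to `ξ` is a hull vertex. -/
theorem exists_isHullVertex (h3 : 3 ≤ n) (hW : ∀ i, W i ∈ unitSphere) (hgen : InGeneralPosition W)
    (hx : ∀ i, 0 < σ * inner ℝ ξ (W i)) : ∃ a, IsHullVertex W a := by
  obtain ⟨a, ha⟩ := Finite.exists_min fun i => σ * inner ℝ ξ (W i)
  have e : ∀ j, inner ℝ (σ • ξ - (σ * inner ℝ ξ (W a)) • W a) (W j)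
      = σ * inner ℝ ξ (W j) - σ * inner ℝ ξ (W a) * inner ℝ (W a) (W j) := fun j => by
    rw [inner_sub_left, real_inner_smul_left, real_inner_smul_left]
  refine ⟨a, σ • ξ - (σ * inner ℝ ξ (W a)) • W a, ?_, fun j hj => ?_⟩
  · rw [e, mem_unitSphere.1 (hW a), mul_one, sub_self]
  · have h1 := inner_lt_one (hW a) (hW j) fun h => hj (hgen.injective h3 h).symm
    have h2 := ha j
    have h4 := mul_pos (hx a) (sub_pos.2 h1)
    rw [e]
    linarith

/-- Along the polygon, no hull vertex lies between the ends of a hull edge. -/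
theorem IsHullEdge.not_between (hW : IsSimplePolygon W) (hξ : ξ ∈ unitSphere) (hσ : σ * σ = 1)
    (hx : ∀ i, 0 < σ * inner ℝ ξ (W i))
    (ht : ∀ i, triple (W i) (W (i + 1)) (W (i + 1 + 1)) ≠ 0) {a b c : Fin n}
    (hpos : 0 < σ * triple (W (a - 1)) (W a) (W (a + 1))) (hab : IsHullEdge σ W a b)
    (ha : IsHullVertex W a) (hb : IsHullVertex W b) (hc : IsHullVertex W c) (hca : c ≠ a) :
    ¬(c - a).val < (b - a).val := by
  intro hlt
  obtain ⟨M, rfl⟩ : ∃ M, n = M + 1 := ⟨n - 1, by have := hW.three_le; omega⟩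
  have hH := isHemisphericPolygon_of_simple hW hσ hx ht a
  obtain ⟨g₀, h₀, h₀'⟩ := ha
  obtain ⟨g₁, h₁, h₁'⟩ := hb
  obtain ⟨g₂, h₂, h₂'⟩ := hc
  have hval : ∀ (k : ℕ) (d : Fin (M + 1)), k ≤ M → k ≠ (d - a).val → step a k ≠ d := by
    intro k d hk hkd h
    rw [← step_sub_val a d] at h
    exact hkd (step_injOn a (by omega) (d - a).isLt h)
  have hcube : ∀ u v w : E3, triple (σ • u) (σ • v) (σ • w) = σ * triple u v w := fun u v w => by
    rw [triple_smul_left, triple_smul_middle, triple_smul_right]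
    linear_combination (σ * triple u v w) * hσ
  have hinner : ∀ g v : E3, inner ℝ (σ • g) (σ • v) = inner ℝ g v := fun g v => by
    rw [real_inner_smul_left, inner_smul_right]
    linear_combination (inner ℝ g v) * hσ
  have e : step a M = a - 1 := by rw [eq_sub_iff_add_eq, ← step_succ, step_self]
  have h0 : ∀ k, 0 < k → k ≤ M → step a k ≠ a := fun k h1 h2 =>
    hval k a h2 (by rw [sub_self]; exact h1.ne')
  refine hH.no_extreme_between hξ (b := (b - a).val) (c := (c - a).val) (g₀ := σ • g₀)
    (g₁ := σ • g₁) (g₂ := σ • g₂) ?_ ?_ hlt (by have := (b - a).isLt; omega) ?_ ?_ ?_ ?_ ?_ ?_ ?_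
  · simp only [hcube, step_zero, step_succ a 0, e]
    exact hpos
  · exact Nat.pos_of_ne_zero fun h => hca (by
      rw [← step_sub_val a c, h, step_zero])
  · intro k k0 kM kb
    simp only [hcube, step_zero, step_sub_val]
    exact hab.2 _ (h0 k k0 kM) (hval k b kM kb)
  · simp only [hinner, step_zero, h₀]
  · intro k k0 kM
    simp only [hinner]
    exact h₀' _ (h0 k k0 kM)
  · simp only [hinner, step_sub_val, h₁]
  · intro k kM kb
    simp only [hinner]
    exact h₁' _ (hval k b kM kb)
  · simp only [hinner, step_sub_val, h₂]
  · intro k kM kc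
    simp only [hinner]
    exact h₂' _ (hval k c kM kc)

/-- The hull vertices of a polygon of index `1` form a one-sided polygon. -/
theorem exists_isOneSidedPolygon_comp (hW : IsSimplePolygon W) (hgen : InGeneralPosition W)
    (hξ : ξ ∈ unitSphere) (hσ : σ * σ = 1) (hx : ∀ i, 0 < σ * inner ℝ ξ (W i))
    (ht : ∀ i, triple (W i) (W (i + 1)) (W (i + 1 + 1)) ≠ 0)
    (hpos : ∀ a, IsHullVertex W a → 0 < σ * triple (W (a - 1)) (W a) (W (a + 1))) :
    ∃ (m : ℕ) (_ : NeZero m) (f : Fin m → Fin n), StrictMono f ∧ IsOneSidedPolygon σ (W ∘ f) ∧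
      ∀ j, W j ∈ sideCone σ (W ∘ f) := by
  classical
  have h3 := hW.three_le
  set S : Finset (Fin n) := Finset.univ.filter (IsHullVertex W) with hS
  have hmem : ∀ a, a ∈ S ↔ IsHullVertex W a := fun a => by simp [hS]
  have next : ∀ a, IsHullVertex W a → ∃ b, IsHullEdge σ W a b ∧ IsHullVertex W b := by
    intro a ha
    obtain ⟨b, hb⟩ := ha.exists_isHullEdge h3 hσ hgen
    have h1 : W a ≠ W b := fun h => hb.1 (hgen.injective h3 h)
    refine ⟨b, hb, hb.isHullVertex hW.mem_sphere h1 fun h => ?_⟩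
    obtain ⟨c, hca, hcb⟩ := exists_ne_ne h3 a b
    refine hgen a b c hb.1 hcb.symm hca.symm ?_
    rw [h]
    simp [triple_eq_sum]; ring
  obtain ⟨a, ha⟩ := exists_isHullVertex h3 hW.mem_sphere hgen hx
  -- Two successive hull edges cannot lead back to the start, since a hull edge is never one in both
  -- directions.
  have hcard : 3 ≤ S.card := by
    obtain ⟨b, hab, hb⟩ := next a ha
    obtain ⟨c, hbc, hc⟩ := next b hb
    have hac : a ≠ c := by rintro rfl; exact hab.not_symm h3 hbc
    calc 3 = ({a, b, c} : Finset (Fin n)).card :=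
          (Finset.card_eq_three.2 ⟨a, b, c, hab.1, hac, hbc.1, rfl⟩).symm
      _ ≤ S.card := Finset.card_le_card (by
          intro d hd
          simp only [Finset.mem_insert, Finset.mem_singleton] at hd
          rcases hd with rfl | rfl | rfl
          exacts [(hmem _).2 ha, (hmem _).2 hb, (hmem _).2 hc])
  obtain ⟨M, hM⟩ : ∃ M, S.card = M + 1 := ⟨S.card - 1, by omega⟩
  set f : Fin (M + 1) → Fin n := fun k => S.orderEmbOfFin hM k with hf
  have hmono : StrictMono f := (S.orderEmbOfFin hM).strictMono
  have hfS : ∀ k, IsHullVertex W (f k) := fun k => (hmem _).1 (S.orderEmbOfFin_mem hM k)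
  have hedge : ∀ k, IsHullEdge σ W (f k) (f (k + 1)) := by
    intro k
    obtain ⟨b, hab, hb⟩ := next (f k) (hfS k)
    obtain ⟨l, rfl⟩ : b ∈ Set.range f := by
      have := Finset.range_orderEmbOfFin S hM
      exact this.symm.subset ((hmem b).2 hb)
    by_cases hl : l = k + 1
    · rwa [← hl]
    exfalso
    have hkl : k ≠ l := by rintro rfl; exact hab.1 rfl
    have hkk : k ≠ k + 1 := fin_ne_add_one (by omega) k
    -- Since `f` is increasing, going round from `f k` one meets `f (k + 1)` before `f l`, also when
    -- `k` is the last index and `k + 1` wraps around to 0.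
    refine hab.not_between hW hξ hσ hx ht (hpos _ (hfS k)) (hfS k) hb (hfS (k + 1))
      (fun h => hkk (hmono.injective h).symm) ?_
    have hlt : ∀ {i j : Fin (M + 1)}, i.val < j.val → (f i).val < (f j).val := fun h => hmono h
    have hkl' := Fin.val_ne_of_ne hkl
    have hl' := Fin.val_ne_of_ne hl
    have hbk := (f k).isLt
    have hbl := (f l).isLt
    have hbk1 := (f (k + 1)).isLt
    have hk1 : (k + 1).val = if k = Fin.last M then 0 else k.val + 1 := Fin.val_add_one k
    rw [fin_val_sub, fin_val_sub]
    split_ifs at hk1 with hk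
    · have hk' : k.val = M := by rw [hk, Fin.val_last]
      have q1 := hlt (i := k + 1) (j := l) (by omega)
      have q2 := hlt (i := l) (j := k) (by omega)
      split_ifs <;> omega
    · have q1 := hlt (i := k) (j := k + 1) (by omega)
      rcases Nat.lt_or_gt_of_ne hkl' with h | h
      · have q2 := hlt (i := k + 1) (j := l) (by omega)
        split_ifs <;> omega
      · have q2 := hlt h
        split_ifs <;> omega
  refine ⟨M + 1, inferInstance, f, hmono, ⟨by omega, hσ, fun i => hW.mem_sphere _,
    fun i j h1 h2 => ?_⟩, fun j i => ?_⟩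
  · exact (hedge i).2 _ (fun h => h1 (hmono.injective h)) fun h => h2 (hmono.injective h)
  · simp only [Function.comp_apply]
    by_cases h1 : j = f i
    · rw [h1, triple_self_left, mul_zero]
    by_cases h2 : j = f (i + 1)
    · rw [h2, triple_self_right, mul_zero]
    exact ((hedge i).2 j h1 h2).le

end Hull

/-- Moving `y` slightly towards `-σ • W j` turns the weak inequality into a strict, hence open, one.
-/
theorem exists_inner_neg {n : ℕ} {W : Fin n → E3} {σ : ℝ} (hW : ∀ i, W i ∈ unitSphere) (hσ : σ * σ = 1) {y : E3}
    (hy : y ∈ unitSphere) {j : Fin n} (hj : σ * inner ℝ y (W j) ≤ 0) {U : Set E3} (hU : U ∈ 𝓝 y) :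
    ∃ z ∈ U, z ∈ unitSphere ∧ σ * inner ℝ z (W j) < 0 := by
  set p : ℝ → E3 := fun t => y - t • σ • W j with hp
  have hp0 : p 0 = y := by simp [hp]
  have hy1 : ‖y‖ = 1 := by simpa [unitSphere] using hy
  have hpc : Continuous p := by fun_prop
  have hc : ContinuousAt (fun t => ‖p t‖⁻¹ • p t) 0 :=
    (hpc.norm.continuousAt.inv₀ (by rw [hp0, hy1]; exact one_ne_zero)).smul hpc.continuousAt
  have h0 : Tendsto (fun t => ‖p t‖⁻¹ • p t) (𝓝[>] 0) (𝓝 y) := by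
    have := hc.tendsto
    rw [hp0, hy1, inv_one, one_smul] at this
    exact this.mono_left nhdsWithin_le_nhds
  obtain ⟨t, ht, ht0⟩ := ((h0.eventually hU).and self_mem_nhdsWithin).exists
  have h1 : σ * inner ℝ (p t) (W j) < 0 := by
    have : σ * inner ℝ (p t) (W j) = σ * inner ℝ y (W j) - t := by
      simp only [hp]
      rw [inner_sub_left, real_inner_smul_left, real_inner_smul_left, mem_unitSphere.1 (hW j)]
      linear_combination -t * hσ
    rw [this]
    have : 0 < t := ht0
    linarith
  have h2 : p t ≠ 0 := fun h => by
    rw [h, inner_zero_left, mul_zero] at h1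
    exact lt_irrefl _ h1
  refine ⟨_, ht, inv_norm_smul_mem_unitSphere h2, ?_⟩
  rw [real_inner_smul_left, mul_left_comm]
  exact mul_neg_of_pos_of_neg (inv_pos.2 (norm_pos_iff.2 h2)) h1

/-! ### Positive layers. -/

section Layers

variable {n : ℕ} [NeZero n] {W : Fin n → E3} {ξ : E3} {σ : ℝ}

/-- The points of the sphere whose products with all vertices have the sign `σ`. -/
def dualRegion (σ : ℝ) (W : Fin n → E3) : Set E3 :=
  {x | x ∈ unitSphere ∧ ∀ j, 0 < σ * inner ℝ x (W j)}

/-- The hull vertices of `W` turn to the side `σ`. -/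
def HasTurnSign (σ : ℝ) (W : Fin n → E3) : Prop :=
  ∀ a, IsHullVertex W a → 0 < σ * triple (W (a - 1)) (W a) (W (a + 1))

theorem InGeneralPosition.triple_consecutive_ne (hgen : InGeneralPosition W) (h3 : 3 ≤ n)
    (i : Fin n) : triple (W i) (W (i + 1)) (W (i + 1 + 1)) ≠ 0 :=
  hgen _ _ _ (fin_ne_add_one h3 i) (fin_ne_add_one h3 (i + 1)) (fin_add_two_ne h3 i).symm

/-- A positive index forces a hemisphere, where the index is 0 or 1. Evaluating it at every hull
vertex shows that all of them turn to the same side. -/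
theorem HasWinding.exists_sign (hW : IsSimplePolygon W) (hgen : InGeneralPosition W) {m : ℤ}
    (hx : ∀ i, inner ℝ ξ (W i) ≠ 0) (hm : 1 ≤ m) (h : HasWinding W ξ m) :
    m = 1 ∧ ∃ σ, σ * σ = 1 ∧ ξ ∈ dualRegion σ W ∧ HasTurnSign σ W := by
  obtain ⟨-, hξ, -, e⟩ := h.polarIndex_eq
  have ht := hgen.triple_consecutive_ne hW.three_le
  have hm' : (1 : ℝ) ≤ m := by exact_mod_cast hm
  obtain ⟨σ, hσ, hpos⟩ := exists_sign_of_polarIndex_pos hW hξ hx ht (by linarith)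
  have key : ∀ a, IsHullVertex W a →
      m = 1 ∧ 0 < σ * triple (W (a - 1)) (W a) (W (a + 1)) := by
    rintro a ⟨g, g0, g1⟩
    rw [polarIndex_of_hemisphere hW hξ hσ hpos ht a g0 g1] at e
    split_ifs at e with h
    · exact ⟨by exact_mod_cast e.symm, h⟩
    · linarith
  obtain ⟨a, ha⟩ := exists_isHullVertex hW.three_le hW.mem_sphere hgen hpos
  exact ⟨(key a ha).1, σ, hσ, ⟨hξ, hpos⟩, fun a ha => (key a ha).2⟩

/-- The sign depends on the polygon only, so all points of positive winding number belong to the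
same dual region. -/
theorem HasTurnSign.unique {τ : ℝ} (hσ : σ * σ = 1) (hτ : τ * τ = 1) {a : Fin n}
    (ha : IsHullVertex W a) (h : HasTurnSign σ W) (h' : HasTurnSign τ W) : τ = σ := by
  have h1 := h a ha
  have h2 := h' a ha
  rcases mul_self_eq_one_iff.1 hσ with rfl | rfl <;> rcases mul_self_eq_one_iff.1 hτ with rfl | rfl
  · rfl
  · linarith
  · linarith
  · rfl

theorem isPreconnected_dualRegion (σ : ℝ) (W : Fin n → E3) : IsPreconnected (dualRegion σ W) := by
  have hC : Convex ℝ {v : E3 | ∀ j, 0 < σ * inner ℝ v (W j)} := by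
    intro x hx y hy a b ha hb hab j
    have e : σ * inner ℝ (a • x + b • y) (W j)
        = a * (σ * inner ℝ x (W j)) + b * (σ * inner ℝ y (W j)) := by
      rw [inner_add_left, real_inner_smul_left, real_inner_smul_left]; ring
    rw [e]
    have h1 := hx j
    have h2 := hy j
    rcases ha.eq_or_lt with rfl | ha
    · rw [zero_add] at hab; rw [hab]; linarith
    · have := mul_nonneg hb h2.le
      have := mul_pos ha h1
      linarith
  have hne : ∀ v : E3, (∀ j, 0 < σ * inner ℝ v (W j)) → v ≠ 0 := by
    rintro v hv rfl
    have := hv 0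
    rw [inner_zero_left, mul_zero] at this
    exact lt_irrefl _ this
  have := hC.isPreconnected.image (fun v : E3 => ‖v‖⁻¹ • v) fun v hv =>
    ((continuous_norm.continuousAt.inv₀ (norm_ne_zero_iff.2 (hne v hv))).smul
      continuousAt_id).continuousWithinAt
  convert this using 1
  ext x
  constructor
  · rintro ⟨hx, hx'⟩
    refine ⟨x, hx', ?_⟩
    have : ‖x‖ = 1 := by simpa [unitSphere] using hx
    simp [this]
  · rintro ⟨v, hv, rfl⟩
    refine ⟨inv_norm_smul_mem_unitSphere (hne v hv), fun j => ?_⟩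
    have h1 := inv_pos.2 (norm_pos_iff.2 (hne v hv))
    rw [real_inner_smul_left, mul_left_comm]
    exact mul_pos h1 (hv j)

theorem dualRegion_subset (σ : ℝ) (W : Fin n → E3) :
    dualRegion σ W ⊆ unitSphere \ trace (polar W) := fun x hx => ⟨hx.1, fun h => by
  obtain ⟨i, hi⟩ := inner_eq_zero_of_mem_trace h
  have := hx.2 i
  rw [hi, mul_zero] at this
  exact lt_irrefl _ this⟩

/-- Near the points of a layer, there are points off all great circles that are polar to vertices,
with prescribed further open conditions. -/
theorem exists_hasWinding_of_mem_nhds (hW : ∀ i, W i ∈ unitSphere) {k : ℕ} {U : Set E3}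
    (hU : IsOpen U) (h : ∀ ξ ∈ U, ξ ∈ unitSphere \ trace (polar W) →
      ∃ m : ℤ, (k : ℤ) ≤ m ∧ HasWinding W ξ m) {z : E3} (hz : z ∈ U) (hz' : z ∈ unitSphere) :
    ∃ ξ ∈ U, (∀ i, inner ℝ ξ (W i) ≠ 0) ∧ ∃ m : ℤ, (k : ℤ) ≤ m ∧ HasWinding W ξ m := by
  obtain ⟨ξ, hξ, hξ1, hξ2⟩ := mem_closure_iff.1 (mem_closure_inner_ne hW hz') U hU hz
  refine ⟨ξ, hξ, hξ2, h ξ hξ ⟨hξ1, fun ht => ?_⟩⟩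
  obtain ⟨i, hi⟩ := inner_eq_zero_of_mem_trace ht
  exact hξ2 i hi

theorem exists_isOpen_of_mem_layerSet {k : ℕ} {x : E3} (hx : x ∈ layerSet W k) :
    ∃ U, IsOpen U ∧ x ∈ U ∧ ∀ ξ ∈ U, ξ ∈ unitSphere \ trace (polar W) →
      ∃ m : ℤ, (k : ℤ) ≤ m ∧ HasWinding W ξ m := by
  obtain ⟨U, hU, hxU, h⟩ := mem_nhdsWithin.1 hx.2.2
  exact ⟨U, hU, hxU, fun ξ h1 h2 => h ⟨h1, h2⟩⟩

/-- The points of positive winding number are those that see all vertices on the same side. -/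
theorem exists_layerSet_eq (hW : IsSimplePolygon W) (hgen : InGeneralPosition W) {k : ℕ}
    (hk : 1 ≤ k) {x : E3} (hx : x ∈ layerSet W k) :
    k = 1 ∧ ∃ σ, σ * σ = 1 ∧ HasTurnSign σ W ∧ (dualRegion σ W).Nonempty ∧
      layerSet W 1 = dualRegion σ W := by
  have hk' : (1 : ℤ) ≤ k := by exact_mod_cast hk
  obtain ⟨U, hU, hxU, h⟩ := exists_isOpen_of_mem_layerSet hx
  obtain ⟨ξ, -, hξ, m, hm, hw⟩ := exists_hasWinding_of_mem_nhds hW.mem_sphere hU h hxU hx.1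
  obtain ⟨rfl, σ, hσ, hξσ, hturn⟩ := hw.exists_sign hW hgen hξ (by omega)
  obtain ⟨a, ha⟩ := exists_isHullVertex hW.three_le hW.mem_sphere hgen hξσ.2
  refine ⟨by omega, σ, hσ, hturn, ⟨ξ, hξσ⟩, Subset.antisymm (fun y hy => ⟨hy.1, fun j => ?_⟩)
    fun y hy => ⟨hy.1, ?_, ?_⟩⟩
  -- Near a point of the layer on the wrong side of `W j` there is a generic point that is strictly
  -- on the wrong side and still has positive winding number, against the uniqueness of the sign.
  · by_contra hj
    obtain ⟨U, hU, hyU, h⟩ := exists_isOpen_of_mem_layerSet hy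
    obtain ⟨z, hzU, hz, hzj⟩ := exists_inner_neg hW.mem_sphere hσ hy.1 (not_lt.1 hj)
      (hU.mem_nhds hyU)
    have ho : IsOpen {v : E3 | σ * inner ℝ v (W j) < 0} :=
      isOpen_lt (by fun_prop) continuous_const
    obtain ⟨ζ, hζ, hζ', m, hm, hw⟩ := exists_hasWinding_of_mem_nhds hW.mem_sphere (hU.inter ho)
      (fun ξ hξ => h ξ hξ.1) ⟨hzU, hzj⟩ hz
    obtain ⟨-, τ, hτ, hζτ, hturn'⟩ := hw.exists_sign hW hgen hζ' (by exact_mod_cast hm)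
    have h1 := hζτ.2 j
    rw [HasTurnSign.unique hσ hτ ha hturn hturn'] at h1
    exact lt_asymm h1 hζ.2
  · rintro ⟨i, rfl⟩
    have := hy.2 i
    rw [inner_polar_left, mul_zero] at this
    exact lt_irrefl _ this
  · have ho : IsOpen (⋂ j, {v : E3 | 0 < σ * inner ℝ v (W j)}) :=
      isOpen_iInter_of_finite fun j => isOpen_lt continuous_const (by fun_prop)
    refine mem_nhdsWithin.2 ⟨_, ho, mem_iInter.2 hy.2, fun η hη => ⟨1, le_rfl, ?_⟩⟩
    -- The dual region is connected and avoids the polar polygon, so one point with winding number 1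
    -- spreads this value over the region.
    refine HasWinding.component W ξ η 1 ?_ hw
    exact (isPreconnected_dualRegion σ W).subset_connectedComponentIn hξσ (dualRegion_subset σ W)
      ⟨hη.2.1, mem_iInter.1 hη.1⟩

theorem eq_dualRegion_of_mem_layers (hW : IsSimplePolygon W) (hgen : InGeneralPosition W) {k : ℕ}
    (hk : 1 ≤ k) {L : Set E3} (hL : L ∈ layers W k) :
    k = 1 ∧ L = layerSet W 1 ∧ ∃ σ, σ * σ = 1 ∧ HasTurnSign σ W ∧ (dualRegion σ W).Nonempty ∧
      layerSet W 1 = dualRegion σ W := by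
  obtain ⟨x, hx, rfl⟩ := hL
  obtain ⟨rfl, σ, hσ, hturn, hne, e⟩ := exists_layerSet_eq hW hgen hk hx
  refine ⟨rfl, ?_, σ, hσ, hturn, hne, e⟩
  rw [e] at hx ⊢
  exact (isPreconnected_dualRegion σ W).connectedComponentIn hx

theorem numPositiveLayers_le_one (hW : IsSimplePolygon W) (hgen : InGeneralPosition W) :
    numPositiveLayers W ≤ 1 := by
  -- The summand with index 0 belongs to level 1, the only level that can occur.
  rw [numPositiveLayers, tsum_eq_single 0]
  · exact Set.encard_le_one_iff.2 fun L L' hL hL' => by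
      rw [(eq_dualRegion_of_mem_layers hW hgen le_rfl hL).2.1,
        (eq_dualRegion_of_mem_layers hW hgen le_rfl hL').2.1]
  · intro k hk
    refine Set.encard_eq_zero.2 (eq_empty_iff_forall_notMem.2 fun L hL => hk ?_)
    have := (eq_dualRegion_of_mem_layers hW hgen (by omega) hL).1
    omega

/-- The polar polygon turns left at its vertices in the closure of the dual region. -/
theorem triple_polar_pos_of_mem_closure (hW : IsSimplePolygon W) (hgen : InGeneralPosition W)
    (hσ : σ * σ = 1) {i : Fin n} (h : polar W i ∈ closure (dualRegion σ W)) :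
    0 < triple (polar W (i - 1)) (polar W i) (polar W (i + 1)) := by
  have h3 := hW.three_le
  have hσ0 : σ ≠ 0 := by rintro rfl; simp at hσ
  obtain ⟨k, rfl⟩ : ∃ k, i = k + 1 := ⟨i - 1, (sub_add_cancel i 1).symm⟩
  have hcross : ∀ l, 0 < ‖cross (W l) (W (l + 1))‖⁻¹ := fun l =>
    inv_pos.2 (norm_pos_iff.2 (hW.isRegularPolygon.cross_ne l))
  have hcl : ∀ j, 0 ≤ σ * inner ℝ (polar W (k + 1)) (W j) := fun j => by
    have hc : IsClosed {v : E3 | 0 ≤ σ * inner ℝ v (W j)} :=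
      isClosed_le continuous_const (by fun_prop)
    exact closure_minimal (fun v hv => (hv.2 j).le) hc h
  have hpos : ∀ j, j ≠ k + 1 → j ≠ k + 1 + 1 →
      0 < σ * triple (W (k + 1)) (W (k + 1 + 1)) (W j) := fun j h1 h2 => by
    have h4 := hcl j
    rw [polar, real_inner_smul_left, mul_left_comm] at h4
    exact lt_of_le_of_ne (nonneg_of_mul_nonneg_right h4 (hcross _))
      (mul_ne_zero hσ0 (hgen _ _ _ (fin_ne_add_one h3 _) h2.symm h1.symm)).symm
  -- Both neighbours of the edge `k + 1` lie on the side `σ`. The turn of the polar polygon has the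
  -- sign of the product of these two triple products, so `σ` cancels.
  have p1 := hpos k (fin_ne_add_one h3 k) (fin_add_two_ne h3 k).symm
  have p2 := hpos (k + 1 + 1 + 1) (fin_add_two_ne h3 _) (fin_ne_add_one h3 _).symm
  rw [← triple_rotate] at p1
  rw [triple_rotate] at p2
  have p3 := mul_pos p1 p2
  rw [add_sub_cancel_right, triple_polar_polar]
  refine mul_pos (hcross _) (mul_pos (hcross _) ?_)
  have e : inner ℝ (polar W (k + 1 + 1)) (W (k + 1)) = ‖cross (W (k + 1 + 1))
      (W (k + 1 + 1 + 1))‖⁻¹ * triple (W (k + 1 + 1)) (W (k + 1 + 1 + 1)) (W (k + 1)) := by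
    rw [polar, real_inner_smul_left, triple]
  rw [e, mul_left_comm]
  refine mul_pos (hcross _) ?_
  linear_combination p3 + (triple (W k) (W (k + 1)) (W (k + 1 + 1)) *
    triple (W (k + 1 + 1)) (W (k + 1 + 1 + 1)) (W (k + 1))) * hσ

end Layers

end

/-! ### The proposition. -/

theorem proposition4 {n : ℕ} [NeZero n] (W : Fin n → E3)
    (hW : IsSimplePolygon W) (hgen : InGeneralPosition W) :
    numPositiveLayers W ≤ 1 ∧
    ∀ k : ℕ, 1 ≤ k → ∀ L ∈ layers W k,
      (∃ (m : ℕ) (_ : NeZero m) (f : Fin m → Fin n),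
        StrictMono f ∧
        IsConvexPolygon (W ∘ f) ∧
        vertexStar (W ∘ f) = frontier (convexHull ℝ (vertexStar W)) ∧
        L = leftRegion (polar (W ∘ f)) ∧
        IsConvexPolygon (polar (W ∘ f)) ∧
        (∀ i, 0 < triple (polar (W ∘ f) (i - 1)) (polar (W ∘ f) i) (polar (W ∘ f) (i + 1)))) ∧
      (∀ i, polar W i ∈ closure L →
        0 < triple (polar W (i - 1)) (polar W i) (polar W (i + 1))) := by
  refine ⟨numPositiveLayers_le_one hW hgen, fun k hk L hL => ?_⟩
  obtain ⟨-, hL1, σ, hσ, hturn, ⟨ξ, hξ⟩, e⟩ := eq_dualRegion_of_mem_layers hW hgen hk hL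
  rw [e] at hL1
  subst hL1
  obtain ⟨m, hm, f, hf, hV, hcone⟩ := exists_isOneSidedPolygon_comp hW hgen hξ.1 hσ hξ.2
    (hgen.triple_consecutive_ne hW.three_le) hturn
  refine ⟨⟨m, hm, f, hf, hV.isConvexPolygon, ?_, ?_, hV.isOneSidedPolygon_polar.isConvexPolygon,
    fun i => ?_⟩, fun i hi => triple_polar_pos_of_mem_closure hW hgen hσ hi⟩
  · rw [hV.convexHull_vertexStar hcone, hV.frontier_sideCone]
  · rw [hV.leftRegion_polar_comp hW.mem_sphere hcone]; rfl
  · have := hV.isOneSidedPolygon_polar.triple_pos (i - 1)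
    rwa [one_mul, sub_add_cancel] at this
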